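/- For $T>0$ and $h:\mathbb{R}\to\mathbb{C}$ write $\mathbb{E}_{[-T,T]}|h|^2=\frac1{2T}\int_{-T}^{T}|h(t)|^2\,dt$. For an integer $k\ge 1$ and reals $F,T>0$ let $$R=R(k,F,T)=\sup_{g}\ \frac{\sup_{t\in[-T,T]}|g(t)|^2}{\mathbb{E}_{[-T,T]}|g|^2},$$ the supremum being over all nonzero $g(t)=\sum_{j=1}^k v_je^{2\pi i f_jt}$ with $v_j\in\mathbb{C}$ and $f_j\in[-F,F]$. **Theorem.** There are universal constants $\epsilon,A,B,C>0$ and $a,b,c\in\mathbb{N}$ and one randomized algorithm with the following properties. Let $k\ge1$, $F>0$, $T>0$, $\Delta\ge0$, $0<\delta<1$, let $R=R(k,F,T)$ and $$\Delta'=\Delta+\frac{A\,R\,\log^a(R+1)}{T}.$$ Then $R<\infty$ and $$\Delta'\le\Delta+\frac{B\,k^3\log^b(k+1)}{T},$$ that is, $\Delta'=\Delta+\widetilde O(R)/T=\Delta+\widetilde O(k^3)/T$. Let further $f_0\in[-F,F]$, let $g(t)=\sum_{i=1}^k v_ie^{2\pi i f_it}$ be not identically zero with all $f_i\in[f_0-\Delta,f_0+\Delta]$,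 and let $y(t)=g(t)+\eta(t)$ be observable for $t\in[-T,T]$ only, where $\eta$ is any measurable function with $\mathbb{E}_{[-T,T]}|\eta|^2\le\epsilon\,\mathbb{E}_{[-T,T]}|g|^2$. Given $k,F,T,\Delta,\delta,R$ and access to samples of $y$ at points of its choice (which it may choose at random, from any distribution on $[-T,T]$ that it can generate from independent uniform reals), the algorithm always takes at most $$C\,k\log^2(k+1)\,\max\Big(0,\log\frac{F}{\Delta'\delta}\Big)$$ samples of $y$ and at most $C\big(k\,(1+\max(0,\log\frac{F}{\Delta'\delta}))\big)^c$ steps (unit-cost exact real arithmetic, comparisons, elementary functions and uniform random reals), and outputs $\widetilde f$ with $|f_0-\widetilde f|\le C\Delta'$ with probability at least $1-\delta$. -/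

import Mathlib

open scoped ENNReal

noncomputable section

namespace ClusteredSignal

/-! ### Signals -/

/-- The `k`-Fourier-sparse signal `g(t) = ∑ j, v j * exp (2 π i (f j) t)`. -/
def sparseSignal {k : ℕ} (v : Fin k → ℂ) (f : Fin k → ℝ) (t : ℝ) : ℂ :=
  ∑ j, v j * Complex.exp (2 * Real.pi * Complex.I * f j * t)

/-- The average of `|h t|^2` for `t` uniform in `[-T, T]`, as an extended nonnegative real
(so it is `⊤` if `h` is not square integrable there). -/
def meanSq (T : ℝ) (h : ℝ → ℂ) : ℝ≥0∞ :=
  (∫⁻ t in Set.Icc (-T) T, ‖h t‖ₑ ^ 2) / ENNReal.ofReal (2 * T)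

/-- The largest ratio between the maximum and the average of `|g|^2` over `[-T, T]`, over all
signals `g` with `k` frequencies in `[-F, F]`. In `ℝ≥0∞` one has `0 / 0 = 0`, so that `g = 0`
does not contribute to the supremum. -/
def worstRatio (k : ℕ) (F T : ℝ) : ℝ≥0∞ :=
  ⨆ (v : Fin k → ℂ) (f : Fin k → ℝ) (_ : ∀ j, f j ∈ Set.Icc (-F) F),
    (⨆ t ∈ Set.Icc (-T) T, ‖sparseSignal v f t‖ₑ ^ 2) / meanSq T (sparseSignal v f)

/-- What can be observed of a signal `z`: its values on `[-T, T]`. Outside, an algorithm learns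
nothing (it reads `0`). -/
def observed (T : ℝ) (z : ℝ → ℂ) : ℝ → ℂ :=
  (Set.Icc (-T) T).indicator z

/-! ### Algorithms

A while language for a randomized real RAM with sample access to a complex-valued signal. The
machine has natural-number registers, a memory of reals addressed by natural numbers, exact real
arithmetic and elementary functions, comparisons, a source of independent uniform reals in
`[0, 1]`, and an instruction that samples the signal at a computed point. There is no rounding
from reals to integers and no real constant other than naturals and `π`. -/

/-- Natural-number expressions. -/
inductive NatExp where
  | lit (n : ℕ)
  | reg (i : ℕ)
  | add (a b : NatExp)
  | sub (a b : NatExp)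

/-- Real expressions; `cell a` is the content of the memory cell with address `a`. -/
inductive RealExp where
  | ofNat (a : NatExp)
  | pi
  | cell (a : NatExp)
  | add (a b : RealExp)
  | sub (a b : RealExp)
  | mul (a b : RealExp)
  | div (a b : RealExp)
  | sqrt (a : RealExp)
  | exp (a : RealExp)
  | log (a : RealExp)
  | sin (a : RealExp)
  | cos (a : RealExp)

/-- Tests. -/
inductive Test where
  | natLe (a b : NatExp)
  | realLe (a b : RealExp)

/-- Programs. -/
inductive Program where
  | skip
  /-- write a natural number into register `i` -/
  | setReg (i : ℕ) (e : NatExp)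
  /-- write a real number into the memory cell with address `a` -/
  | setCell (a : NatExp) (e : RealExp)
  /-- write a fresh uniform random element of `[0, 1]` into the memory cell with address `a` -/
  | rand (a : NatExp)
  /-- sample the signal at the point `e`, and write the real and the imaginary part of the
  value into the memory cells with addresses `a` and `a + 1` -/
  | sample (a : NatExp) (e : RealExp)
  | seq (p q : Program)
  | ite (b : Test) (p q : Program)
  | loop (b : Test) (p : Program)

/-- A configuration: the registers, the memory, and the numbers of random reals drawn, of samples
taken and of steps made so far. -/
structure State where
  reg : ℕ → ℕ
  cell : ℕ → ℝ
  drawn : ℕ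
  samples : ℕ
  steps : ℕ

/-- The value of a natural-number expression (subtraction is truncated at `0`). -/
def NatExp.eval (s : State) : NatExp → ℕ
  | .lit n => n
  | .reg i => s.reg i
  | .add a b => a.eval s + b.eval s
  | .sub a b => a.eval s - b.eval s

/-- The value of a real expression. -/
def RealExp.eval (s : State) : RealExp → ℝ
  | .ofNat a => (a.eval s : ℝ)
  | .pi => Real.pi
  | .cell a => s.cell (a.eval s)
  | .add a b => a.eval s + b.eval s
  | .sub a b => a.eval s - b.eval s
  | .mul a b => a.eval s * b.eval s
  | .div a b => a.eval s / b.eval s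
  | .sqrt a => Real.sqrt (a.eval s)
  | .exp a => Real.exp (a.eval s)
  | .log a => Real.log (a.eval s)
  | .sin a => Real.sin (a.eval s)
  | .cos a => Real.cos (a.eval s)

/-- The truth of a test. -/
def Test.holds (s : State) : Test → Prop
  | .natLe a b => a.eval s ≤ b.eval s
  | .realLe a b => a.eval s ≤ b.eval s

/-- One more step. -/
def State.tick (s : State) : State :=
  { s with steps := s.steps + 1 }

/-- `Exec y ω p s s'`: with sample access to the signal `y` and with the random reals
`ω 0, ω 1, …`, the program `p` started in `s` halts in `s'`. Every assignment, random draw, sample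
and test is one step; the size of the expressions in a fixed program is bounded, so evaluating
them changes the count by a constant factor only. -/
inductive Exec (y : ℝ → ℂ) (ω : ℕ → unitInterval) : Program → State → State → Prop
  | skip (s : State) : Exec y ω .skip s s
  | setReg (i : ℕ) (e : NatExp) (s : State) :
      Exec y ω (.setReg i e) s
        { s.tick with reg := Function.update s.reg i (e.eval s) }
  | setCell (a : NatExp) (e : RealExp) (s : State) :
      Exec y ω (.setCell a e) s
        { s.tick with cell := Function.update s.cell (a.eval s) (e.eval s) }
  | rand (a : NatExp) (s : State) :
      Exec y ω (.rand a) s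
        { s.tick with
          cell := Function.update s.cell (a.eval s) (ω s.drawn : ℝ)
          drawn := s.drawn + 1 }
  | sample (a : NatExp) (e : RealExp) (s : State) :
      Exec y ω (.sample a e) s
        { s.tick with
          cell := Function.update
            (Function.update s.cell (a.eval s) (y (e.eval s)).re)
            (a.eval s + 1) (y (e.eval s)).im
          samples := s.samples + 1 }
  | seq {p q : Program} {s s' s'' : State} :
      Exec y ω p s s' → Exec y ω q s' s'' → Exec y ω (.seq p q) s s''
  | iteTrue {b : Test} {p q : Program} {s s' : State} :
      b.holds s → Exec y ω p s.tick s' → Exec y ω (.ite b p q) s s'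
  | iteFalse {b : Test} {p q : Program} {s s' : State} :
      ¬ b.holds s → Exec y ω q s.tick s' → Exec y ω (.ite b p q) s s'
  | loopTrue {b : Test} {p : Program} {s s' s'' : State} :
      b.holds s → Exec y ω p s.tick s' → Exec y ω (.loop b p) s' s'' →
      Exec y ω (.loop b p) s s''
  | loopFalse {b : Test} {p : Program} {s : State} :
      ¬ b.holds s → Exec y ω (.loop b p) s s.tick

/-- Execution is deterministic once the signal and the random reals are fixed. -/
theorem Exec.unique {y : ℝ → ℂ} {ω : ℕ → unitInterval} {p : Program} {s s₁ : State}
    (h₁ : Exec y ω p s s₁) : ∀ {s₂ : State}, Exec y ω p s s₂ → s₁ = s₂ := by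
  induction h₁ with
  | skip | setReg | setCell | rand | sample => intro s₂ h₂; cases h₂; rfl
  | seq _ _ ih₁ ih₂ =>
    intro s₂ h₂
    cases h₂ with
    | seq a b => cases ih₁ a; exact ih₂ b
  | iteTrue hb _ ih =>
    intro s₂ h₂
    cases h₂ with
    | iteTrue _ a => exact ih a
    | iteFalse hb' _ => exact absurd hb hb'
  | iteFalse hb _ ih =>
    intro s₂ h₂
    cases h₂ with
    | iteTrue hb' _ => exact absurd hb' hb
    | iteFalse _ a => exact ih a
  | loopTrue hb _ _ ih₁ ih₂ =>
    intro s₂ h₂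
    cases h₂ with
    | loopTrue _ a b => cases ih₁ a; exact ih₂ b
    | loopFalse hb' => exact absurd hb hb'
  | loopFalse hb =>
    intro s₂ h₂
    cases h₂ with
    | loopTrue hb' _ _ => exact absurd hb' hb
    | loopFalse _ => rfl

/-- The initial configuration: `k` in register `0`, and `F, T, Δ, δ, R` in the cells `0, …, 4`. -/
def initial (k : ℕ) (F T Δ δ R : ℝ) : State where
  reg := fun i => if i = 0 then k else 0
  cell := fun i => [F, T, Δ, δ, R].getD i 0
  drawn := 0
  samples := 0
  steps := 0

/-- The law of the random reals: independent and uniform in `[0, 1]`. -/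
def coinLaw : MeasureTheory.Measure (ℕ → unitInterval) :=
  MeasureTheory.Measure.infinitePi fun _ =>
    (MeasureTheory.volume : MeasureTheory.Measure unitInterval)

end ClusteredSignal

end

open ClusteredSignal

noncomputable section

namespace ClusteredSignal

open MeasureTheory Set Finset

/-! ### Triangular form of a diagonalizable operator in an orthonormal basis -/

section Triangular

open InnerProductSpace Submodule

variable {E : Type*} [NormedAddCommGroup E] [InnerProductSpace ℂ E]

/-! Write D = Δ + R/T. The proof rests on one algebraic fact. Apply Gram–Schmidt to the exponentials
in L²(ν). Differentiation, which is diagonal on the exponentials, becomes triangular with the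
imaginary numbers 2πi f_j on the diagonal (`exists_gram_basis`). A regularizer μ Σ|v_j|² keeps the
form definite when frequencies coincide, and μ tends to 0 at the end of each estimate.

Three analytic bounds follow. Averaging the reproducing kernel over a window gives |g(t)|² ≲ k ∫|g|²
/ dist(t, ±T) (`norm_sq_le_interior`). With an exponential weight on a half line, integration by
parts and the imaginary diagonal bound each basis element at the endpoint
(`norm_sq_zero_le_half_line`). Together with a growth bound from linear recurrences this gives R ≤
16k³ (`worstRatio_le`). On [-T,T] the derivative is skew-adjoint up to a boundary form of rank two,
so triangularity determines its off-diagonal entries by boundary values. Hence ‖g'‖ ≤ (2πΔ + R/T)‖g‖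
for frequencies in [-Δ,Δ] (`integral_norm_sq_deriv_le`). After demodulation by f₀, the relation
g(t+β) ≈ e^{2πi f₀β} g(t) holds in mean square as soon as βD is small.

Sampling with density proportional to 1/((T+T/R)² − t²) makes the weighted values of |g|² bounded by
O(k log R) times the energy. Then O(k log R) samples estimate the energy within a factor
(`measure_sampleSum_lt_le`), and the empirical correlation of y with its shift has nearly the phase
2πf₀β (`norm_correlation_sub_le`). A random dilation of β makes aliasing unlikely. One step at
resolution w is therefore correct with probability at least 499/500: it refines a good candidate or
rejects a bad one (`measure_not_stepCorrect_le`).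

Making every step reliable would cost an extra factor. Instead, the search tolerates errors: a
rejected candidate sends it back to a coarser resolution. A potential rises by one at a correct step
until it reaches the final depth L, and drops by at most seven at a wrong one. An exponential moment
shows that more than N/40 wrong steps among N ≈ 40 log(F/(Dδ)) have probability at most δ. Otherwise
most recorded candidates are good, and any candidate near a majority of the others is good
(`card_good_candidates`, `close_of_closeCount`). The remaining lemmas show that the program `locate`
carries out this search. -/

/-- An operator with an eigenbasis is triangular in some orthonormal basis, with the eigenvalues
on the diagonal. -/
theorem exists_orthonormalBasis_triangular {k : ℕ} (b : Module.Basis (Fin k) ℂ E)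
    (D : E →ₗ[ℂ] E) (l : Fin k → ℂ) (hD : ∀ j, D (b j) = l j • b j) :
    ∃ φ : OrthonormalBasis (Fin k) ℂ E, (∀ i, inner ℂ (φ i) (D (φ i)) = l i) ∧
      ∀ i j, j < i → inner ℂ (φ i) (D (φ j)) = 0 := by
  classical
  have hon : Orthonormal ℂ (gramSchmidtNormed ℂ b) :=
    gramSchmidtNormed_orthonormal b.linearIndependent
  have hsp : ⊤ ≤ span ℂ (Set.range (gramSchmidtNormed ℂ b)) := by
    rw [span_gramSchmidtNormed_range, span_gramSchmidt, b.span_eq]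
  let φ := OrthonormalBasis.mk hon hsp
  have hφ : ∀ i, φ i = gramSchmidtNormed ℂ b i := fun i => by simp [φ]
  have hgs : ∀ i, φ i = ((‖gramSchmidt ℂ b i‖ : ℂ)⁻¹) • gramSchmidt ℂ b i := fun i => by
    rw [hφ]; rfl
  have hperp : ∀ i, ∀ x ∈ span ℂ (b '' Set.Iio i), inner ℂ (φ i) x = 0 := by
    intro i x hx
    rw [← span_gramSchmidt_Iio ℂ b i] at hx
    induction hx using span_induction with
    | mem x hx =>
      obtain ⟨j, hj, rfl⟩ := hx
      rw [hgs, inner_smul_left, gramSchmidt_orthogonal ℂ b (ne_of_gt hj), mul_zero]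
    | zero => simp
    | add x y _ _ hx hy => rw [inner_add_right, hx, hy, add_zero]
    | smul a x _ hx => rw [inner_smul_right, hx, mul_zero]
  have hDs : ∀ (s : Set (Fin k)), ∀ x ∈ span ℂ (b '' s), D x ∈ span ℂ (b '' s) := by
    intro s x hx
    induction hx using span_induction with
    | mem x hx =>
      obtain ⟨j, hj, rfl⟩ := hx
      rw [hD]
      exact smul_mem _ _ (subset_span ⟨j, hj, rfl⟩)
    | zero => simp
    | add x y _ _ hx hy => rw [map_add]; exact add_mem hx hy
    | smul a x _ hx => rw [map_smul]; exact smul_mem _ _ hx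
  have hφm : ∀ i, φ i ∈ span ℂ (b '' Set.Iic i) := by
    intro i
    rw [hgs]
    exact smul_mem _ _ (gramSchmidt_mem_span ℂ b le_rfl)
  refine ⟨φ, fun i => ?_, fun i j hij => ?_⟩
  -- The vector `b i` differs from its Gram–Schmidt vector by earlier basis vectors, and `D`
  -- preserves their span, so along `φ i` only the eigenvalue remains.
  · have hd : b i - gramSchmidt ℂ b i ∈ span ℂ (b '' Set.Iio i) := by
      rw [← span_gramSchmidt_Iio ℂ b i, gramSchmidt_def, sub_sub_cancel]
      refine sum_mem fun j hj => ?_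
      have : gramSchmidt ℂ b j ∈ span ℂ (gramSchmidt ℂ b '' Set.Iio i) :=
        subset_span ⟨j, Finset.mem_Iio.1 hj, rfl⟩
      exact (span_singleton_le_iff_mem _ _).2 this (starProjection_apply_mem _ _)
    have hdecomp : D (gramSchmidt ℂ b i) = l i • gramSchmidt ℂ b i
        + (l i • (b i - gramSchmidt ℂ b i) - D (b i - gramSchmidt ℂ b i)) := by
      rw [map_sub, hD, smul_sub]; abel
    have h1 : D (φ i) = l i • φ i + ((‖gramSchmidt ℂ b i‖ : ℂ)⁻¹) •
        (l i • (b i - gramSchmidt ℂ b i) - D (b i - gramSchmidt ℂ b i)) := by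
      rw [hgs, map_smul, hdecomp, smul_add, smul_comm]
    rw [h1, inner_add_right, inner_smul_right, inner_smul_right,
      hperp i _ (sub_mem (smul_mem _ _ hd) (hDs _ _ hd)), inner_self_eq_norm_sq_to_K]
    simp
  · refine hperp i _ ?_
    have h2 := hDs _ _ (hφm j)
    exact span_mono (image_mono (fun x hx => lt_of_le_of_lt hx hij)) h2

end Triangular

/-! ### Sparse signals -/

section Signals

variable {k : ℕ}

/-- The coefficients of the derivative of a signal. -/
def derivCoeff (f : Fin k → ℝ) : (Fin k → ℂ) →ₗ[ℂ] (Fin k → ℂ) where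
  toFun v j := 2 * Real.pi * Complex.I * f j * v j
  map_add' v w := by ext j; simp [mul_add]
  map_smul' a v := by ext j; simp; ring

theorem sparseSignal_add (v w : Fin k → ℂ) (f : Fin k → ℝ) (t : ℝ) :
    sparseSignal (v + w) f t = sparseSignal v f t + sparseSignal w f t := by
  simp [sparseSignal, add_mul, Finset.sum_add_distrib]

theorem sparseSignal_smul (a : ℂ) (v : Fin k → ℂ) (f : Fin k → ℝ) (t : ℝ) :
    sparseSignal (a • v) f t = a * sparseSignal v f t := by
  simp [sparseSignal, Finset.mul_sum, mul_assoc]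

/-- The value of a signal at a point, as a linear functional of the coefficients. -/
def evalAt (f : Fin k → ℝ) (t : ℝ) : (Fin k → ℂ) →ₗ[ℂ] ℂ where
  toFun v := sparseSignal v f t
  map_add' v w := sparseSignal_add v w f t
  map_smul' a v := by simp [sparseSignal_smul]

theorem evalAt_apply (f : Fin k → ℝ) (t : ℝ) (v : Fin k → ℂ) :
    evalAt f t v = sparseSignal v f t := rfl

theorem continuous_sparseSignal (v : Fin k → ℂ) (f : Fin k → ℝ) :
    Continuous (sparseSignal v f) := by
  unfold sparseSignal
  fun_prop

theorem hasDerivAt_sparseSignal (v : Fin k → ℂ) (f : Fin k → ℝ) (t : ℝ) :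
    HasDerivAt (sparseSignal v f) (sparseSignal (derivCoeff f v) f t) t := by
  unfold sparseSignal
  refine HasDerivAt.fun_sum fun j _ => ?_
  have h1 : HasDerivAt (fun t : ℝ => (2 * Real.pi * Complex.I * f j * t : ℂ))
      (2 * Real.pi * Complex.I * f j * 1) t :=
    (Complex.ofRealCLM.hasDerivAt (x := t)).const_mul _
  refine (h1.cexp.const_mul (v j)).congr_deriv ?_
  change _ = 2 * Real.pi * Complex.I * f j * v j * _
  ring

theorem sparseSignal_add_time (v : Fin k → ℂ) (f : Fin k → ℝ) (s t : ℝ) :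
    sparseSignal v f (s + t) =
      sparseSignal (fun j => v j * Complex.exp (2 * Real.pi * Complex.I * f j * s)) f t := by
  unfold sparseSignal
  refine Finset.sum_congr rfl fun j _ => ?_
  rw [mul_assoc (v j), ← Complex.exp_add]
  congr 2
  push_cast
  ring

theorem sparseSignal_neg_time (v : Fin k → ℂ) (f : Fin k → ℝ) (t : ℝ) :
    sparseSignal v f (-t) = sparseSignal v (fun j => -f j) t := by
  simp [sparseSignal]

theorem sparseSignal_sub_freq (v : Fin k → ℂ) (f : Fin k → ℝ) (f₀ t : ℝ) :
    sparseSignal v (fun j => f j - f₀) t =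
      Complex.exp (-(2 * Real.pi * Complex.I * f₀ * t)) * sparseSignal v f t := by
  unfold sparseSignal
  rw [Finset.mul_sum]
  refine Finset.sum_congr rfl fun j _ => ?_
  rw [mul_left_comm, ← Complex.exp_add]
  congr 2
  push_cast
  ring

theorem norm_exp_two_pi_I (x t : ℝ) : ‖Complex.exp (2 * Real.pi * Complex.I * x * t)‖ = 1 := by
  have : (2 * Real.pi * Complex.I * x * t : ℂ) = ((2 * Real.pi * x * t : ℝ) : ℂ) * Complex.I := by
    push_cast; ring
  rw [this, Complex.norm_exp_ofReal_mul_I]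

theorem norm_sparseSignal_le (v : Fin k → ℂ) (f : Fin k → ℝ) (t : ℝ) :
    ‖sparseSignal v f t‖ ≤ ∑ j, ‖v j‖ := by
  refine (norm_sum_le _ _).trans (le_of_eq ?_)
  simp only [norm_mul, norm_exp_two_pi_I, mul_one]

theorem integrable_sparseSignal_mul (ν : Measure ℝ) [IsFiniteMeasure ν] (v w : Fin k → ℂ)
    (f : Fin k → ℝ) :
    Integrable (fun t => starRingEnd ℂ (sparseSignal v f t) * sparseSignal w f t) ν := by
  refine Integrable.of_bound (C := (∑ j, ‖v j‖) * ∑ j, ‖w j‖) ?_ (ae_of_all _ fun t => ?_)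
  · exact ((Complex.continuous_conj.comp (continuous_sparseSignal v f)).mul
      (continuous_sparseSignal w f)).aestronglyMeasurable
  · rw [norm_mul, RCLike.norm_conj]
    exact mul_le_mul (norm_sparseSignal_le v f t) (norm_sparseSignal_le w f t) (norm_nonneg _)
      (Finset.sum_nonneg fun _ _ => norm_nonneg _)

theorem integrable_norm_sq_sparseSignal (ν : Measure ℝ) [IsFiniteMeasure ν] (v : Fin k → ℂ)
    (f : Fin k → ℝ) : Integrable (fun t => ‖sparseSignal v f t‖ ^ 2) ν := by
  refine Integrable.of_bound (C := (∑ j, ‖v j‖) ^ 2) ?_ (ae_of_all _ fun t => ?_)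
  · exact ((continuous_sparseSignal v f).norm.pow 2).aestronglyMeasurable
  · rw [norm_pow, norm_norm]
    exact pow_le_pow_left₀ (norm_nonneg _) (norm_sparseSignal_le v f t) 2

/-- The regularized Gram form of the exponentials with frequencies `f` in `L²(ν)`. -/
def gramForm (f : Fin k → ℝ) (ν : Measure ℝ) (μ : ℝ) (v w : Fin k → ℂ) : ℂ :=
  (∫ t, starRingEnd ℂ (sparseSignal v f t) * sparseSignal w f t ∂ν)
    + μ * ∑ j, starRingEnd ℂ (v j) * w j

theorem gramForm_self (f : Fin k → ℝ) (ν : Measure ℝ) (μ : ℝ) (v : Fin k → ℂ) :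
    gramForm f ν μ v v = ((∫ t, ‖sparseSignal v f t‖ ^ 2 ∂ν) + μ * ∑ j, ‖v j‖ ^ 2 : ℝ) := by
  unfold gramForm
  simp only [Complex.conj_mul']
  push_cast
  congr 1
  rw [← integral_complex_ofReal]
  simp

theorem conj_gramForm (f : Fin k → ℝ) (ν : Measure ℝ) (μ : ℝ) (v w : Fin k → ℂ) :
    starRingEnd ℂ (gramForm f ν μ w v) = gramForm f ν μ v w := by
  unfold gramForm
  simp only [map_add, map_mul, ← integral_conj, map_sum, Complex.conj_conj, Complex.conj_ofReal]
  simp only [mul_comm]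

theorem gramForm_add_left (f : Fin k → ℝ) (ν : Measure ℝ) [IsFiniteMeasure ν] (μ : ℝ)
    (u v w : Fin k → ℂ) :
    gramForm f ν μ (u + v) w = gramForm f ν μ u w + gramForm f ν μ v w := by
  unfold gramForm
  simp only [sparseSignal_add, map_add, add_mul, Pi.add_apply, Finset.sum_add_distrib, mul_add]
  rw [integral_add (integrable_sparseSignal_mul ν _ _ f) (integrable_sparseSignal_mul ν _ _ f)]
  ring

theorem gramForm_smul_left (f : Fin k → ℝ) (ν : Measure ℝ) (μ : ℝ) (v w : Fin k → ℂ) (a : ℂ) :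
    gramForm f ν μ (a • v) w = starRingEnd ℂ a * gramForm f ν μ v w := by
  unfold gramForm
  simp only [sparseSignal_smul, map_mul, mul_assoc, Pi.smul_apply, smul_eq_mul,
    ← Finset.mul_sum, integral_const_mul, mul_add]
  ring

theorem gramForm_self_nonneg (f : Fin k → ℝ) (ν : Measure ℝ) {μ : ℝ} (hμ : 0 < μ)
    (v : Fin k → ℂ) : 0 ≤ (gramForm f ν μ v v).re := by
  rw [gramForm_self, Complex.ofReal_re]
  have : 0 ≤ ∫ t, ‖sparseSignal v f t‖ ^ 2 ∂ν := integral_nonneg fun _ => by positivity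
  positivity

/-- This is what μ is for: with coinciding frequencies the exponentials are dependent, and the
integral alone is only semidefinite in the coefficients. -/
theorem gramForm_definite (f : Fin k → ℝ) (ν : Measure ℝ) {μ : ℝ} (hμ : 0 < μ)
    (v : Fin k → ℂ) (hv : gramForm f ν μ v v = 0) : v = 0 := by
  rw [gramForm_self, Complex.ofReal_eq_zero] at hv
  have h0 : 0 ≤ ∫ t, ‖sparseSignal v f t‖ ^ 2 ∂ν := integral_nonneg fun _ => by positivity
  have h1 : 0 ≤ ∑ j, ‖v j‖ ^ 2 := Finset.sum_nonneg fun _ _ => by positivity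
  have h2 : ∑ j, ‖v j‖ ^ 2 = 0 := by nlinarith [mul_nonneg hμ.le h1]
  rw [Finset.sum_eq_zero_iff_of_nonneg fun _ _ => by positivity] at h2
  ext j
  simpa using h2 j (Finset.mem_univ j)

/-- Coefficient vectors, without the norm that `Fin k → ℂ` carries. -/
def CoeffSpace (k : ℕ) := Fin k → ℂ

instance : AddCommGroup (CoeffSpace k) := inferInstanceAs (AddCommGroup (Fin k → ℂ))

instance : Module ℂ (CoeffSpace k) := inferInstanceAs (Module ℂ (Fin k → ℂ))

/-- The Gram form as an inner product. -/
abbrev gramCore (f : Fin k → ℝ) (ν : Measure ℝ) [IsFiniteMeasure ν] {μ : ℝ} (hμ : 0 < μ) :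
    InnerProductSpace.Core ℂ (CoeffSpace k) where
  inner v w := gramForm f ν μ v w
  conj_inner_symm v w := conj_gramForm f ν μ v w
  re_inner_nonneg v := gramForm_self_nonneg f ν hμ v
  add_left u v w := gramForm_add_left f ν μ u v w
  smul_left v w a := gramForm_smul_left f ν μ v w a
  definite v hv := gramForm_definite f ν hμ v hv

theorem derivCoeff_basisFun (f : Fin k → ℝ) (j : Fin k) :
    derivCoeff f (Pi.basisFun ℂ (Fin k) j) =
      (2 * Real.pi * Complex.I * f j : ℂ) • Pi.basisFun ℂ (Fin k) j := by
  ext i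
  by_cases hij : i = j
  · subst hij; simp [derivCoeff]
  · simp [derivCoeff, hij]

/-- A basis that is orthonormal for the Gram form, in which differentiation is triangular. -/
theorem exists_gram_basis (f : Fin k → ℝ) (ν : Measure ℝ) [IsFiniteMeasure ν] {μ : ℝ}
    (hμ : 0 < μ) :
    ∃ φ : Fin k → Fin k → ℂ, (∀ i, gramForm f ν μ (φ i) (φ i) = 1) ∧
      (∀ v, v = ∑ i, gramForm f ν μ (φ i) v • φ i) ∧
      (∀ v, gramForm f ν μ v v = (∑ i, ‖gramForm f ν μ (φ i) v‖ ^ 2 : ℝ)) ∧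
      (∀ i, gramForm f ν μ (φ i) (derivCoeff f (φ i)) = 2 * Real.pi * Complex.I * f i) ∧
      ∀ i j, j < i → gramForm f ν μ (φ i) (derivCoeff f (φ j)) = 0 := by
  let n := (gramCore f ν hμ).toNormedAddCommGroup
  let ip : InnerProductSpace ℂ (CoeffSpace k) := InnerProductSpace.ofCore (gramCore f ν hμ).toCore
  obtain ⟨φ, h1, h2⟩ := exists_orthonormalBasis_triangular (E := CoeffSpace k)
    (Pi.basisFun ℂ (Fin k)) (derivCoeff f) (fun j => 2 * Real.pi * Complex.I * f j)
    (fun j => derivCoeff_basisFun f j)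
  refine ⟨φ, fun i => ?_, fun v => (φ.sum_repr' v).symm, fun v => ?_, h1, h2⟩
  · have h3 : inner ℂ (φ i) (φ i) = 1 := by
      rw [inner_self_eq_norm_sq_to_K (𝕜 := ℂ) (φ i), φ.orthonormal.1 i]
      simp
    exact h3
  · have h3 : ∀ x : CoeffSpace k, inner ℂ x x = ((∑ i, ‖inner ℂ (φ i) x‖ ^ 2 : ℝ) : ℂ) := by
      intro x
      rw [inner_self_eq_norm_sq_to_K (𝕜 := ℂ) x, φ.sum_sq_norm_inner_right x]
      norm_cast
    exact h3 v

end Signals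

end ClusteredSignal

end

noncomputable section

namespace ClusteredSignal

open MeasureTheory Set Finset

/-! ### Pointwise bounds from the reproducing kernel -/

section Kernel

variable {k : ℕ}

theorem sparseSignal_sum {ι : Type*} (s : Finset ι) (c : ι → ℂ) (φ : ι → Fin k → ℂ)
    (f : Fin k → ℝ) (t : ℝ) :
    sparseSignal (∑ i ∈ s, c i • φ i) f t = ∑ i ∈ s, c i * sparseSignal (φ i) f t := by
  simp only [← evalAt_apply, map_sum, map_smul, smul_eq_mul]

theorem norm_sum_mul_sq_le {ι : Type*} (s : Finset ι) (a b : ι → ℂ) :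
    ‖∑ i ∈ s, a i * b i‖ ^ 2 ≤ (∑ i ∈ s, ‖a i‖ ^ 2) * ∑ i ∈ s, ‖b i‖ ^ 2 := by
  calc ‖∑ i ∈ s, a i * b i‖ ^ 2 ≤ (∑ i ∈ s, ‖a i‖ * ‖b i‖) ^ 2 := by
        refine pow_le_pow_left₀ (norm_nonneg _) ((norm_sum_le _ _).trans (le_of_eq ?_)) 2
        simp only [norm_mul]
    _ ≤ _ := Finset.sum_mul_sq_le_sq_mul_sq s _ _

/-- The evaluation bound in a basis that is orthonormal for the Gram form. -/
theorem norm_sq_sparseSignal_le_of_basis {f : Fin k → ℝ} {ν : Measure ℝ} {μ : ℝ}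
    {φ : Fin k → Fin k → ℂ} (h1 : ∀ v, v = ∑ i, gramForm f ν μ (φ i) v • φ i)
    (h2 : ∀ v, gramForm f ν μ v v = (∑ i, ‖gramForm f ν μ (φ i) v‖ ^ 2 : ℝ))
    (v : Fin k → ℂ) (t : ℝ) :
    ‖sparseSignal v f t‖ ^ 2 ≤ (∑ i, ‖sparseSignal (φ i) f t‖ ^ 2) *
      ((∫ t, ‖sparseSignal v f t‖ ^ 2 ∂ν) + μ * ∑ j, ‖v j‖ ^ 2) := by
  have h3 := h2 v
  rw [gramForm_self, Complex.ofReal_inj] at h3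
  rw [h3]
  conv_lhs => rw [h1 v, sparseSignal_sum]
  rw [mul_comm]
  exact norm_sum_mul_sq_le _ _ _

theorem integral_norm_sq_le_one_of_unit {f : Fin k → ℝ} {ν : Measure ℝ} {μ : ℝ} (hμ : 0 < μ)
    {w : Fin k → ℂ} (h : gramForm f ν μ w w = 1) :
    (∫ t, ‖sparseSignal w f t‖ ^ 2 ∂ν) ≤ 1 := by
  rw [gramForm_self, Complex.ofReal_eq_one] at h
  have : 0 ≤ μ * ∑ j, ‖w j‖ ^ 2 := by positivity
  linarith

/-- Removes the regularizer: estimates are proved for every μ > 0 and then μ → 0. The division by z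
+ 1 below covers z = 0. -/
theorem le_of_forall_pos_regularizer {x y z : ℝ} (hz : 0 ≤ z)
    (h : ∀ μ : ℝ, 0 < μ → x ≤ y + μ * z) : x ≤ y := by
  refine le_of_forall_pos_le_add fun e he => ?_
  have h1 := h (e / (z + 1)) (by positivity)
  have h2 : e / (z + 1) * z ≤ e := by
    rw [div_mul_eq_mul_div, div_le_iff₀ (by positivity)]
    nlinarith
  linarith

theorem intervalIntegrable_norm_sq (v : Fin k → ℂ) (f : Fin k → ℝ) (a b : ℝ) :
    IntervalIntegrable (fun t => ‖sparseSignal v f t‖ ^ 2) volume a b :=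
  ((continuous_sparseSignal v f).norm.pow 2).intervalIntegrable a b

/-- In the interior of an interval, the square of a `k`-sparse signal is at most `k` over the
distance to the boundary, times its integral. -/
theorem norm_sq_le_interior (v : Fin k → ℂ) (f : Fin k → ℝ) {r : ℝ} (hr : 0 < r) (t : ℝ) :
    2 * r * ‖sparseSignal v f t‖ ^ 2 ≤
      k * ∫ x in (t - 2 * r)..(t + 2 * r), ‖sparseSignal v f x‖ ^ 2 := by
  have hV : 0 ≤ ∑ j, ‖v j‖ ^ 2 := Finset.sum_nonneg fun _ _ => by positivity
  refine le_of_forall_pos_regularizer (z := k * ∑ j, ‖v j‖ ^ 2) (by positivity) fun μ hμ => ?_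
  set ν : Measure ℝ := volume.restrict (Set.Ioc (-r) r) with hν
  obtain ⟨φ, hφ1, hφ2, hφ3, -, -⟩ := exists_gram_basis f ν hμ
  set G := ∫ x in (t - 2 * r)..(t + 2 * r), ‖sparseSignal v f x‖ ^ 2 with hG
  set C := G + μ * ∑ j, ‖v j‖ ^ 2 with hC
  -- A translation by t − s multiplies the coefficients by unimodular numbers. So evaluation at t
  -- can be replaced by evaluation at any s in [-r,r], at the cost of the larger window t ± 2r.
  have hbound : ∀ s ∈ Set.Icc (-r) r, ‖sparseSignal v f t‖ ^ 2 ≤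
      (∑ i, ‖sparseSignal (φ i) f s‖ ^ 2) * C := by
    intro s hs
    have h1 : sparseSignal v f t = sparseSignal
        (fun j => v j * Complex.exp (2 * Real.pi * Complex.I * f j * (t - s : ℝ))) f s := by
      rw [← sparseSignal_add_time, sub_add_cancel]
    rw [h1]
    refine (norm_sq_sparseSignal_le_of_basis hφ2 hφ3 _ s).trans ?_
    refine mul_le_mul_of_nonneg_left ?_ (Finset.sum_nonneg fun _ _ => by positivity)
    rw [hC]
    simp only [norm_mul, norm_exp_two_pi_I, mul_one]
    refine add_le_add_left ?_ _
    rw [hν, ← intervalIntegral.integral_of_le (by linarith)]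
    simp only [← sparseSignal_add_time]
    rw [intervalIntegral.integral_comp_add_left (fun x => ‖sparseSignal v f x‖ ^ 2)]
    refine intervalIntegral.integral_mono_interval ?_ ?_ ?_
      (ae_of_all _ fun _ => by positivity) (intervalIntegrable_norm_sq v f _ _)
    · linarith [hs.2]
    · linarith
    · linarith [hs.1]
  have hC0 : 0 ≤ C := by
    have : 0 ≤ G := intervalIntegral.integral_nonneg (by linarith) fun _ _ => by positivity
    positivity
  have hcont : Continuous fun s => ∑ i, ‖sparseSignal (φ i) f s‖ ^ 2 :=
    continuous_finsetSum _ fun i _ => (continuous_sparseSignal (φ i) f).norm.pow 2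
  have hint : ∫ _ in (-r)..r, ‖sparseSignal v f t‖ ^ 2 ≤
      ∫ s in (-r)..r, (∑ i, ‖sparseSignal (φ i) f s‖ ^ 2) * C :=
    intervalIntegral.integral_mono_on (a := -r) (b := r) (μ := volume) (by linarith)
    (continuous_const.intervalIntegrable _ _)
    ((hcont.mul continuous_const).intervalIntegrable _ _) hbound
  rw [intervalIntegral.integral_const, intervalIntegral.integral_mul_const,
    intervalIntegral.integral_finsetSum (fun i _ => intervalIntegrable_norm_sq _ _ _ _)] at hint
  -- The trace of the kernel: its diagonal integrates to at most the dimension k.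
  have hsum : ∑ i, ∫ s in (-r)..r, ‖sparseSignal (φ i) f s‖ ^ 2 ≤ k := by
    calc _ ≤ ∑ i : Fin k, (1 : ℝ) := by
          refine Finset.sum_le_sum fun i _ => ?_
          rw [intervalIntegral.integral_of_le (by linarith)]
          exact integral_norm_sq_le_one_of_unit hμ (hφ1 i)
      _ = k := by simp
  calc 2 * r * ‖sparseSignal v f t‖ ^ 2 = (r - -r) • ‖sparseSignal v f t‖ ^ 2 := by
        rw [smul_eq_mul]; ring
    _ ≤ _ := hint
    _ ≤ k * C := mul_le_mul_of_nonneg_right hsum hC0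
    _ = k * G + μ * (k * ∑ j, ‖v j‖ ^ 2) := by rw [hC]; ring

/-- The exponentially weighted half line. -/
def expMeasure (l : ℝ) : Measure ℝ :=
  (volume.restrict (Set.Ioi 0)).withDensity fun s => ENNReal.ofReal (Real.exp (-l * s))

theorem integrableOn_exp_neg {l : ℝ} (hl : 0 < l) :
    IntegrableOn (fun s => Real.exp (-l * s)) (Set.Ioi 0) :=
  integrableOn_exp_mul_Ioi (by linarith) 0

theorem isFiniteMeasure_expMeasure {l : ℝ} (hl : 0 < l) : IsFiniteMeasure (expMeasure l) :=
  isFiniteMeasure_withDensity_ofReal (integrableOn_exp_neg hl).2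

theorem integral_expMeasure (l : ℝ) (h : ℝ → ℝ) :
    ∫ s, h s ∂(expMeasure l) = ∫ s in Set.Ioi 0, Real.exp (-l * s) * h s := by
  unfold expMeasure
  rw [integral_withDensity_eq_integral_toReal_smul (by fun_prop) (by simp)]
  refine integral_congr_ae (ae_of_all _ fun s => ?_)
  simp [ENNReal.toReal_ofReal (Real.exp_pos _).le]

theorem integrableOn_expMeasure {l : ℝ} {h : ℝ → ℝ} (hi : Integrable h (expMeasure l)) :
    IntegrableOn (fun s => Real.exp (-l * s) * h s) (Set.Ioi 0) := by
  unfold expMeasure at hi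
  rw [integrable_withDensity_iff_integrable_smul' (by fun_prop) (by simp)] at hi
  refine hi.congr (ae_of_all _ fun s => ?_)
  simp [ENNReal.toReal_ofReal (Real.exp_pos _).le]

theorem hasDerivAt_norm_sq_sparseSignal (v : Fin k → ℂ) (f : Fin k → ℝ) (t : ℝ) :
    HasDerivAt (fun t => ‖sparseSignal v f t‖ ^ 2)
      (2 * (starRingEnd ℂ (sparseSignal v f t) * sparseSignal (derivCoeff f v) f t).re) t := by
  have h := (hasDerivAt_sparseSignal v f t).norm_sq
  convert h using 1
  rw [Complex.inner, mul_comm (sparseSignal _ _ _)]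

/-- The regularizer contributes nothing to the real part, since on coefficients the derivative is
multiplication by imaginary numbers. -/
theorem gramForm_derivCoeff_re (f : Fin k → ℝ) (ν : Measure ℝ) [IsFiniteMeasure ν] (μ : ℝ)
    (v : Fin k → ℂ) :
    (gramForm f ν μ v (derivCoeff f v)).re =
      ∫ t, (starRingEnd ℂ (sparseSignal v f t) * sparseSignal (derivCoeff f v) f t).re ∂ν := by
  unfold gramForm
  have h1 : (∑ j, starRingEnd ℂ (v j) * derivCoeff f v j).re = 0 := by
    rw [Complex.re_sum]
    refine Finset.sum_eq_zero fun j _ => ?_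
    change (starRingEnd ℂ (v j) * (2 * Real.pi * Complex.I * f j * v j)).re = 0
    have : starRingEnd ℂ (v j) * (2 * Real.pi * Complex.I * f j * v j) =
        ((2 * Real.pi * f j * ‖v j‖ ^ 2 : ℝ) : ℂ) * Complex.I := by
      push_cast
      rw [← Complex.conj_mul']
      ring
    rw [this, Complex.re_ofReal_mul, Complex.I_re, mul_zero]
  rw [Complex.add_re, Complex.re_ofReal_mul, h1, mul_zero, add_zero]
  exact (integral_re (integrable_sparseSignal_mul ν v (derivCoeff f v) f)).symm

/-- The value at the endpoint of a half line is bounded by the weighted integral. -/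
theorem norm_sq_zero_le_half_line (v : Fin k → ℂ) (f : Fin k → ℝ) {l : ℝ} (hl : 0 < l) :
    ‖sparseSignal v f 0‖ ^ 2 ≤
      k * l * ∫ s in Set.Ioi 0, Real.exp (-l * s) * ‖sparseSignal v f s‖ ^ 2 := by
  have hV : 0 ≤ ∑ j, ‖v j‖ ^ 2 := Finset.sum_nonneg fun _ _ => by positivity
  refine le_of_forall_pos_regularizer (z := k * l * ∑ j, ‖v j‖ ^ 2) (by positivity) fun μ hμ => ?_
  have := isFiniteMeasure_expMeasure hl
  obtain ⟨φ, hφ1, hφ2, hφ3, hφ4, -⟩ := exists_gram_basis f (expMeasure l) hμ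
  -- Integrating the derivative of e^{-ls}|φ_i|² gives −|φ_i(0)|² = 2 Re⟨φ_i, φ_i'⟩ − l‖φ_i‖². The
  -- real part vanishes because the diagonal entry of the derivative is 2πi f_i.
  have hdiag : ∀ i, ‖sparseSignal (φ i) f 0‖ ^ 2 ≤ l := by
    intro i
    set g := sparseSignal (φ i) f with hg
    set q := fun t => (starRingEnd ℂ (g t) * sparseSignal (derivCoeff f (φ i)) f t).re with hq
    have hre : ∫ t, q t ∂(expMeasure l) = 0 := by
      rw [hq, hg, ← gramForm_derivCoeff_re f _ μ, hφ4]
      simp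
    have hqi : Integrable q (expMeasure l) :=
      (integrable_sparseSignal_mul (expMeasure l) (φ i) (derivCoeff f (φ i)) f).re
    have hgi : Integrable (fun t => ‖g t‖ ^ 2) (expMeasure l) :=
      integrable_norm_sq_sparseSignal _ _ _
    have hqe := integrableOn_expMeasure hqi
    have hge := integrableOn_expMeasure hgi
    have hderiv : ∀ x ∈ Set.Ici (0 : ℝ), HasDerivAt (fun s => Real.exp (-l * s) * ‖g s‖ ^ 2)
        (2 * (Real.exp (-l * x) * q x) - l * (Real.exp (-l * x) * ‖g x‖ ^ 2)) x := by
      intro x _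
      have h1 : HasDerivAt (fun s : ℝ => Real.exp (-l * s)) (Real.exp (-l * x) * (-l * 1)) x :=
        ((hasDerivAt_id x).const_mul (-l)).exp
      refine (h1.mul (hasDerivAt_norm_sq_sparseSignal (φ i) f x)).congr_deriv ?_
      simp only [hq, hg]
      ring
    have hlim : Filter.Tendsto (fun s => Real.exp (-l * s) * ‖g s‖ ^ 2) Filter.atTop (nhds 0) := by
      have hb : Filter.Tendsto (fun s => Real.exp (-l * s) * (∑ j, ‖φ i j‖) ^ 2) Filter.atTop
          (nhds (0 * (∑ j, ‖φ i j‖) ^ 2)) := by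
        refine Filter.Tendsto.mul_const _ ?_
        refine Real.tendsto_exp_atBot.comp ?_
        exact Filter.tendsto_id.const_mul_atTop_of_neg (by linarith)
      rw [zero_mul] at hb
      refine squeeze_zero (fun s => by positivity) (fun s => ?_) hb
      exact mul_le_mul_of_nonneg_left
        (pow_le_pow_left₀ (norm_nonneg _) (norm_sparseSignal_le _ _ _) 2) (Real.exp_pos _).le
    have hFTC := integral_Ioi_of_hasDerivAt_of_tendsto' hderiv
      ((hqe.const_mul 2).sub (hge.const_mul l)) hlim
    rw [integral_sub (hqe.const_mul 2) (hge.const_mul l), integral_const_mul, integral_const_mul,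
      ← integral_expMeasure, ← integral_expMeasure, hre] at hFTC
    have h1 : ∫ t, ‖g t‖ ^ 2 ∂(expMeasure l) ≤ 1 := integral_norm_sq_le_one_of_unit hμ (hφ1 i)
    simp only [mul_zero, Real.exp_zero, one_mul, zero_sub] at hFTC
    nlinarith
  have hmain := norm_sq_sparseSignal_le_of_basis hφ2 hφ3 v 0
  rw [integral_expMeasure] at hmain
  set G := ∫ s in Set.Ioi 0, Real.exp (-l * s) * ‖sparseSignal v f s‖ ^ 2 with hG
  have hG0 : 0 ≤ G := integral_nonneg fun _ => by positivity
  have hsum : ∑ i, ‖sparseSignal (φ i) f 0‖ ^ 2 ≤ k * l := by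
    refine (Finset.sum_le_sum fun i _ => hdiag i).trans (by simp)
  calc _ ≤ _ := hmain
    _ ≤ (k * l) * (G + μ * ∑ j, ‖v j‖ ^ 2) := mul_le_mul_of_nonneg_right hsum (by positivity)
    _ = _ := by ring

/-- A sparse signal satisfies a linear recurrence along arithmetic progressions. -/
theorem norm_sparseSignal_progression (θ : ℝ) : ∀ {k : ℕ} (v : Fin k → ℂ) (f : Fin k → ℝ)
    (s M : ℝ), (∀ j < k, ‖sparseSignal v f (s + j * θ)‖ ≤ M) →
    ‖sparseSignal v f (s + k * θ)‖ ≤ (2 ^ k - 1) * M := by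
  intro k
  induction k with
  | zero => intro v f s M _; simp [sparseSignal]
  | succ k ih =>
    intro v f s M hM
    set z : ℂ := Complex.exp (2 * Real.pi * Complex.I * f (Fin.last k) * θ) with hz
    -- The shift by θ minus the factor z annihilates the last exponential. What is left is a signal
    -- with one term fewer, bounded by 2M, and 2(2^k − 1) + 1 = 2^(k+1) − 1.
    set w : Fin k → ℂ := fun j => v j.castSucc *
      (Complex.exp (2 * Real.pi * Complex.I * f j.castSucc * θ) - z) with hw
    have hstep : ∀ t, sparseSignal v f (t + θ) = z * sparseSignal v f t
        + sparseSignal w (fun j => f j.castSucc) t := by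
      intro t
      simp only [sparseSignal, Fin.sum_univ_castSucc, hw, mul_add, Finset.mul_sum]
      have h1 : ∀ x : ℝ, Complex.exp (2 * Real.pi * Complex.I * x * ((t + θ : ℝ) : ℂ)) =
          Complex.exp (2 * Real.pi * Complex.I * x * t) *
            Complex.exp (2 * Real.pi * Complex.I * x * θ) := by
        intro x
        rw [← Complex.exp_add]
        congr 1
        push_cast
        ring
      simp only [h1]
      rw [add_right_comm, ← Finset.sum_add_distrib]
      congr 1
      · refine Finset.sum_congr rfl fun j _ => by ring
      · rw [hz]; ring
    have hz1 : ‖z‖ = 1 := norm_exp_two_pi_I _ _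
    have hsucc : ∀ j : ℕ, s + (j + 1 : ℕ) * θ = s + j * θ + θ := fun j => by push_cast; ring
    have hw2 : ∀ j < k, ‖sparseSignal w (fun j => f j.castSucc) (s + j * θ)‖ ≤ 2 * M := by
      intro j hj
      have h1 : sparseSignal w (fun j => f j.castSucc) (s + j * θ) =
          sparseSignal v f (s + (j + 1 : ℕ) * θ) - z * sparseSignal v f (s + j * θ) := by
        rw [hsucc, hstep]; ring
      rw [h1]
      refine (norm_sub_le _ _).trans ?_
      rw [norm_mul, hz1, one_mul]
      linarith [hM (j + 1) (by omega), hM j (by omega)]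
    have h2 := ih w (fun j => f j.castSucc) s (2 * M) hw2
    rw [hsucc, hstep]
    refine (norm_add_le _ _).trans ?_
    rw [norm_mul, hz1, one_mul, pow_succ]
    linarith [hM k (by omega)]

/-- A point at most T/k beyond the range already controlled is preceded by k points in progression
of step T/k, starting at s − T, all inside that range. Each extension by T/k costs a factor 2^k. -/
theorem norm_sparseSignal_growth_nat (hk : 1 ≤ k) (v : Fin k → ℂ) (f : Fin k → ℝ) {T M : ℝ}
    (hT : 0 < T) (hM : ∀ s ∈ Set.Icc 0 T, ‖sparseSignal v f s‖ ≤ M) (n : ℕ) :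
    ∀ s, 0 ≤ s → s ≤ T + n * (T / k) → ‖sparseSignal v f s‖ ≤ 2 ^ (k * n) * M := by
  have hM0 : 0 ≤ M := (norm_nonneg _).trans (hM 0 ⟨le_rfl, hT.le⟩)
  have hk' : (0 : ℝ) < k := by exact_mod_cast hk
  have hθ : 0 < T / k := by positivity
  have hkθ : (k : ℝ) * (T / k) = T := by field_simp
  induction n with
  | zero => intro s h0 h1; simpa using hM s ⟨h0, by simpa using h1⟩
  | succ n ih =>
    intro s h0 h1
    push_cast at h1
    have hmono : (2 : ℝ) ^ (k * n) * M ≤ 2 ^ (k * (n + 1)) * M := by gcongr <;> norm_num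
    by_cases hs : s ≤ T + n * (T / k)
    · exact (ih s h0 hs).trans hmono
    · push Not at hs
      have h2 := norm_sparseSignal_progression (T / k) v f (s - T) (2 ^ (k * n) * M) fun j hj => by
        have hj' : (j : ℝ) + 1 ≤ k := by exact_mod_cast hj
        have hn : 0 ≤ (n : ℝ) * (T / k) := by positivity
        have hjθ : 0 ≤ (j : ℝ) * (T / k) := by positivity
        refine ih _ (by linarith) ?_
        nlinarith
      rw [hkθ, sub_add_cancel] at h2
      refine h2.trans ?_
      rw [Nat.mul_succ, pow_add]
      have : 0 ≤ 2 ^ (k * n) * M := by positivity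
      nlinarith

/-- Reaching s takes ⌈(s − T)k/T⌉ extensions. This is at most ks/T, since k ≥ 1 pays for the
rounding. -/
theorem norm_sq_sparseSignal_growth (hk : 1 ≤ k) (v : Fin k → ℂ) (f : Fin k → ℝ) {T M : ℝ}
    (hT : 0 < T) (hM : ∀ s ∈ Set.Icc 0 T, ‖sparseSignal v f s‖ ≤ M) {s : ℝ} (hs : T ≤ s) :
    ‖sparseSignal v f s‖ ^ 2 ≤ M ^ 2 * Real.exp (2 * k ^ 2 * s / T) := by
  have hM0 : 0 ≤ M := (norm_nonneg _).trans (hM 0 ⟨le_rfl, hT.le⟩)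
  have hk1 : (1 : ℝ) ≤ k := by exact_mod_cast hk
  have hk' : (0 : ℝ) < k := by linarith
  set x := (s - T) / (T / k) with hx
  have hx0 : 0 ≤ x := div_nonneg (by linarith) (by positivity)
  have h1 := norm_sparseSignal_growth_nat hk v f hT hM ⌈x⌉₊ s (by linarith) (by
    have := Nat.le_ceil x
    rw [hx, div_le_iff₀ (by positivity)] at this
    rw [← hx] at this
    linarith)
  have h2 : (⌈x⌉₊ : ℝ) ≤ k * s / T := by
    have h3 := (Nat.ceil_lt_add_one hx0).le
    refine h3.trans ?_
    rw [hx, div_div_eq_mul_div, div_add_one hT.ne', div_le_div_iff_of_pos_right hT]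
    nlinarith
  have h3 : (2 : ℝ) ^ (k * ⌈x⌉₊) ≤ Real.exp (k ^ 2 * s / T) := by
    calc (2 : ℝ) ^ (k * ⌈x⌉₊) ≤ Real.exp 1 ^ (k * ⌈x⌉₊) := by
          gcongr
          linarith [Real.exp_one_gt_d9]
      _ = Real.exp (k * ⌈x⌉₊) := by rw [← Real.exp_nat_mul]; push_cast; rw [mul_one]
      _ ≤ _ := by
          refine Real.exp_le_exp.2 ?_
          calc (k : ℝ) * ⌈x⌉₊ ≤ k * (k * s / T) := by gcongr
            _ = _ := by ring
  calc ‖sparseSignal v f s‖ ^ 2 ≤ (Real.exp (k ^ 2 * s / T) * M) ^ 2 := by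
        refine pow_le_pow_left₀ (norm_nonneg _) (h1.trans ?_) 2
        gcongr
    _ = _ := by
        rw [mul_pow, ← Real.exp_nat_mul, mul_comm]
        congr 2
        push_cast
        ring

/-- Beyond T the square grows at most like exp(2k²s/T). An exponential weight of twice that rate
makes the tail of the half-line bound smaller than half of the left side, and the integral over
[0,T] has to account for the other half. -/
theorem norm_sq_max_le_right (hk : 1 ≤ k) (v : Fin k → ℂ) (f : Fin k → ℝ) {T : ℝ} (hT : 0 < T)
    (hM : ∀ s ∈ Set.Icc 0 T, ‖sparseSignal v f s‖ ≤ ‖sparseSignal v f 0‖) :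
    ‖sparseSignal v f 0‖ ^ 2 ≤ 8 * k ^ 3 / T * ∫ s in (0)..T, ‖sparseSignal v f s‖ ^ 2 := by
  have hk1 : (1 : ℝ) ≤ k := by exact_mod_cast hk
  have hk' : (0 : ℝ) < k := by linarith
  set l : ℝ := 4 * k ^ 2 / T with hl
  have hl0 : 0 < l := by positivity
  have h1 := norm_sq_zero_le_half_line v f hl0
  set M := ‖sparseSignal v f 0‖ with hMdef
  have := isFiniteMeasure_expMeasure hl0
  have hi := integrableOn_expMeasure (integrable_norm_sq_sparseSignal (expMeasure l) v f)
  rw [← Set.Ioc_union_Ioi_eq_Ioi hT.le, setIntegral_union (Set.Ioc_disjoint_Ioi le_rfl)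
    measurableSet_Ioi (hi.mono_set Set.Ioc_subset_Ioi_self)
    (hi.mono_set (Set.Ioi_subset_Ioi hT.le))] at h1
  have hA : ∫ s in Set.Ioc 0 T, Real.exp (-l * s) * ‖sparseSignal v f s‖ ^ 2 ≤
      ∫ s in (0)..T, ‖sparseSignal v f s‖ ^ 2 := by
    rw [intervalIntegral.integral_of_le hT.le]
    refine setIntegral_mono_on (hi.mono_set Set.Ioc_subset_Ioi_self)
      (intervalIntegrable_norm_sq v f 0 T).1 measurableSet_Ioc fun s hs => ?_
    refine mul_le_of_le_one_left (by positivity) (Real.exp_le_one_iff.2 ?_)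
    nlinarith [hs.1]
  have hneg : -(2 * (k : ℝ) ^ 2 / T) < 0 := by
    have : 0 < 2 * (k : ℝ) ^ 2 / T := by positivity
    linarith
  have hB : ∫ s in Set.Ioi T, Real.exp (-l * s) * ‖sparseSignal v f s‖ ^ 2 ≤
      M ^ 2 * (T / (2 * k ^ 2) * Real.exp (-(2 * k ^ 2))) := by
    calc _ ≤ ∫ s in Set.Ioi T, M ^ 2 * Real.exp (-(2 * k ^ 2 / T) * s) := by
          refine setIntegral_mono_on (hi.mono_set (Set.Ioi_subset_Ioi hT.le))
            ((integrableOn_exp_mul_Ioi hneg T).const_mul _) measurableSet_Ioi fun s hs => ?_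
          calc _ ≤ Real.exp (-l * s) * (M ^ 2 * Real.exp (2 * k ^ 2 * s / T)) := by
                refine mul_le_mul_of_nonneg_left ?_ (Real.exp_pos _).le
                exact norm_sq_sparseSignal_growth hk v f hT hM (le_of_lt hs)
            _ = _ := by
                rw [mul_left_comm, ← Real.exp_add]
                congr 2
                rw [hl]
                field_simp
                ring
      _ = _ := by
          rw [integral_const_mul, integral_exp_mul_Ioi hneg]
          congr 1
          have : -(2 * (k : ℝ) ^ 2 / T) * T = -(2 * k ^ 2) := by field_simp
          rw [this]
          field_simp
  -- The tail is k l · T/(2k²) · e^{-2k²} M² = 2k e^{-2k²} M².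
  have hexp : 2 * k * Real.exp (-(2 * (k : ℝ) ^ 2)) ≤ 1 / 2 := by
    rw [Real.exp_neg, ← div_eq_mul_inv, div_le_iff₀ (Real.exp_pos _)]
    have := Real.quadratic_le_exp_of_nonneg (x := 2 * (k : ℝ) ^ 2) (by positivity)
    nlinarith [sq_nonneg ((k : ℝ) - 1), sq_nonneg ((k : ℝ) ^ 2 - 1)]
  have hkl : 0 ≤ k * l := by positivity
  have h2 : k * l * (M ^ 2 * (T / (2 * k ^ 2) * Real.exp (-(2 * k ^ 2)))) ≤ M ^ 2 * (1 / 2) := by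
    calc _ = M ^ 2 * (2 * k * Real.exp (-(2 * (k : ℝ) ^ 2))) := by
          rw [hl]; field_simp; ring
      _ ≤ _ := by gcongr
  have h3 := mul_le_mul_of_nonneg_left (add_le_add hA hB) hkl
  rw [mul_add] at h3
  have h4 : 8 * (k : ℝ) ^ 3 / T = 2 * (k * l) := by rw [hl]; ring
  rw [h4]
  linarith

end Kernel

end ClusteredSignal

end

noncomputable section

namespace ClusteredSignal

open MeasureTheory Set Finset

/-! ### Bounds for the worst ratio R -/

section Ratio

variable {k : ℕ}

/-- A maximum at x ≤ 0 has an interval of length T to its right inside [-T,T], to which the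
one-sided bound applies after translation. -/
theorem norm_sq_max_le_of_nonpos (hk : 1 ≤ k) (v : Fin k → ℂ) (f : Fin k → ℝ) {T x : ℝ}
    (hT : 0 < T) (hx : x ∈ Set.Icc (-T) T) (hx0 : x ≤ 0)
    (hM : ∀ s ∈ Set.Icc (-T) T, ‖sparseSignal v f s‖ ≤ ‖sparseSignal v f x‖) :
    ‖sparseSignal v f x‖ ^ 2 ≤
      8 * k ^ 3 / T * ∫ s in (-T)..T, ‖sparseSignal v f s‖ ^ 2 := by
  set w : Fin k → ℂ := fun j => v j * Complex.exp (2 * Real.pi * Complex.I * f j * x) with hw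
  have hsh : ∀ s, sparseSignal w f s = sparseSignal v f (x + s) := fun s =>
    (sparseSignal_add_time v f x s).symm
  have h1 := norm_sq_max_le_right hk w f hT fun s hs => by
    rw [hsh, hsh, add_zero]
    exact hM _ ⟨by linarith [hx.1, hs.1], by linarith [hs.2]⟩
  simp only [hsh, add_zero] at h1
  rw [intervalIntegral.integral_comp_add_left (fun s => ‖sparseSignal v f s‖ ^ 2)] at h1
  refine h1.trans (mul_le_mul_of_nonneg_left ?_ (by positivity))
  exact intervalIntegral.integral_mono_interval (by linarith [hx.1]) (by linarith) (by linarith)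
    (ae_of_all _ fun _ => by positivity) (intervalIntegrable_norm_sq v f _ _)

/-- The maximum of the square of a `k`-sparse signal over an interval is at most of order `k ^ 3`
times its average. -/
theorem norm_sq_le_integral (hk : 1 ≤ k) (v : Fin k → ℂ) (f : Fin k → ℝ) {T t : ℝ}
    (hT : 0 < T) (ht : t ∈ Set.Icc (-T) T) :
    ‖sparseSignal v f t‖ ^ 2 ≤
      8 * k ^ 3 / T * ∫ s in (-T)..T, ‖sparseSignal v f s‖ ^ 2 := by
  obtain ⟨x, hx, hmax⟩ := isCompact_Icc.exists_isMaxOn ⟨t, ht⟩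
    (continuous_sparseSignal v f).norm.continuousOn
  have hM : ∀ s ∈ Set.Icc (-T) T, ‖sparseSignal v f s‖ ≤ ‖sparseSignal v f x‖ := hmax
  refine (pow_le_pow_left₀ (norm_nonneg _) (hM t ht) 2).trans ?_
  rcases le_total x 0 with h0 | h0
  · exact norm_sq_max_le_of_nonpos hk v f hT hx h0 hM
  -- Time reversal moves a maximum at x ≥ 0 to −x.
  · have hneg : ∀ s, sparseSignal v (fun j => -f j) s = sparseSignal v f (-s) := fun s =>
      (sparseSignal_neg_time v f s).symm
    have h1 := norm_sq_max_le_of_nonpos hk v (fun j => -f j) hT (x := -x)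
      ⟨by linarith [hx.2], by linarith [hx.1]⟩ (by linarith) fun s hs => by
        rw [hneg, hneg, neg_neg]
        exact hM _ ⟨by linarith [hs.2], by linarith [hs.1]⟩
    simp only [hneg, neg_neg] at h1
    rwa [intervalIntegral.integral_comp_neg (fun s => ‖sparseSignal v f s‖ ^ 2), neg_neg] at h1

theorem lintegral_enorm_sq_sparseSignal (v : Fin k → ℂ) (f : Fin k → ℝ) {T : ℝ} (hT : 0 < T) :
    ∫⁻ t in Set.Icc (-T) T, ‖sparseSignal v f t‖ₑ ^ 2 =
      ENNReal.ofReal (∫ t in (-T)..T, ‖sparseSignal v f t‖ ^ 2) := by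
  rw [intervalIntegral.integral_of_le (by linarith), ← integral_Icc_eq_integral_Ioc,
    ofReal_integral_eq_lintegral_ofReal (integrable_norm_sq_sparseSignal _ v f)
      (ae_of_all _ fun _ => by positivity)]
  refine lintegral_congr fun t => ?_
  rw [ENNReal.ofReal_pow (norm_nonneg _), ofReal_norm]

theorem meanSq_sparseSignal (v : Fin k → ℂ) (f : Fin k → ℝ) {T : ℝ} (hT : 0 < T) :
    meanSq T (sparseSignal v f) =
      ENNReal.ofReal ((∫ t in (-T)..T, ‖sparseSignal v f t‖ ^ 2) / (2 * T)) := by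
  unfold meanSq
  rw [lintegral_enorm_sq_sparseSignal v f hT, ENNReal.ofReal_div_of_pos (by positivity)]

theorem worstRatio_le (hk : 1 ≤ k) (F : ℝ) {T : ℝ} (hT : 0 < T) :
    worstRatio k F T ≤ ENNReal.ofReal (16 * k ^ 3) := by
  refine iSup_le fun v => iSup_le fun f => iSup_le fun _ => ?_
  refine ENNReal.div_le_of_le_mul (iSup_le fun t => iSup_le fun ht => ?_)
  rw [meanSq_sparseSignal v f hT, ← ENNReal.ofReal_mul (by positivity), ← ofReal_norm,
    ← ENNReal.ofReal_pow (norm_nonneg _)]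
  refine ENNReal.ofReal_le_ofReal ((norm_sq_le_integral hk v f hT ht).trans (le_of_eq ?_))
  field_simp
  ring

theorem worstRatio_ne_top (hk : 1 ≤ k) (F : ℝ) {T : ℝ} (hT : 0 < T) : worstRatio k F T ≠ ⊤ :=
  ne_top_of_le_ne_top ENNReal.ofReal_ne_top (worstRatio_le hk F hT)

theorem toReal_worstRatio_le (hk : 1 ≤ k) (F : ℝ) {T : ℝ} (hT : 0 < T) :
    (worstRatio k F T).toReal ≤ 16 * k ^ 3 :=
  ENNReal.toReal_le_of_le_ofReal (by positivity) (worstRatio_le hk F hT)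

/-- A signal with frequencies in `[-F, F]` is bounded by the worst ratio times its average. -/
theorem norm_sq_le_worstRatio (hk : 1 ≤ k) (v : Fin k → ℂ) {f : Fin k → ℝ} {F T t : ℝ}
    (hT : 0 < T) (hf : ∀ j, f j ∈ Set.Icc (-F) F) (ht : t ∈ Set.Icc (-T) T) :
    ‖sparseSignal v f t‖ ^ 2 ≤ (worstRatio k F T).toReal / (2 * T) *
      ∫ s in (-T)..T, ‖sparseSignal v f s‖ ^ 2 := by
  set G := ∫ s in (-T)..T, ‖sparseSignal v f s‖ ^ 2 with hG
  have hG0 : 0 ≤ G := intervalIntegral.integral_nonneg (by linarith) fun _ _ => by positivity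
  have hb := norm_sq_le_integral hk v f hT ht
  -- If the energy is zero, the ratio is 0/0 = 0 in `ℝ≥0∞` and the supremum carries no information;
  -- the k³ bound then shows that the signal vanishes.
  rcases hG0.eq_or_lt with h0 | h0
  · rw [← hG, ← h0, mul_zero] at hb
    rw [← h0, mul_zero]
    exact hb
  have h1 : (‖sparseSignal v f t‖ₑ ^ 2) / meanSq T (sparseSignal v f) ≤ worstRatio k F T := by
    refine le_trans ?_ (le_iSup_of_le v (le_iSup_of_le f (le_iSup_of_le hf le_rfl)))
    exact ENNReal.div_le_div_right
      (le_iSup₂_of_le (f := fun t _ => ‖sparseSignal v f t‖ₑ ^ 2) t ht le_rfl) _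
  rw [meanSq_sparseSignal v f hT, ← hG, ← ofReal_norm, ← ENNReal.ofReal_pow (norm_nonneg _),
    ← ENNReal.ofReal_div_of_pos (by positivity),
    ENNReal.ofReal_le_iff_le_toReal (worstRatio_ne_top hk F hT), div_le_iff₀ (by positivity)] at h1
  refine h1.trans (le_of_eq ?_)
  ring

/-- The constant signal has ratio 1. The zero frequency is admissible because F > 0. -/
theorem one_le_toReal_worstRatio (hk : 1 ≤ k) {F T : ℝ} (hF : 0 < F) (hT : 0 < T) :
    1 ≤ (worstRatio k F T).toReal := by
  have : NeZero k := ⟨by omega⟩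
  have hc : ∀ t, sparseSignal (Pi.single (0 : Fin k) (1 : ℂ)) (fun _ => 0) t = 1 := by
    intro t
    simp [sparseSignal]
  have h := norm_sq_le_worstRatio hk (Pi.single (0 : Fin k) (1 : ℂ)) (f := fun _ => 0) (F := F)
    hT (fun _ => ⟨by linarith, hF.le⟩) (t := 0) ⟨by linarith, hT.le⟩
  simp only [hc] at h
  norm_num at h
  have h2 : (worstRatio k F T).toReal / (2 * T) * (T + T) = (worstRatio k F T).toReal := by
    field_simp
    ring
  linarith

end Ratio

/-! ### A Bernstein inequality -/

section Bernstein

variable {k : ℕ}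

/-- Integration by parts: the derivative is skew-adjoint up to the boundary values. On the
regularizing part it is exactly skew-adjoint. -/
theorem gramForm_derivCoeff_add (f : Fin k → ℝ) {T : ℝ} (hT : 0 < T) (μ : ℝ)
    (v w : Fin k → ℂ) :
    gramForm f (volume.restrict (Set.Ioc (-T) T)) μ v (derivCoeff f w) +
      gramForm f (volume.restrict (Set.Ioc (-T) T)) μ (derivCoeff f v) w =
      starRingEnd ℂ (sparseSignal v f T) * sparseSignal w f T -
        starRingEnd ℂ (sparseSignal v f (-T)) * sparseSignal w f (-T) := by
  have hder : ∀ x : ℝ, HasDerivAt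
      (fun t => starRingEnd ℂ (sparseSignal v f t) * sparseSignal w f t)
      (starRingEnd ℂ (sparseSignal v f x) * sparseSignal (derivCoeff f w) f x +
        starRingEnd ℂ (sparseSignal (derivCoeff f v) f x) * sparseSignal w f x) x := by
    intro x
    have h1 : HasDerivAt (fun t => starRingEnd ℂ (sparseSignal v f t))
        (starRingEnd ℂ (sparseSignal (derivCoeff f v) f x)) x :=
      (hasDerivAt_sparseSignal v f x).star
    refine (h1.mul (hasDerivAt_sparseSignal w f x)).congr_deriv ?_
    ring
  have hc : ∀ a b : Fin k → ℂ, Continuous fun t =>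
      starRingEnd ℂ (sparseSignal a f t) * sparseSignal b f t := fun a b =>
    (Complex.continuous_conj.comp (continuous_sparseSignal a f)).mul (continuous_sparseSignal b f)
  have hftc := intervalIntegral.integral_eq_sub_of_hasDerivAt (a := -T) (b := T)
    (fun x _ => hder x) (((hc _ _).add (hc _ _)).intervalIntegrable _ _)
  rw [← hftc, intervalIntegral.integral_add ((hc _ _).intervalIntegrable _ _)
    ((hc _ _).intervalIntegrable _ _)]
  unfold gramForm
  rw [intervalIntegral.integral_of_le (by linarith), intervalIntegral.integral_of_le (by linarith)]
  have hz : ∑ j, starRingEnd ℂ (v j) * derivCoeff f w j +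
      ∑ j, starRingEnd ℂ (derivCoeff f v j) * w j = 0 := by
    rw [← Finset.sum_add_distrib]
    refine Finset.sum_eq_zero fun j _ => ?_
    change starRingEnd ℂ (v j) * (2 * Real.pi * Complex.I * f j * w j) +
      starRingEnd ℂ (2 * Real.pi * Complex.I * f j * v j) * w j = 0
    simp only [map_mul, Complex.conj_I, Complex.conj_ofReal, map_ofNat]
    ring
  linear_combination (μ : ℂ) * hz

theorem gramForm_sum_right (f : Fin k → ℝ) (ν : Measure ℝ) [IsFiniteMeasure ν] (μ : ℝ)
    {ι : Type*} (s : Finset ι) (u : Fin k → ℂ) (c : ι → ℂ) (φ : ι → Fin k → ℂ) :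
    gramForm f ν μ u (∑ i ∈ s, c i • φ i) = ∑ i ∈ s, c i * gramForm f ν μ u (φ i) := by
  classical
  induction s using Finset.induction_on with
  | empty =>
    simp [gramForm, sparseSignal]
  | insert i s hi ih =>
    rw [Finset.sum_insert hi, Finset.sum_insert hi, ← ih, ← conj_gramForm, gramForm_add_left,
      gramForm_smul_left, map_add, map_mul, conj_gramForm, conj_gramForm, Complex.conj_conj]

/-- The sum of the squares of an orthonormal basis at a point is the norm of the evaluation. -/
theorem sum_norm_sq_basis_le {f : Fin k → ℝ} {ν : Measure ℝ} [IsFiniteMeasure ν] {μ κ t : ℝ}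
    (hμ : 0 < μ) {φ : Fin k → Fin k → ℂ}
    (h1 : ∀ i j, gramForm f ν μ (φ i) (φ j) = if i = j then 1 else 0)
    (h3 : ∀ v, gramForm f ν μ v v = (∑ i, ‖gramForm f ν μ (φ i) v‖ ^ 2 : ℝ)) (hκ0 : 0 ≤ κ)
    (hκ : ∀ w, ‖sparseSignal w f t‖ ^ 2 ≤ κ * ∫ s, ‖sparseSignal w f s‖ ^ 2 ∂ν) :
    ∑ i, ‖sparseSignal (φ i) f t‖ ^ 2 ≤ κ := by
  set a := ∑ i, ‖sparseSignal (φ i) f t‖ ^ 2 with ha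
  -- The Riesz representer of evaluation at t. Its value at t and its squared Gram norm are both a,
  -- so the hypothesis gives a² ≤ κ a.
  set w : Fin k → ℂ := ∑ i, starRingEnd ℂ (sparseSignal (φ i) f t) • φ i with hw
  have hw1 : sparseSignal w f t = (a : ℂ) := by
    rw [hw, sparseSignal_sum, ha]
    push_cast
    simp only [Complex.conj_mul']
  have hw2 : (∫ s, ‖sparseSignal w f s‖ ^ 2 ∂ν) ≤ a := by
    have h4 := h3 w
    rw [gramForm_self, Complex.ofReal_inj] at h4
    have h5 : ∑ i, ‖gramForm f ν μ (φ i) w‖ ^ 2 = a := by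
      rw [ha]
      refine Finset.sum_congr rfl fun i _ => ?_
      rw [hw, gramForm_sum_right]
      simp [h1]
    have : 0 ≤ μ * ∑ j, ‖w j‖ ^ 2 := by positivity
    linarith
  have ha0 : 0 ≤ a := Finset.sum_nonneg fun _ _ => by positivity
  have h6 := hκ w
  rw [hw1, Complex.norm_real, Real.norm_of_nonneg ha0] at h6
  have h7 : a ^ 2 ≤ κ * a := h6.trans (by gcongr)
  by_contra hlt
  push Not at hlt
  nlinarith

/-- The norm of a triangular operator with a boundary term of rank two. -/
theorem sum_sq_le_of_boundary {n : ℕ} (L κ : ℝ) (hL : 0 ≤ L) (hκ : 0 ≤ κ) (c a b x : Fin n → ℝ)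
    (hc : ∀ i, 0 ≤ c i) (ha : ∀ i, 0 ≤ a i) (hb : ∀ i, 0 ≤ b i) (hx : ∀ i, 0 ≤ x i)
    (hA : ∑ i, a i ^ 2 ≤ κ) (hB : ∑ i, b i ^ 2 ≤ κ)
    (h : ∀ i, x i ≤ L * c i + ∑ j, c j * (a i * a j + b i * b j)) :
    ∑ i, x i ^ 2 ≤ (L + 2 * κ) ^ 2 * ∑ i, c i ^ 2 := by
  set α := ∑ j, a j * c j with hα
  set β := ∑ j, b j * c j with hβ
  set C := ∑ i, c i ^ 2 with hC
  have hC0 : 0 ≤ C := Finset.sum_nonneg fun _ _ => by positivity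
  have hα0 : 0 ≤ α := Finset.sum_nonneg fun i _ => mul_nonneg (ha i) (hc i)
  have hβ0 : 0 ≤ β := Finset.sum_nonneg fun i _ => mul_nonneg (hb i) (hc i)
  have hα2 : α ^ 2 ≤ κ * C := (Finset.sum_mul_sq_le_sq_mul_sq _ _ _).trans (by gcongr)
  have hβ2 : β ^ 2 ≤ κ * C := (Finset.sum_mul_sq_le_sq_mul_sq _ _ _).trans (by gcongr)
  have hab : ∑ i, a i * b i ≤ κ := by
    calc ∑ i, a i * b i ≤ ∑ i, (a i ^ 2 + b i ^ 2) / 2 :=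
          Finset.sum_le_sum fun i _ => by nlinarith [sq_nonneg (a i - b i)]
      _ = ((∑ i, a i ^ 2) + ∑ i, b i ^ 2) / 2 := by
          rw [← Finset.sum_div, Finset.sum_add_distrib]
      _ ≤ κ := by linarith
  have hab0 : 0 ≤ ∑ i, a i * b i := Finset.sum_nonneg fun i _ => mul_nonneg (ha i) (hb i)
  have hαβ : α * β ≤ κ * C := by nlinarith [sq_nonneg (α - β)]
  have hx2 : ∀ i, x i ≤ L * c i + (α * a i + β * b i) := by
    intro i
    refine (h i).trans (le_of_eq ?_)
    rw [hα, hβ, Finset.sum_mul, Finset.sum_mul, ← Finset.sum_add_distrib]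
    congr 1
    exact Finset.sum_congr rfl fun j _ => by ring
  calc ∑ i, x i ^ 2 ≤ ∑ i, (L * c i + (α * a i + β * b i)) ^ 2 :=
        Finset.sum_le_sum fun i _ => pow_le_pow_left₀ (hx i) (hx2 i) 2
    _ = ∑ i, (L ^ 2 * c i ^ 2 + 2 * L * α * (a i * c i) + 2 * L * β * (b i * c i)
          + α ^ 2 * a i ^ 2 + β ^ 2 * b i ^ 2 + 2 * (α * β) * (a i * b i)) :=
        Finset.sum_congr rfl fun i _ => by ring
    _ = L ^ 2 * C + 2 * L * α * α + 2 * L * β * β + α ^ 2 * ∑ i, a i ^ 2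
          + β ^ 2 * ∑ i, b i ^ 2 + 2 * (α * β) * ∑ i, a i * b i := by
        simp only [Finset.sum_add_distrib, ← Finset.mul_sum, hα, hβ, hC]
    _ ≤ L ^ 2 * C + 2 * L * (κ * C) + 2 * L * (κ * C) + (κ * C) * κ + (κ * C) * κ
          + 2 * (κ * C) * κ := by
        have h1 : 2 * L * α * α ≤ 2 * L * (κ * C) := by nlinarith
        have h2 : 2 * L * β * β ≤ 2 * L * (κ * C) := by nlinarith
        have h3 : α ^ 2 * ∑ i, a i ^ 2 ≤ (κ * C) * κ := by gcongr
        have h4 : β ^ 2 * ∑ i, b i ^ 2 ≤ (κ * C) * κ := by gcongr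
        have h5 : 2 * (α * β) * ∑ i, a i * b i ≤ 2 * (κ * C) * κ := by gcongr
        linarith
    _ = _ := by ring

/-- A Bernstein inequality: if evaluation at the endpoints is bounded, then so is
differentiation. -/
theorem integral_norm_sq_deriv_le (v : Fin k → ℂ) (f : Fin k → ℝ) {T Δ κ : ℝ} (hT : 0 < T)
    (hΔ : 0 ≤ Δ) (hf : ∀ j, |f j| ≤ Δ) (hκ0 : 0 ≤ κ)
    (hκ : ∀ t ∈ Set.Icc (-T) T, ∀ w : Fin k → ℂ, ‖sparseSignal w f t‖ ^ 2 ≤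
      κ * ∫ s in (-T)..T, ‖sparseSignal w f s‖ ^ 2) :
    ∫ s in (-T)..T, ‖sparseSignal (derivCoeff f v) f s‖ ^ 2 ≤
      (2 * Real.pi * Δ + 2 * κ) ^ 2 * ∫ s in (-T)..T, ‖sparseSignal v f s‖ ^ 2 := by
  have hV : 0 ≤ ∑ j, ‖v j‖ ^ 2 := Finset.sum_nonneg fun _ _ => by positivity
  refine le_of_forall_pos_regularizer
    (z := (2 * Real.pi * Δ + 2 * κ) ^ 2 * ∑ j, ‖v j‖ ^ 2) (by positivity) fun μ hμ => ?_
  simp only [intervalIntegral.integral_of_le (show -T ≤ T by linarith)] at hκ ⊢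
  set ν : Measure ℝ := volume.restrict (Set.Ioc (-T) T) with hν
  obtain ⟨φ, hφ1, hφ2, hφ3, hφ4, hφ5⟩ := exists_gram_basis f ν hμ
  -- Orthogonality comes back from Parseval: the coefficient of `φ j` along itself already accounts
  -- for its whole norm.
  have hon : ∀ i j, gramForm f ν μ (φ i) (φ j) = if i = j then 1 else 0 := by
    intro i j
    have h1 := hφ3 (φ j)
    rw [hφ1 j] at h1
    have h2 : ∑ i, ‖gramForm f ν μ (φ i) (φ j)‖ ^ 2 = 1 := by exact_mod_cast h1.symm
    split_ifs with hij
    · rw [hij, hφ1]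
    · have h3 := Finset.sum_erase_add Finset.univ
        (fun i => ‖gramForm f ν μ (φ i) (φ j)‖ ^ 2) (Finset.mem_univ j)
      rw [h2] at h3
      simp only [hφ1 j, norm_one, one_pow] at h3
      have h4 : ∑ i ∈ Finset.univ.erase j, ‖gramForm f ν μ (φ i) (φ j)‖ ^ 2 = 0 := by linarith
      rw [Finset.sum_eq_zero_iff_of_nonneg fun _ _ => by positivity] at h4
      simpa using h4 i (by simp [hij])
  have hA := sum_norm_sq_basis_le hμ hon hφ3 hκ0 (hκ T ⟨by linarith, le_rfl⟩)
  have hB := sum_norm_sq_basis_le hμ hon hφ3 hκ0 (hκ (-T) ⟨le_rfl, by linarith⟩)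
  set c := fun i => gramForm f ν μ (φ i) v with hc
  -- For i < j the entry ⟨Dφ_i, φ_j⟩ vanishes by triangularity, so ⟨φ_i, Dφ_j⟩ equals the boundary
  -- term.
  have hN : ∀ i j, i < j → ‖gramForm f ν μ (φ i) (derivCoeff f (φ j))‖ ≤
      ‖sparseSignal (φ i) f T‖ * ‖sparseSignal (φ j) f T‖ +
        ‖sparseSignal (φ i) f (-T)‖ * ‖sparseSignal (φ j) f (-T)‖ := by
    intro i j hij
    have h1 := gramForm_derivCoeff_add f hT μ (φ i) (φ j)
    rw [← hν, ← conj_gramForm f ν μ (derivCoeff f (φ i)), hφ5 j i hij, map_zero, add_zero] at h1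
    rw [h1]
    refine (norm_sub_le _ _).trans ?_
    simp only [norm_mul, RCLike.norm_conj, le_refl]
  have hmain := sum_sq_le_of_boundary (2 * Real.pi * Δ) κ (by positivity) hκ0
    (fun i => ‖c i‖) (fun i => ‖sparseSignal (φ i) f T‖) (fun i => ‖sparseSignal (φ i) f (-T)‖)
    (fun i => ‖gramForm f ν μ (φ i) (derivCoeff f v)‖) (fun _ => norm_nonneg _)
    (fun _ => norm_nonneg _) (fun _ => norm_nonneg _) (fun _ => norm_nonneg _) hA hB fun i => by
      have h1 : gramForm f ν μ (φ i) (derivCoeff f v) =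
          ∑ j, c j * gramForm f ν μ (φ i) (derivCoeff f (φ j)) := by
        conv_lhs => rw [hφ2 v, map_sum]
        simp only [map_smul]
        rw [gramForm_sum_right]
      have h2 : 2 * Real.pi * Δ * ‖c i‖ = ∑ j, if j = i then 2 * Real.pi * Δ * ‖c j‖ else 0 := by
        simp
      rw [h1, h2, ← Finset.sum_add_distrib]
      refine (norm_sum_le _ _).trans (Finset.sum_le_sum fun j _ => ?_)
      rw [norm_mul]
      have hnn : 0 ≤ ‖c j‖ * (‖sparseSignal (φ i) f T‖ * ‖sparseSignal (φ j) f T‖ +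
        ‖sparseSignal (φ i) f (-T)‖ * ‖sparseSignal (φ j) f (-T)‖) := by positivity
      rcases lt_trichotomy i j with hij | hij | hij
      · rw [if_neg hij.ne', zero_add]
        exact mul_le_mul_of_nonneg_left (hN i j hij) (norm_nonneg _)
      · subst hij
        rw [if_pos rfl, hφ4]
        have h3 : ‖(2 * Real.pi * Complex.I * f i : ℂ)‖ ≤ 2 * Real.pi * Δ := by
          simp only [norm_mul, Complex.norm_I, Complex.norm_real, Complex.norm_ofNat, mul_one,
            Real.norm_eq_abs, abs_of_pos Real.pi_pos]
          exact mul_le_mul_of_nonneg_left (hf i) (by positivity)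
        nlinarith [norm_nonneg (c i)]
      · rw [hφ5 i j hij, norm_zero, mul_zero, if_neg hij.ne, zero_add]
        exact hnn
  have h3 := hφ3 v
  have h4 := hφ3 (derivCoeff f v)
  rw [gramForm_self, Complex.ofReal_inj] at h3 h4
  rw [← h3, ← h4] at hmain
  have h5 : 0 ≤ μ * ∑ j, ‖derivCoeff f v j‖ ^ 2 := by positivity
  calc _ ≤ _ := le_add_of_nonneg_right h5
    _ ≤ _ := hmain
    _ = _ := by ring

end Bernstein

end ClusteredSignal

end

noncomputable section

namespace ClusteredSignal

open MeasureTheory Set Finset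

/-! ### Time shifts of a clustered signal -/

section Shift

variable {k : ℕ}

/-- Cauchy–Schwarz, obtained from the nonnegativity of the variance of h. -/
theorem sq_integral_le (h : ℝ → ℝ) (hh : Continuous h) {β : ℝ} (hβ : 0 < β) :
    (∫ s in (0)..β, h s) ^ 2 ≤ β * ∫ s in (0)..β, h s ^ 2 := by
  set I := ∫ s in (0)..β, h s with hI
  have h0 : 0 ≤ ∫ s in (0)..β, (h s - I / β) ^ 2 :=
    intervalIntegral.integral_nonneg hβ.le fun _ _ => by positivity
  have h1 : ∫ s in (0)..β, (h s - I / β) ^ 2 =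
      (∫ s in (0)..β, h s ^ 2) - 2 * (I / β) * I + β * (I / β) ^ 2 := by
    have : ∀ s, (h s - I / β) ^ 2 = h s ^ 2 - 2 * (I / β) * h s + (I / β) ^ 2 := fun s => by ring
    simp only [this]
    rw [intervalIntegral.integral_add, intervalIntegral.integral_sub,
      intervalIntegral.integral_const_mul, intervalIntegral.integral_const]
    · simp [← hI]
    all_goals exact Continuous.intervalIntegrable (by fun_prop) _ _
  rw [h1] at h0
  have h2 : (∫ s in (0)..β, h s ^ 2) - 2 * (I / β) * I + β * (I / β) ^ 2 =
      (∫ s in (0)..β, h s ^ 2) - I ^ 2 / β := by field_simp; ring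
  rw [h2, sub_nonneg, div_le_iff₀ hβ] at h0
  linarith

theorem setLIntegral_comp_add_le {A B : Set ℝ} (hA : MeasurableSet A) (hB : MeasurableSet B)
    {s : ℝ} (hs : ∀ t ∈ A, t + s ∈ B) (h : ℝ → ℝ≥0∞) :
    ∫⁻ t in A, h (t + s) ≤ ∫⁻ t in B, h t := by
  rw [← lintegral_indicator hA, ← lintegral_indicator hB,
    ← lintegral_add_right_eq_self (B.indicator h) s]
  refine lintegral_mono fun t => ?_
  by_cases ht : t ∈ A
  · simp [ht, hs t ht]
  · simp [ht]

theorem norm_sq_shift_sub_le (v : Fin k → ℂ) (f : Fin k → ℝ) (t : ℝ) {β : ℝ} (hβ : 0 < β) :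
    ‖sparseSignal v f (t + β) - sparseSignal v f t‖ ^ 2 ≤
      β * ∫ s in (0)..β, ‖sparseSignal (derivCoeff f v) f (t + s)‖ ^ 2 := by
  have hc : Continuous fun s => sparseSignal (derivCoeff f v) f (t + s) :=
    (continuous_sparseSignal _ f).comp (by fun_prop)
  have h1 : ∫ s in (0)..β, sparseSignal (derivCoeff f v) f (t + s) =
      sparseSignal v f (t + β) - sparseSignal v f (t + 0) :=
    intervalIntegral.integral_eq_sub_of_hasDerivAt
      (fun x _ => (hasDerivAt_sparseSignal v f (t + x)).comp_const_add t x)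
      (hc.intervalIntegrable _ _)
  rw [add_zero] at h1
  rw [← h1]
  refine le_trans ?_ (sq_integral_le _ hc.norm hβ)
  exact pow_le_pow_left₀ (norm_nonneg _) (intervalIntegral.norm_integral_le_integral_norm hβ.le) 2

theorem enorm_sq_eq_ofReal {E : Type*} [NormedAddCommGroup E] (x : E) :
    ‖x‖ₑ ^ 2 = ENNReal.ofReal (‖x‖ ^ 2) := by
  rw [ENNReal.ofReal_pow (norm_nonneg _), ofReal_norm]

/-- The increment is the integral of the derivative over [0,β]. After Cauchy–Schwarz and Tonelli,
each s ≤ β contributes the energy of the derivative over a translate of [-T, T−β] that stays in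
[-T,T]. -/
theorem lintegral_shift_sub_le (v : Fin k → ℂ) (f : Fin k → ℝ) {T β : ℝ} (hT : 0 < T)
    (hβ : 0 < β) :
    ∫⁻ t in Set.Icc (-T) (T - β), ‖sparseSignal v f (t + β) - sparseSignal v f t‖ₑ ^ 2 ≤
      ENNReal.ofReal (β ^ 2 * ∫ s in (-T)..T, ‖sparseSignal (derivCoeff f v) f s‖ ^ 2) := by
  set g := sparseSignal (derivCoeff f v) f with hg
  have hgc : Continuous g := continuous_sparseSignal _ _
  have h1 : ∀ t, ‖sparseSignal v f (t + β) - sparseSignal v f t‖ₑ ^ 2 ≤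
      ENNReal.ofReal β * ∫⁻ s in Set.Ioc 0 β, ‖g (t + s)‖ₑ ^ 2 := by
    intro t
    have hci : Continuous fun s => ‖g (t + s)‖ ^ 2 := by fun_prop
    have h2 : ∫⁻ s in Set.Ioc 0 β, ‖g (t + s)‖ₑ ^ 2 =
        ENNReal.ofReal (∫ s in (0)..β, ‖g (t + s)‖ ^ 2) := by
      rw [intervalIntegral.integral_of_le hβ.le, ofReal_integral_eq_lintegral_ofReal
        (hci.intervalIntegrable 0 β).1 (ae_of_all _ fun _ => by positivity)]
      simp only [enorm_sq_eq_ofReal]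
    rw [h2, ← ENNReal.ofReal_mul hβ.le, enorm_sq_eq_ofReal]
    exact ENNReal.ofReal_le_ofReal (norm_sq_shift_sub_le v f t hβ)
  calc _ ≤ ∫⁻ t in Set.Icc (-T) (T - β),
        ENNReal.ofReal β * ∫⁻ s in Set.Ioc 0 β, ‖g (t + s)‖ₑ ^ 2 := lintegral_mono fun t => h1 t
    _ = ENNReal.ofReal β * ∫⁻ s in Set.Ioc 0 β, ∫⁻ t in Set.Icc (-T) (T - β),
          ‖g (t + s)‖ₑ ^ 2 := by
        rw [lintegral_const_mul' _ _ ENNReal.ofReal_ne_top, lintegral_lintegral_swap]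
        exact ((hgc.comp (continuous_fst.add continuous_snd)).measurable.enorm.pow_const 2).aemeasurable
    _ ≤ ENNReal.ofReal β * ∫⁻ _ in Set.Ioc 0 β, ∫⁻ t in Set.Icc (-T) T, ‖g t‖ₑ ^ 2 := by
        gcongr ENNReal.ofReal β * ?_
        refine setLIntegral_mono' measurableSet_Ioc fun s hs => ?_
        refine setLIntegral_comp_add_le measurableSet_Icc measurableSet_Icc (fun t ht => ?_)
          (fun t => ‖g t‖ₑ ^ 2)
        exact ⟨by linarith [ht.1, hs.1], by linarith [ht.2, hs.2]⟩
    _ = _ := by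
        rw [setLIntegral_const, Real.volume_Ioc, sub_zero, hg,
          lintegral_enorm_sq_sparseSignal _ _ hT, ENNReal.ofReal_mul (by positivity),
          ENNReal.ofReal_pow hβ.le]
        ring

theorem norm_sparseSignal_sub_freq (v : Fin k → ℂ) (f : Fin k → ℝ) (f₀ t : ℝ) :
    ‖sparseSignal v (fun j => f j - f₀) t‖ = ‖sparseSignal v f t‖ := by
  rw [sparseSignal_sub_freq, norm_mul, Complex.exp_neg, norm_inv, norm_exp_two_pi_I, inv_one,
    one_mul]

/-- The frequencies themselves may leave [-F,F]. Demodulation by f₀ keeps the modulus and brings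
them into [-Δ,Δ], which lies in [-F,F]. -/
theorem norm_sq_le_worstRatio_clustered (hk : 1 ≤ k) (v : Fin k → ℂ) {f : Fin k → ℝ}
    {F T Δ f₀ t : ℝ} (hT : 0 < T) (hΔF : Δ ≤ F) (hf : ∀ i, f i ∈ Set.Icc (f₀ - Δ) (f₀ + Δ))
    (ht : t ∈ Set.Icc (-T) T) :
    ‖sparseSignal v f t‖ ^ 2 ≤ (worstRatio k F T).toReal / (2 * T) *
      ∫ s in (-T)..T, ‖sparseSignal v f s‖ ^ 2 := by
  have := norm_sq_le_worstRatio hk v (f := fun j => f j - f₀) (F := F) hT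
    (fun j => ⟨by linarith [(hf j).1], by linarith [(hf j).2]⟩) ht
  simpa only [norm_sparseSignal_sub_freq] using this

/-- The square integral of the difference between a clustered signal, shifted by `β`, and the
signal times the phase of its central frequency. -/
theorem lintegral_shift_sub_phase_le (hk : 1 ≤ k) (v : Fin k → ℂ) {f : Fin k → ℝ}
    {F T Δ f₀ β : ℝ} (hT : 0 < T) (hΔ : 0 ≤ Δ) (hΔF : Δ ≤ F)
    (hf : ∀ i, f i ∈ Set.Icc (f₀ - Δ) (f₀ + Δ)) (hβ : 0 < β) :
    ∫⁻ t in Set.Icc (-T) (T - β), ‖sparseSignal v f (t + β) -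
        Complex.exp (2 * Real.pi * Complex.I * f₀ * β) * sparseSignal v f t‖ₑ ^ 2 ≤
      ENNReal.ofReal ((β * (2 * Real.pi * Δ + (worstRatio k F T).toReal / T)) ^ 2 *
        ∫ s in (-T)..T, ‖sparseSignal v f s‖ ^ 2) := by
  set R := (worstRatio k F T).toReal with hR
  have hR0 : 0 ≤ R := ENNReal.toReal_nonneg
  set h := sparseSignal v (fun j => f j - f₀) with hh
  have hnorm : ∀ t, ‖sparseSignal v f (t + β) -
      Complex.exp (2 * Real.pi * Complex.I * f₀ * β) * sparseSignal v f t‖ =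
      ‖h (t + β) - h t‖ := by
    intro t
    have h1 : h (t + β) - h t = Complex.exp (-(2 * Real.pi * Complex.I * f₀ * (t + β : ℝ))) *
        (sparseSignal v f (t + β) -
          Complex.exp (2 * Real.pi * Complex.I * f₀ * β) * sparseSignal v f t) := by
      rw [hh, sparseSignal_sub_freq, sparseSignal_sub_freq, mul_sub, ← mul_assoc,
        ← Complex.exp_add]
      congr 3
      push_cast
      ring
    rw [h1, norm_mul, Complex.exp_neg, norm_inv, norm_exp_two_pi_I, inv_one, one_mul]
  simp only [enorm_sq_eq_ofReal, hnorm]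
  simp only [← enorm_sq_eq_ofReal]
  refine (lintegral_shift_sub_le v (fun j => f j - f₀) hT hβ).trans
    (ENNReal.ofReal_le_ofReal ?_)
  -- The value κ = R/(2T) is the definition of R, since the average is taken over an interval of
  -- length 2T.
  have h2 := integral_norm_sq_deriv_le v (fun j => f j - f₀) (T := T) (Δ := Δ) (κ := R / (2 * T))
    hT hΔ (fun j => abs_le.2 ⟨by linarith [(hf j).1], by linarith [(hf j).2]⟩) (by positivity)
    fun t ht w => norm_sq_le_worstRatio hk w hT
      (fun j => ⟨by linarith [(hf j).1], by linarith [(hf j).2]⟩) ht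
  simp only [norm_sparseSignal_sub_freq] at h2
  have h3 : 2 * Real.pi * Δ + 2 * (R / (2 * T)) = 2 * Real.pi * Δ + R / T := by
    congr 1; field_simp
  rw [h3] at h2
  calc _ ≤ β ^ 2 * ((2 * Real.pi * Δ + R / T) ^ 2 * ∫ s in (-T)..T, ‖sparseSignal v f s‖ ^ 2) := by
        simp only [norm_sparseSignal_sub_freq]
        gcongr
    _ = _ := by ring

/-- The deviation of the observed signal at `t + β` from the phase of the central frequency times
the clean signal at `t`. -/
def deviation (y g : ℝ → ℂ) (f₀ β t : ℝ) : ℂ :=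
  y (t + β) - Complex.exp (2 * Real.pi * Complex.I * f₀ * β) * g t

theorem enorm_add_sq_le (x z : ℂ) : ‖x + z‖ₑ ^ 2 ≤ 2 * ‖x‖ₑ ^ 2 + 2 * ‖z‖ₑ ^ 2 := by
  simp only [enorm_sq_eq_ofReal]
  rw [show (2 : ℝ≥0∞) = ENNReal.ofReal 2 by simp, ← ENNReal.ofReal_mul (by norm_num),
    ← ENNReal.ofReal_mul (by norm_num), ← ENNReal.ofReal_add (by positivity) (by positivity)]
  refine ENNReal.ofReal_le_ofReal ?_
  have := norm_add_le x z
  nlinarith [norm_nonneg (x + z), sq_nonneg (‖x‖ - ‖z‖), norm_nonneg x, norm_nonneg z]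

/-- Up to T − β the point t + β is still observable, and the deviation is the shift error plus the
noise. On the last stretch of length β the reading is 0 and the deviation has modulus |g(t)|; by the
definition of R this stretch holds at most the fraction βR/(2T) of the energy. -/
theorem lintegral_deviation_le (hk : 1 ≤ k) (v : Fin k → ℂ) {f : Fin k → ℝ} {η y : ℝ → ℂ}
    {F T Δ f₀ β ε b : ℝ} (hT : 0 < T) (hΔ : 0 ≤ Δ) (hΔF : Δ ≤ F)
    (hf : ∀ i, f i ∈ Set.Icc (f₀ - Δ) (f₀ + Δ)) (hε : 0 ≤ ε)
    (hηb : ∫⁻ t in Set.Icc (-T) T, ‖η t‖ₑ ^ 2 ≤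
      ENNReal.ofReal (ε * ∫ s in (-T)..T, ‖sparseSignal v f s‖ ^ 2))
    (hy : y = observed T (fun t => sparseSignal v f t + η t))
    (hβ : 0 < β) (hb : β * (Δ + (worstRatio k F T).toReal / T) ≤ b) (hb1 : b ≤ 1)
    (hR : 1 ≤ (worstRatio k F T).toReal) :
    ∫⁻ t in Set.Icc (-T) T, ‖deviation y (sparseSignal v f) f₀ β t‖ₑ ^ 2 ≤
      ENNReal.ofReal ((98 * b ^ 2 + 2 * ε + b) *
        ∫ s in (-T)..T, ‖sparseSignal v f s‖ ^ 2) := by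
  set R := (worstRatio k F T).toReal with hRdef
  set g := sparseSignal v f with hg
  set G := ∫ s in (-T)..T, ‖g s‖ ^ 2 with hG
  have hG0 : 0 ≤ G := intervalIntegral.integral_nonneg (by linarith) fun _ _ => by positivity
  have hβR : β * (R / T) ≤ b := by nlinarith [mul_nonneg hβ.le hΔ]
  have hβT : β ≤ T := by
    have : β * (1 / T) ≤ 1 := by
      refine le_trans ?_ (hβR.trans hb1)
      gcongr
    rwa [mul_one_div, div_le_one hT] at this
  have hunion : Set.Icc (-T) T ⊆ Set.Icc (-T) (T - β) ∪ Set.Ioc (T - β) T := by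
    intro t ht
    rcases le_or_gt t (T - β) with h | h
    · exact Or.inl ⟨ht.1, h⟩
    · exact Or.inr ⟨h, ht.2⟩
  set p := Complex.exp (2 * Real.pi * Complex.I * f₀ * β) with hp
  have hp1 : ‖p‖ = 1 := norm_exp_two_pi_I _ _
  have hgc : Continuous g := continuous_sparseSignal v f
  have hA : ∫⁻ t in Set.Icc (-T) (T - β), ‖deviation y g f₀ β t‖ₑ ^ 2 ≤
      ENNReal.ofReal ((98 * b ^ 2 + 2 * ε) * G) := by
    calc _ ≤ ∫⁻ t in Set.Icc (-T) (T - β), (2 * ‖g (t + β) - p * g t‖ₑ ^ 2 +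
          2 * ‖η (t + β)‖ₑ ^ 2) := by
          refine setLIntegral_mono' measurableSet_Icc fun t ht => ?_
          have hmem : t + β ∈ Set.Icc (-T) T := ⟨by linarith [ht.1], by linarith [ht.2]⟩
          have : deviation y g f₀ β t = (g (t + β) - p * g t) + η (t + β) := by
            rw [deviation, hy, observed, Set.indicator_of_mem hmem]
            ring
          rw [this]
          exact enorm_add_sq_le _ _
      _ = 2 * (∫⁻ t in Set.Icc (-T) (T - β), ‖g (t + β) - p * g t‖ₑ ^ 2) +
          2 * ∫⁻ t in Set.Icc (-T) (T - β), ‖η (t + β)‖ₑ ^ 2 := by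
          rw [lintegral_add_left (Measurable.const_mul (by fun_prop) _),
            lintegral_const_mul' _ _ (by simp), lintegral_const_mul' _ _ (by simp)]
      -- Here 7 is an upper bound for 2π, and 98 = 2 · 7².
      _ ≤ 2 * ENNReal.ofReal ((7 * b) ^ 2 * G) + 2 * ENNReal.ofReal (ε * G) := by
          gcongr ?_ + ?_
          · refine mul_le_mul_right ((lintegral_shift_sub_phase_le hk v hT hΔ hΔF hf hβ).trans
              (ENNReal.ofReal_le_ofReal ?_)) _
            refine mul_le_mul_of_nonneg_right (pow_le_pow_left₀ (by positivity) ?_ 2) hG0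
            have h1 : 2 * Real.pi * Δ ≤ 7 * Δ := by nlinarith [Real.pi_lt_d2]
            have h2 : R / T ≤ 7 * (R / T) := by
              have : 0 ≤ R / T := by positivity
              linarith
            calc β * (2 * Real.pi * Δ + R / T) ≤ β * (7 * Δ + 7 * (R / T)) := by gcongr
              _ = 7 * (β * (Δ + R / T)) := by ring
              _ ≤ 7 * b := by linarith
          · refine mul_le_mul_right (le_trans ?_ hηb) _
            exact setLIntegral_comp_add_le measurableSet_Icc measurableSet_Icc
              (fun t ht => ⟨by linarith [ht.1], by linarith [ht.2]⟩) (fun t => ‖η t‖ₑ ^ 2)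
      _ = _ := by
          rw [show (2 : ℝ≥0∞) = ENNReal.ofReal 2 by simp, ← ENNReal.ofReal_mul (by norm_num),
            ← ENNReal.ofReal_mul (by norm_num),
            ← ENNReal.ofReal_add (by positivity) (by positivity)]
          congr 1
          ring
  have hB : ∫⁻ t in Set.Ioc (T - β) T, ‖deviation y g f₀ β t‖ₑ ^ 2 ≤ ENNReal.ofReal (b * G) := by
    calc _ ≤ ∫⁻ _ in Set.Ioc (T - β) T, ENNReal.ofReal (R / (2 * T) * G) := by
          refine setLIntegral_mono' measurableSet_Ioc fun t ht => ?_
          have hmem : t + β ∉ Set.Icc (-T) T := fun h => by linarith [ht.1, h.2]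
          have : deviation y g f₀ β t = -(p * g t) := by
            rw [deviation, hy, observed, Set.indicator_of_notMem hmem, zero_sub]
          rw [this, enorm_sq_eq_ofReal, norm_neg, norm_mul, hp1, one_mul]
          exact ENNReal.ofReal_le_ofReal (norm_sq_le_worstRatio_clustered hk v hT hΔF hf
            ⟨by linarith [ht.1], ht.2⟩)
      _ = ENNReal.ofReal (R / (2 * T) * G * β) := by
          rw [setLIntegral_const, Real.volume_Ioc, sub_sub_cancel,
            ← ENNReal.ofReal_mul (by positivity)]
      _ ≤ _ := by
          refine ENNReal.ofReal_le_ofReal ?_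
          calc R / (2 * T) * G * β = (β * (R / T)) / 2 * G := by field_simp
            _ ≤ b * G := by
              refine mul_le_mul_of_nonneg_right ?_ hG0
              have : 0 ≤ β * (R / T) := by positivity
              linarith
  calc _ ≤ ∫⁻ t in Set.Icc (-T) (T - β) ∪ Set.Ioc (T - β) T, ‖deviation y g f₀ β t‖ₑ ^ 2 :=
        lintegral_mono_set hunion
    _ ≤ _ := lintegral_union_le _ _ _
    _ ≤ _ := add_le_add hA hB
    _ = _ := by
        have : 0 ≤ b := le_trans (by positivity) hβR
        rw [← ENNReal.ofReal_add (by positivity) (by positivity)]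
        congr 1
        ring

end Shift

end ClusteredSignal

end

noncomputable section

namespace ClusteredSignal

open MeasureTheory Set Finset ProbabilityTheory

/-! ### Importance sampling -/

section Sampling

/-- The sample point for the uniform real `u`; its density is inversely proportional to the
distance to the boundary of `[-T, T]`, cut off at `T / R`. -/
def samplePoint (R T u : ℝ) : ℝ :=
  (T + T / R) * (1 - 2 / (Real.exp ((2 * u - 1) * Real.log (2 * R + 1)) + 1))

/-- The inverse of the density of the sample point. -/
def sampleWeight (R T u : ℝ) : ℝ :=
  Real.log (2 * R + 1) * ((T + T / R) ^ 2 - samplePoint R T u ^ 2) / (T + T / R)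

variable {R T : ℝ}

theorem log_two_mul_add_one_pos (hR : 1 ≤ R) : 0 < Real.log (2 * R + 1) :=
  Real.log_pos (by linarith)

/-- With b = T + T/R and L = log(2R+1), the point is b tanh((2u−1)L/2). Its derivative is L(b² −
t²)/b, the reciprocal of the density of t. -/
theorem hasDerivAt_samplePoint (hR : 1 ≤ R) (hT : 0 < T) (u : ℝ) :
    HasDerivAt (samplePoint R T) (sampleWeight R T u) u := by
  set L := Real.log (2 * R + 1) with hL
  have hb : 0 < T + T / R := by positivity
  have h1 : HasDerivAt (fun u : ℝ => Real.exp ((2 * u - 1) * L) + 1)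
      (Real.exp ((2 * u - 1) * L) * (2 * 1 * L)) u :=
    ((((hasDerivAt_id u).const_mul 2).sub_const 1).mul_const L).exp.add_const 1
  have hpos : 0 < Real.exp ((2 * u - 1) * L) + 1 := by positivity
  have h2 := (((hasDerivAt_const u (2 : ℝ)).div h1 hpos.ne').const_sub 1).const_mul (T + T / R)
  refine h2.congr_deriv ?_
  unfold sampleWeight samplePoint
  rw [← hL]
  set E := Real.exp ((2 * u - 1) * L) with hE
  have hE0 : 0 < E := Real.exp_pos _
  field_simp
  ring

/-- The factor L = log(2R+1) is the one for which tanh(L/2) = R/(R+1) = T/(T + T/R), so that u = 0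
and u = 1 hit the ends of the interval. -/
theorem samplePoint_zero (hR : 1 ≤ R) : samplePoint R T 0 = -T := by
  unfold samplePoint
  rw [mul_zero, zero_sub, neg_one_mul, Real.exp_neg, Real.exp_log (by linarith)]
  field_simp
  ring

theorem samplePoint_one (hR : 1 ≤ R) : samplePoint R T 1 = T := by
  unfold samplePoint
  rw [show ((2 : ℝ) * 1 - 1) = 1 by norm_num, one_mul, Real.exp_log (by linarith)]
  field_simp
  ring

theorem strictMono_samplePoint (hR : 1 ≤ R) (hT : 0 < T) : StrictMono (samplePoint R T) := by
  intro u w huw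
  unfold samplePoint
  have hL := log_two_mul_add_one_pos hR
  have : Real.exp ((2 * u - 1) * Real.log (2 * R + 1)) <
      Real.exp ((2 * w - 1) * Real.log (2 * R + 1)) := by
    refine Real.exp_lt_exp.2 ?_
    nlinarith
  gcongr

theorem samplePoint_mem (hR : 1 ≤ R) (hT : 0 < T) {u : ℝ} (hu : u ∈ Set.Icc (0 : ℝ) 1) :
    samplePoint R T u ∈ Set.Icc (-T) T := by
  have h0 := (strictMono_samplePoint hR hT).monotone hu.1
  have h1 := (strictMono_samplePoint hR hT).monotone hu.2
  rw [samplePoint_zero hR] at h0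
  rw [samplePoint_one hR] at h1
  exact ⟨h0, h1⟩

theorem sampleWeight_nonneg (hR : 1 ≤ R) (hT : 0 < T) {u : ℝ} (hu : u ∈ Set.Icc (0 : ℝ) 1) :
    0 ≤ sampleWeight R T u := by
  have h1 := samplePoint_mem hR hT hu
  have hL := log_two_mul_add_one_pos hR
  unfold sampleWeight
  have h2 : 0 ≤ (T + T / R) ^ 2 - samplePoint R T u ^ 2 := by
    have : 0 < T / R := by positivity
    nlinarith [h1.1, h1.2]
  positivity

theorem continuous_samplePoint (hR : 1 ≤ R) (hT : 0 < T) : Continuous (samplePoint R T) :=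
  continuous_iff_continuousAt.2 fun u => (hasDerivAt_samplePoint hR hT u).continuousAt

theorem continuous_sampleWeight (hR : 1 ≤ R) (hT : 0 < T) : Continuous (sampleWeight R T) := by
  have := continuous_samplePoint hR hT
  unfold sampleWeight
  fun_prop

theorem lintegral_unitInterval (h : ℝ → ℝ≥0∞) :
    ∫⁻ u : unitInterval, h u = ∫⁻ u in Set.Icc (0 : ℝ) 1, h u :=
  lintegral_subtype_comap measurableSet_Icc h

/-- Importance sampling is unbiased. -/
theorem lintegral_sample (hR : 1 ≤ R) (hT : 0 < T) (h : ℝ → ℝ≥0∞) :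
    ∫⁻ u : unitInterval, ENNReal.ofReal (sampleWeight R T u) * h (samplePoint R T u) =
      ∫⁻ t in Set.Icc (-T) T, h t := by
  rw [lintegral_unitInterval fun u => ENNReal.ofReal (sampleWeight R T u) * h (samplePoint R T u)]
  have himg : samplePoint R T '' Set.Icc 0 1 = Set.Icc (-T) T := by
    refine Set.Subset.antisymm ?_ ?_
    · rintro _ ⟨u, hu, rfl⟩
      exact samplePoint_mem hR hT hu
    · have := intermediate_value_Icc zero_le_one (continuous_samplePoint hR hT).continuousOn
      rwa [samplePoint_zero hR, samplePoint_one hR] at this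
  rw [← himg, lintegral_image_eq_lintegral_abs_deriv_mul measurableSet_Icc
    (fun u _ => (hasDerivAt_samplePoint hR hT u).hasDerivWithinAt)
    (strictMono_samplePoint hR hT).injective.injOn]
  refine setLIntegral_congr_fun measurableSet_Icc fun u hu => ?_
  rw [abs_of_nonneg (sampleWeight_nonneg hR hT hu)]

variable {k : ℕ}

/-- The weighted square of a signal is bounded. -/
theorem sampleWeight_mul_norm_sq_le (v : Fin k → ℂ) (f : Fin k → ℝ) (hk : 1 ≤ k)
    (hR : 1 ≤ R) (hT : 0 < T)
    (hv : ∀ t ∈ Set.Icc (-T) T, ‖sparseSignal v f t‖ ^ 2 ≤ R / (2 * T) *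
      ∫ s in (-T)..T, ‖sparseSignal v f s‖ ^ 2) {u : ℝ} (hu : u ∈ Set.Icc (0 : ℝ) 1) :
    sampleWeight R T u * ‖sparseSignal v f (samplePoint R T u)‖ ^ 2 ≤
      3 * k * Real.log (2 * R + 1) * ∫ s in (-T)..T, ‖sparseSignal v f s‖ ^ 2 := by
  set G := ∫ s in (-T)..T, ‖sparseSignal v f s‖ ^ 2 with hG
  have hG0 : 0 ≤ G := intervalIntegral.integral_nonneg (by linarith) fun _ _ => by positivity
  set t := samplePoint R T u with ht
  have htm : t ∈ Set.Icc (-T) T := samplePoint_mem hR hT hu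
  set L := Real.log (2 * R + 1) with hL
  have hL0 : 0 < L := log_two_mul_add_one_pos hR
  set b := T + T / R with hb
  have hTR : 0 < T / R := by positivity
  have hb0 : 0 < b := by positivity
  have habs : |t| ≤ T := abs_le.2 htm
  -- The factor b − |t| is the distance T − |t| to the boundary plus T/R. The interior bound pays
  -- for the first summand, the definition of R for the second.
  have hw : sampleWeight R T u ≤ 2 * L * (b - |t|) := by
    unfold sampleWeight
    rw [← ht, ← hL, ← hb, div_le_iff₀ hb0]
    have h1 : b ^ 2 - t ^ 2 = (b - |t|) * (b + |t|) := by rw [← sq_abs t]; ring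
    rw [h1]
    have h2 : (b - |t|) * (b + |t|) ≤ (b - |t|) * (2 * b) := by
      refine mul_le_mul_of_nonneg_left ?_ ?_ <;> linarith
    nlinarith
  have hint : (T - |t|) * ‖sparseSignal v f t‖ ^ 2 ≤ k * G := by
    rcases habs.lt_or_eq with h | h
    · have h1 := norm_sq_le_interior v f (r := (T - |t|) / 2) (by linarith) t
      have h2 : 2 * ((T - |t|) / 2) = T - |t| := by ring
      rw [h2] at h1
      refine h1.trans (mul_le_mul_of_nonneg_left ?_ (by positivity))
      refine intervalIntegral.integral_mono_interval ?_ ?_ ?_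
        (ae_of_all _ fun _ => by positivity) (intervalIntegrable_norm_sq v f _ _)
      · linarith [neg_abs_le t]
      · linarith
      · linarith [le_abs_self t]
    · rw [h, sub_self, zero_mul]
      positivity
  have hedge : T / R * ‖sparseSignal v f t‖ ^ 2 ≤ G / 2 := by
    calc T / R * ‖sparseSignal v f t‖ ^ 2 ≤ T / R * (R / (2 * T) * G) :=
          mul_le_mul_of_nonneg_left (hv t htm) hTR.le
      _ = G / 2 := by field_simp
  have hk1 : (1 : ℝ) ≤ k := by exact_mod_cast hk
  calc _ ≤ 2 * L * (b - |t|) * ‖sparseSignal v f t‖ ^ 2 := by gcongr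
    _ = 2 * L * ((T - |t|) * ‖sparseSignal v f t‖ ^ 2 + T / R * ‖sparseSignal v f t‖ ^ 2) := by
        rw [hb]; ring
    _ ≤ 2 * L * (k * G + G / 2) := by gcongr
    _ ≤ 3 * k * L * G := by nlinarith [mul_nonneg hL0.le hG0]

end Sampling

/-! ### Independent random reals and concentration -/

section Coins

instance : IsProbabilityMeasure coinLaw := by unfold coinLaw; infer_instance

theorem lintegral_coin (i : ℕ) {h : unitInterval → ℝ≥0∞} (hh : Measurable h) :
    ∫⁻ ω, h (ω i) ∂coinLaw = ∫⁻ u, h u :=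
  (measurePreserving_eval_infinitePi (fun _ : ℕ => (volume : Measure unitInterval)) i).lintegral_comp
    hh

/-- The first `q` terms of one sequence followed by another sequence. -/
def splice (q : ℕ) (p : (ℕ → unitInterval) × (ℕ → unitInterval)) : ℕ → unitInterval :=
  fun i => if i < q then p.1 i else p.2 (i - q)

theorem measurable_splice (q : ℕ) : Measurable (splice q) := by
  refine measurable_pi_lambda _ fun i => ?_
  unfold splice
  split_ifs <;> fun_prop

/-- Checked on finite boxes: a box constrains the indices below q and, shifted by q, the later ones.
This replaces conditioning on the past by Fubini's theorem. -/
theorem map_splice (q : ℕ) : (coinLaw.prod coinLaw).map (splice q) = coinLaw := by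
  conv_rhs => rw [coinLaw]
  refine Measure.eq_infinitePi _ fun s t ht => ?_
  rw [Measure.map_apply (measurable_splice q)
    (MeasurableSet.pi s.countable_toSet fun i _ => ht i)]
  have hpre : splice q ⁻¹' (Set.pi s t) =
      (Set.pi (s.filter (· < q)) t) ×ˢ
        (Set.pi ((s.filter (¬ · < q)).image (· - q)) fun i => t (i + q)) := by
    ext ⟨ω₁, ω₂⟩
    simp only [Set.mem_preimage, Set.mem_pi, Set.mem_prod, splice, Finset.mem_coe,
      Finset.mem_filter, Finset.mem_image, not_lt]
    constructor
    · intro h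
      refine ⟨fun i hi => by simpa [hi.2] using h i hi.1, ?_⟩
      rintro j ⟨i, hi, rfl⟩
      rw [Nat.sub_add_cancel hi.2]
      simpa [Nat.not_lt.2 hi.2] using h i hi.1
    · rintro ⟨h1, h2⟩ i hi
      split_ifs with hq
      · exact h1 i ⟨hi, hq⟩
      · have := h2 (i - q) ⟨i, ⟨hi, by omega⟩, rfl⟩
        rwa [Nat.sub_add_cancel (by omega)] at this
  rw [hpre, Measure.prod_prod, coinLaw, Measure.infinitePi_pi _ fun i _ => ht i,
    Measure.infinitePi_pi _ fun i _ => ht _, Finset.prod_image]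
  · rw [← Finset.prod_filter_mul_prod_filter_not s (· < q)]
    congr 1
    refine Finset.prod_congr rfl fun i hi => ?_
    rw [Nat.sub_add_cancel (by simpa using (Finset.mem_filter.1 hi).2)]
  · intro i hi j hj hij
    simp only [Finset.coe_filter, Set.mem_ofPred_eq] at hi hj
    simp only at hij
    omega

theorem lintegral_splice (q : ℕ) {h : (ℕ → unitInterval) → ℝ≥0∞} (hh : Measurable h) :
    ∫⁻ ω, h ω ∂coinLaw = ∫⁻ ω₁, ∫⁻ ω₂, h (splice q (ω₁, ω₂)) ∂coinLaw ∂coinLaw := by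
  conv_lhs => rw [← map_splice q]
  rw [lintegral_map hh (measurable_splice q)]
  exact lintegral_prod (fun p => h (splice q p)) (hh.comp (measurable_splice q)).aemeasurable

variable {R T : ℝ}

/-- The weighted square of a function that may depend on a first random real, at the sample point
given by a second one. -/
def sampleTerm (R T : ℝ) (φ : unitInterval → ℝ → ℂ) (p : unitInterval × unitInterval) : ℝ :=
  sampleWeight R T p.2 * ‖φ p.1 (samplePoint R T p.2)‖ ^ 2

/-- The weighted sum of squares of a function that may depend on the first random real, over
sample points given by the next `m` random reals. -/
def sampleSum (R T : ℝ) (m : ℕ) (φ : unitInterval → ℝ → ℂ) (ω : ℕ → unitInterval) : ℝ :=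
  ∑ i ∈ Finset.range m, sampleTerm R T φ (ω 0, ω (i + 1))

theorem measurable_sampleTerm (hR : 1 ≤ R) (hT : 0 < T) {φ : unitInterval → ℝ → ℂ}
    (hφ : Measurable (Function.uncurry φ)) :
    Measurable (sampleTerm R T φ) := by
  have h1 := (continuous_samplePoint hR hT).measurable
  have h2 := (continuous_sampleWeight hR hT).measurable
  have h3 : Measurable fun p : unitInterval × unitInterval => φ p.1 (samplePoint R T p.2) :=
    hφ.comp (measurable_fst.prodMk (h1.comp (measurable_subtype_coe.comp measurable_snd)))
  exact (h2.comp (measurable_subtype_coe.comp measurable_snd)).mul (h3.norm.pow_const 2)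

theorem measurable_sampleSum (hR : 1 ≤ R) (hT : 0 < T) (m : ℕ) {φ : unitInterval → ℝ → ℂ}
    (hφ : Measurable (Function.uncurry φ)) : Measurable (sampleSum R T m φ) := by
  have hpair : ∀ i : ℕ, Measurable fun ω : ℕ → unitInterval => (ω 0, ω (i + 1)) := fun i =>
    (measurable_pi_apply 0).prodMk (measurable_pi_apply (i + 1))
  have h := measurable_sampleTerm hR hT hφ
  unfold sampleSum
  exact Finset.measurable_fun_sum _ fun i _ => h.comp (hpair i)

/-- Markov's inequality. The function may depend on `ω 0`, as the deviation does through the random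
shift. The sample points use later random reals, so unbiasedness applies for each fixed value of `ω
0`. -/
theorem measure_lt_sampleSum_le (hR : 1 ≤ R) (hT : 0 < T) (m : ℕ) {φ : unitInterval → ℝ → ℂ}
    (hφ : Measurable (Function.uncurry φ)) {c θ : ℝ} (hθ : 0 < θ)
    (h : ∀ u, ∫⁻ t in Set.Icc (-T) T, ‖φ u t‖ₑ ^ 2 ≤ ENNReal.ofReal c) :
    coinLaw {ω | θ < sampleSum R T m φ ω} ≤ ENNReal.ofReal (m * c / θ) := by
  have hterm : ∀ p, 0 ≤ sampleTerm R T φ p := fun p =>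
    mul_nonneg (sampleWeight_nonneg hR hT p.2.2) (by positivity)
  obtain ⟨K, hK⟩ : ∃ K : unitInterval × unitInterval → ℝ≥0∞,
      K = fun p => ENNReal.ofReal (sampleTerm R T φ p) := ⟨_, rfl⟩
  have hKm : Measurable K := hK ▸ (measurable_sampleTerm hR hT hφ).ennreal_ofReal
  have hpair : ∀ i : ℕ, Measurable fun ω : ℕ → unitInterval => (ω 0, ω (i + 1)) := fun i =>
    (measurable_pi_apply 0).prodMk (measurable_pi_apply (i + 1))
  have hE : ∫⁻ ω, ENNReal.ofReal (sampleSum R T m φ ω) ∂coinLaw ≤ m * ENNReal.ofReal c := by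
    have h1 : ∀ ω, ENNReal.ofReal (sampleSum R T m φ ω) =
        ∑ i ∈ Finset.range m, K (ω 0, ω (i + 1)) := fun ω => by
      rw [sampleSum, ENNReal.ofReal_sum_of_nonneg fun i _ => hterm _, hK]
    simp only [h1]
    rw [lintegral_finsetSum (f := fun i (ω : ℕ → unitInterval) => K (ω 0, ω (i + 1))) _
      fun i _ => hKm.comp (hpair i)]
    calc _ ≤ ∑ i ∈ Finset.range m, ENNReal.ofReal c := by
          refine Finset.sum_le_sum fun i _ => ?_
          rw [lintegral_splice 1 (h := fun ω => K (ω 0, ω (i + 1))) (hKm.comp (hpair i))]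
          calc _ ≤ ∫⁻ _ : ℕ → unitInterval, ENNReal.ofReal c ∂coinLaw := by
                refine lintegral_mono fun ω₁ => ?_
                have h2 : ∀ ω₂, K (splice 1 (ω₁, ω₂) 0, splice 1 (ω₁, ω₂) (i + 1)) =
                    K (ω₁ 0, ω₂ i) := fun ω₂ => by simp [splice]
                simp only [h2]
                rw [lintegral_coin i (h := fun u => K (ω₁ 0, u))
                  (hKm.comp (measurable_const.prodMk measurable_id))]
                refine le_trans (le_of_eq ?_) (h (ω₁ 0))
                rw [← lintegral_sample hR hT fun t => ‖φ (ω₁ 0) t‖ₑ ^ 2]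
                refine lintegral_congr fun u => ?_
                rw [hK]
                simp only [sampleTerm]
                rw [ENNReal.ofReal_mul (sampleWeight_nonneg hR hT u.2), enorm_sq_eq_ofReal]
            _ = _ := by simp
      _ = _ := by simp
  have hmk := mul_meas_ge_le_lintegral (μ := coinLaw)
    (measurable_sampleSum hR hT m hφ).ennreal_ofReal (ENNReal.ofReal θ)
  calc coinLaw {ω | θ < sampleSum R T m φ ω}
      ≤ coinLaw {ω | ENNReal.ofReal θ ≤ ENNReal.ofReal (sampleSum R T m φ ω)} := by
        refine measure_mono fun ω hω => ?_
        exact ENNReal.ofReal_le_ofReal (le_of_lt hω)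
    _ ≤ m * ENNReal.ofReal c / ENNReal.ofReal θ := by
        rw [ENNReal.le_div_iff_mul_le (Or.inl (by simpa using hθ)) (Or.inl ENNReal.ofReal_ne_top),
          mul_comm]
        exact hmk.trans hE
    _ = _ := by
        rw [ENNReal.ofReal_div_of_pos hθ, ENNReal.ofReal_mul (by positivity),
          ENNReal.ofReal_natCast]

/-- The weighted sum of squares of a function with bounded weighted squares concentrates. -/
theorem measure_sampleSum_lt_le (hR : 1 ≤ R) (hT : 0 < T) {m : ℕ} (hm : 0 < m) {g : ℝ → ℂ}
    (hg : Measurable g) {G κ : ℝ} (hG : 0 < G)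
    (hint : ∫⁻ t in Set.Icc (-T) T, ‖g t‖ₑ ^ 2 = ENNReal.ofReal G)
    (hκ : ∀ u ∈ Set.Icc (0 : ℝ) 1,
      sampleWeight R T u * ‖g (samplePoint R T u)‖ ^ 2 ≤ κ * G) :
    coinLaw {ω | sampleSum R T m (fun _ => g) ω < m * G / 2} ≤ ENNReal.ofReal (4 * κ / m) := by
  set x : unitInterval → ℝ := fun u => sampleWeight R T u * ‖g (samplePoint R T u)‖ ^ 2 with hx
  have hxm : Measurable x := by
    have h1 := (continuous_samplePoint hR hT).measurable
    have h2 := (continuous_sampleWeight hR hT).measurable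
    exact (h2.comp measurable_subtype_coe).mul
      ((hg.comp (h1.comp measurable_subtype_coe)).norm.pow_const 2)
  have hx0 : ∀ u, 0 ≤ x u := fun u => mul_nonneg (sampleWeight_nonneg hR hT u.2) (by positivity)
  have hxκ : ∀ u, x u ≤ κ * G := fun u => hκ u u.2
  set X : ℕ → (ℕ → unitInterval) → ℝ := fun i ω => x (ω (i + 1)) with hX
  have hXm : ∀ i, Measurable (X i) := fun i => hxm.comp (measurable_pi_apply (i + 1))
  have hmem : ∀ i, MemLp (X i) 2 coinLaw := fun i =>
    MemLp.of_bound (hXm i).aestronglyMeasurable (κ * G) (ae_of_all _ fun ω => by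
      rw [Real.norm_of_nonneg (hx0 _)]; exact hxκ _)
  have hexp : ∀ i, ∫ ω, X i ω ∂coinLaw = G := by
    intro i
    rw [integral_eq_lintegral_of_nonneg_ae (ae_of_all _ fun ω => hx0 _)
      (hXm i).aestronglyMeasurable, lintegral_coin (i + 1) (h := fun u => ENNReal.ofReal (x u))
      hxm.ennreal_ofReal]
    have : ∫⁻ u, ENNReal.ofReal (x u) = ENNReal.ofReal G := by
      rw [← hint, ← lintegral_sample hR hT]
      refine lintegral_congr fun u => ?_
      rw [hx]
      simp only
      rw [ENNReal.ofReal_mul (sampleWeight_nonneg hR hT u.2), enorm_sq_eq_ofReal]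
    rw [this, ENNReal.toReal_ofReal hG.le]
  -- A nonnegative variable bounded by κG with mean G has second moment at most κG · G. Chebyshev's
  -- inequality below then needs m of order κ only.
  have hvar : ∀ i, variance (X i) coinLaw ≤ κ * G * G := by
    intro i
    refine (variance_le_expectation_sq (hXm i).aestronglyMeasurable).trans ?_
    calc ∫ ω, (X i ^ 2) ω ∂coinLaw ≤ ∫ ω, κ * G * X i ω ∂coinLaw := by
          refine integral_mono_ae (hmem i).integrable_sq
            (((hmem i).integrable (by norm_num)).const_mul _) (ae_of_all _ fun ω => ?_)
          simp only [Pi.pow_apply, sq]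
          exact mul_le_mul_of_nonneg_right (hxκ _) (hx0 _)
      _ = _ := by rw [integral_const_mul, hexp]
  have hindep : iIndepFun (fun (i : ℕ) (ω : ℕ → unitInterval) => x (ω i)) coinLaw :=
    iIndepFun_infinitePi (X := fun _ => x) fun _ => hxm
  set S := ∑ i ∈ Finset.range m, X i with hS
  have hSvar : variance S coinLaw ≤ m * (κ * G * G) := by
    rw [hS, IndepFun.variance_sum (fun i _ => hmem i)]
    · refine (Finset.sum_le_sum fun i _ => hvar i).trans (by simp)
    · intro i _ j _ hij
      exact hindep.indepFun (by simpa using hij)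
  have hSexp : ∫ ω, S ω ∂coinLaw = m * G := by
    rw [hS]
    simp only [Finset.sum_apply]
    rw [integral_finsetSum _ fun i _ => (hmem i).integrable (by norm_num)]
    simp [hexp]
  have hSmem : MemLp S 2 coinLaw := memLp_finsetSum' _ fun i _ => hmem i
  have hm' : (0 : ℝ) < m := by exact_mod_cast hm
  have hch := meas_ge_le_variance_div_sq hSmem (c := m * G / 2) (by positivity)
  refine (measure_mono fun ω hω => ?_).trans (hch.trans (ENNReal.ofReal_le_ofReal ?_))
  · simp only [Set.mem_ofPred_eq] at hω ⊢
    rw [hSexp]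
    have : S ω = sampleSum R T m (fun _ => g) ω := by
      rw [hS, Finset.sum_apply, sampleSum]
      rfl
    rw [this, abs_sub_comm]
    refine le_trans ?_ (le_abs_self _)
    linarith
  · calc _ ≤ m * (κ * G * G) / (m * G / 2) ^ 2 := by gcongr
      _ = _ := by field_simp; ring

end Coins

end ClusteredSignal

end

noncomputable section

namespace ClusteredSignal

open MeasureTheory Set Finset ProbabilityTheory

/-! ### Random dilations avoid the nonzero integers -/

section Alias

theorem volume_alias_interval_le {x τ : ℝ} (hx : 0 < x) (n : ℝ) :
    volume {u : unitInterval | |x * (1 + u) - n| ≤ τ} ≤ ENNReal.ofReal (2 * τ / x) := by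
  rw [unitInterval.volume_apply]
  calc _ ≤ volume (Set.Icc ((n - τ) / x - 1) ((n + τ) / x - 1)) := by
        refine measure_mono ?_
        rintro _ ⟨u, hu, rfl⟩
        rw [Set.mem_ofPred_eq] at hu
        have h := abs_le.1 hu
        constructor
        · rw [sub_le_iff_le_add, div_le_iff₀ hx]; nlinarith [h.1]
        · rw [le_sub_iff_add_le, le_div_iff₀ hx]; nlinarith [h.2]
    _ = _ := by
        rw [Real.volume_Icc]
        congr 1
        field_simp
        ring

/-- At most x + 3 integers are in reach of x(1+u), and each captures u with probability at most
6·10⁻⁵/x. For small x this sum is useless, but then x(1+u) stays clear of 1. -/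
theorem volume_alias_nat_le {x : ℝ} (hx : 0 ≤ x) :
    volume {u : unitInterval | ∃ n : ℕ, 1 ≤ n ∧ |x * (1 + u) - n| ≤ 3 / 100000} ≤
      ENNReal.ofReal (1 / 2000) := by
  by_cases hx1 : x < 49 / 100
  · have : {u : unitInterval | ∃ n : ℕ, 1 ≤ n ∧ |x * (1 + u) - n| ≤ 3 / 100000} = ∅ := by
      ext u
      simp only [Set.mem_ofPred_eq, Set.mem_empty_iff_false, iff_false]
      rintro ⟨n, hn, h⟩
      have hn' : (1 : ℝ) ≤ n := by exact_mod_cast hn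
      have h1 := (abs_le.1 h).1
      have h2 := u.2.2
      have h3 := u.2.1
      nlinarith
    rw [this]
    simp
  · push Not at hx1
    have hx0 : 0 < x := by linarith
    have hsub : {u : unitInterval | ∃ n : ℕ, 1 ≤ n ∧ |x * (1 + u) - n| ≤ 3 / 100000} ⊆
        ⋃ n ∈ Finset.Icc ⌊x⌋₊ (⌊2 * x⌋₊ + 1),
          {u : unitInterval | |x * (1 + u) - (n : ℝ)| ≤ 3 / 100000} := by
      rintro u ⟨n, -, h⟩
      have h1 := abs_le.1 h
      have h2 := u.2.2
      have h3 := u.2.1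
      simp only [Set.mem_iUnion, Finset.mem_Icc]
      refine ⟨n, ⟨?_, ?_⟩, h⟩
      · have h4 := Nat.floor_le hx
        have h5 : (⌊x⌋₊ : ℝ) < n + 1 := by nlinarith [h1.2]
        exact Nat.lt_succ_iff.1 (by exact_mod_cast h5)
      · have h4 := Nat.lt_floor_add_one (2 * x)
        have h5 : (n : ℝ) < ⌊2 * x⌋₊ + 1 + 1 := by nlinarith [h1.1]
        exact Nat.lt_succ_iff.1 (by exact_mod_cast h5)
    have hcard : ((Finset.Icc ⌊x⌋₊ (⌊2 * x⌋₊ + 1)).card : ℝ) ≤ x + 3 := by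
      have h1 : ⌊x⌋₊ ≤ ⌊2 * x⌋₊ := Nat.floor_le_floor (by linarith)
      rw [Nat.card_Icc, Nat.cast_sub (by omega)]
      push_cast
      have h2 := Nat.lt_floor_add_one x
      have h3 := Nat.floor_le (show 0 ≤ 2 * x by linarith)
      linarith
    calc _ ≤ _ := measure_mono hsub
      _ ≤ ∑ n ∈ Finset.Icc ⌊x⌋₊ (⌊2 * x⌋₊ + 1),
          volume {u : unitInterval | |x * (1 + u) - (n : ℝ)| ≤ 3 / 100000} :=
          measure_biUnion_finset_le _ _
      _ ≤ ∑ n ∈ Finset.Icc ⌊x⌋₊ (⌊2 * x⌋₊ + 1), ENNReal.ofReal (2 * (3 / 100000) / x) :=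
          Finset.sum_le_sum fun n _ => volume_alias_interval_le hx0 n
      _ = ENNReal.ofReal ((Finset.Icc ⌊x⌋₊ (⌊2 * x⌋₊ + 1)).card * (2 * (3 / 100000) / x)) := by
          rw [Finset.sum_const, nsmul_eq_mul, ENNReal.ofReal_mul (by positivity),
            ENNReal.ofReal_natCast]
      _ ≤ _ := by
          refine ENNReal.ofReal_le_ofReal ?_
          calc _ ≤ (x + 3) * (2 * (3 / 100000) / x) := by gcongr
            _ ≤ 1 / 2000 := by
              rw [mul_div_assoc', div_le_iff₀ hx0]
              linarith

/-- A random dilation of a real is rarely close to a nonzero integer. -/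
theorem measure_alias_le (x : ℝ) :
    coinLaw {ω | ∃ n : ℤ, n ≠ 0 ∧ |x * (1 + ω 0) - n| ≤ 3 / 100000} ≤
      ENNReal.ofReal (1 / 2000) := by
  have hmp := measurePreserving_eval_infinitePi (fun _ : ℕ => (volume : Measure unitInterval)) 0
  have hsub : {ω : ℕ → unitInterval | ∃ n : ℤ, n ≠ 0 ∧ |x * (1 + ω 0) - n| ≤ 3 / 100000} ⊆
      Function.eval 0 ⁻¹'
        {u : unitInterval | ∃ n : ℕ, 1 ≤ n ∧ |(|x|) * (1 + u) - n| ≤ 3 / 100000} := by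
    rintro ω ⟨n, hn, h⟩
    refine ⟨n.natAbs, by omega, le_trans ?_ h⟩
    have h1 : |x| * (1 + (ω 0 : ℝ)) = |x * (1 + ω 0)| := by
      rw [abs_mul, abs_of_nonneg (a := 1 + (ω 0 : ℝ)) (by linarith [(ω 0).2.1])]
    have h2 : ((n.natAbs : ℕ) : ℝ) = |(n : ℝ)| := by
      rw [Nat.cast_natAbs, Int.cast_abs]
    change |(|x|) * (1 + (ω 0 : ℝ)) - (n.natAbs : ℕ)| ≤ _
    rw [h1, h2]
    exact abs_abs_sub_abs_le _ _
  refine (measure_mono hsub).trans ?_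
  refine le_trans ?_ (volume_alias_nat_le (abs_nonneg x))
  refine le_of_eq (hmp.measure_preimage (MeasurableSet.nullMeasurableSet ?_))
  have : {u : unitInterval | ∃ n : ℕ, 1 ≤ n ∧ |(|x|) * (1 + u) - n| ≤ 3 / 100000} =
      ⋃ n : ℕ, ⋃ _ : 1 ≤ n, {u : unitInterval | |(|x|) * (1 + (u : ℝ)) - n| ≤ 3 / 100000} := by
    ext u
    simp
  rw [this]
  refine MeasurableSet.iUnion fun n => MeasurableSet.iUnion fun _ => ?_
  exact measurableSet_le (by fun_prop) measurable_const

end Alias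

/-! ### Reading off a phase from a perturbed complex number -/

section Phase

/-- A complex number close to `A * exp (i φ)` with small `φ` has a small argument. -/
theorem accepts_of_small_phase {A P Q φ : ℝ} (hA : 0 < A)
    (hP : |P - A * Real.cos φ| ≤ A / 10000000) (hQ : |Q - A * Real.sin φ| ≤ A / 10000000)
    (hφ : |φ| ≤ 1 / 20000) : 10000 * |Q| ≤ P := by
  have h1 : |Real.sin φ| ≤ 1 / 20000 := (Real.abs_sin_le_abs).trans hφ
  have h2 := Real.one_sub_sq_div_two_le_cos (x := φ)
  have h3 : φ ^ 2 ≤ (1 / 20000) ^ 2 := by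
    rw [← sq_abs φ]; exact pow_le_pow_left₀ (abs_nonneg _) hφ 2
  have h4 : |Q| ≤ A * (1 / 20000) + A / 10000000 := by
    calc |Q| = |(Q - A * Real.sin φ) + A * Real.sin φ| := by ring_nf
      _ ≤ _ := abs_add_le _ _
      _ ≤ A / 10000000 + A * (1 / 20000) := by
        rw [abs_mul, abs_of_pos hA]
        gcongr
      _ = _ := by ring
  have h5 : A * (999 / 1000) ≤ A * Real.cos φ := by
    refine mul_le_mul_of_nonneg_left ?_ hA.le
    norm_num at h3
    linarith
  linarith [(abs_le.1 hP).1]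

/-- If a complex number close to `A * exp (i φ)` has a small argument, and `φ` is not close to a
nonzero multiple of `2 π`, then the tangent of the argument is close to `φ`. -/
theorem abs_div_sub_phase_le {A P Q φ : ℝ} (hA : 0 < A)
    (hP : |P - A * Real.cos φ| ≤ A / 10000000) (hQ : |Q - A * Real.sin φ| ≤ A / 10000000)
    (hacc : 10000 * |Q| ≤ P)
    (hal : ¬ ∃ n : ℤ, n ≠ 0 ∧ |φ / (2 * Real.pi) - n| ≤ 3 / 100000) :
    |Q / P - φ| ≤ 1 / 1000000 := by
  have hpi := Real.pi_pos
  -- First everything is proved for the reduction ψ of φ modulo 2π; the absence of aliasing serves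
  -- only to show n = 0.
  set n : ℤ := round (φ / (2 * Real.pi)) with hn
  set ψ := φ - n * (2 * Real.pi) with hψ
  have hcos : Real.cos φ = Real.cos ψ := by rw [hψ, Real.cos_sub_int_mul_two_pi]
  have hsin : Real.sin φ = Real.sin ψ := by rw [hψ, Real.sin_sub_int_mul_two_pi]
  have hψn : ψ / (2 * Real.pi) = φ / (2 * Real.pi) - n := by rw [hψ]; field_simp
  have hψπ : |ψ| ≤ Real.pi := by
    have h1 := abs_sub_round (φ / (2 * Real.pi))
    rw [← hn, ← hψn, abs_div, abs_of_pos (by positivity : 0 < 2 * Real.pi),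
      div_le_iff₀ (by positivity)] at h1
    linarith
  rw [hcos] at hP
  rw [hsin] at hQ
  have hP0 : 0 ≤ P := le_trans (by positivity) hacc
  have hPle : P ≤ A * (1 + 1 / 10000000) := by
    nlinarith [(abs_le.1 hP).2, Real.cos_le_one ψ]
  have hs : |Real.sin ψ| ≤ 11 / 100000 := by
    have h1 : A * |Real.sin ψ| ≤ A * (11 / 100000) := by
      calc A * |Real.sin ψ| = |A * Real.sin ψ| := by rw [abs_mul, abs_of_pos hA]
        _ = |Q - (Q - A * Real.sin ψ)| := by ring_nf
        _ ≤ |Q| + |Q - A * Real.sin ψ| := abs_sub _ _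
        _ ≤ A * (11 / 100000) := by linarith
    exact le_of_mul_le_mul_left h1 hA
  have hc : -(1 / 10000000) ≤ Real.cos ψ := by
    have h1 : A * -(1 / 10000000) ≤ A * Real.cos ψ := by linarith [(abs_le.1 hP).2]
    exact le_of_mul_le_mul_left h1 hA
  have hs2 : Real.sin ψ ^ 2 ≤ (11 / 100000) ^ 2 := by
    rw [← sq_abs]; exact pow_le_pow_left₀ (abs_nonneg _) hs 2
  -- The small sine leaves ψ near 0 or near ±π, and the lower bound for the cosine excludes ±π.
  have hψ2 : |ψ| ≤ Real.pi / 2 := by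
    by_contra hcon
    push Not at hcon
    have h1 : Real.cos |ψ| ≤ 0 :=
      (Real.cos_neg_of_pi_div_two_lt_of_lt hcon (by linarith)).le
    rw [Real.cos_abs] at h1
    nlinarith [Real.sin_sq_add_cos_sq ψ]
  -- Jordan's inequality: 11·10⁻⁵ · π/2 < 176·10⁻⁶. Divided by 2π this is below 3·10⁻⁵, the
  -- threshold in the aliasing condition.
  have hψs : |ψ| ≤ 176 / 1000000 := by
    have h1 : 2 / Real.pi * |ψ| ≤ |Real.sin ψ| := Real.mul_abs_le_abs_sin hψ2
    rw [div_mul_eq_mul_div, div_le_iff₀ hpi] at h1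
    nlinarith [Real.pi_lt_d2, abs_nonneg (Real.sin ψ)]
  have hn0 : n = 0 := by
    by_contra hne
    refine hal ⟨n, hne, ?_⟩
    rw [← hψn, abs_div, abs_of_pos (by positivity : 0 < 2 * Real.pi),
      div_le_iff₀ (by positivity)]
    nlinarith [Real.pi_gt_d2]
  have hφψ : φ = ψ := by rw [hψ, hn0]; simp
  rw [hφψ]
  have hψsq : ψ ^ 2 ≤ (176 / 1000000) ^ 2 := by
    rw [← sq_abs]; exact pow_le_pow_left₀ (abs_nonneg _) hψs 2
  have hcl := Real.one_sub_sq_div_two_le_cos (x := ψ)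
  have hcu := Real.cos_le_one ψ
  have hsb : |Real.sin ψ - ψ| ≤ ψ ^ 2 := by
    have h1 := Real.sin_bound (x := ψ) (by linarith)
    have h2 : |Real.sin ψ - ψ| ≤ |Real.sin ψ - (ψ - ψ ^ 3 / 6)| + |ψ ^ 3 / 6| := by
      calc |Real.sin ψ - ψ| = |(Real.sin ψ - (ψ - ψ ^ 3 / 6)) - ψ ^ 3 / 6| := by ring_nf
        _ ≤ _ := abs_sub _ _
    have h3 : |ψ ^ 3 / 6| = |ψ| * |ψ| ^ 2 / 6 := by
      rw [abs_div, abs_pow, abs_of_pos (by norm_num : (0 : ℝ) < 6)]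
      ring
    have h4 : |ψ| ^ 5 = |ψ| ^ 3 * |ψ| ^ 2 := by ring
    have h5 : |ψ| ^ 3 ≤ 1 := pow_le_one₀ (abs_nonneg _) (by linarith)
    rw [h3] at h2
    rw [h4] at h1
    rw [← sq_abs ψ]
    nlinarith [sq_nonneg |ψ|]
  have hcb : |ψ * (1 - Real.cos ψ)| ≤ ψ ^ 2 := by
    rw [abs_mul, abs_of_nonneg (by linarith : 0 ≤ 1 - Real.cos ψ)]
    nlinarith [abs_nonneg ψ, sq_nonneg ψ]
  have hPlow : A * (99 / 100) ≤ P := by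
    have : A * (999 / 1000) ≤ A * Real.cos ψ := by
      refine mul_le_mul_of_nonneg_left ?_ hA.le
      norm_num at hψsq
      linarith
    linarith [(abs_le.1 hP).1]
  have hPpos : 0 < P := by linarith
  have hnum : |Q - ψ * P| ≤ A * (99 / 100) * (1 / 1000000) := by
    have hdec : Q - ψ * P = (Q - A * Real.sin ψ) + A * (Real.sin ψ - ψ) +
        A * (ψ * (1 - Real.cos ψ)) - ψ * (P - A * Real.cos ψ) := by ring
    have h1 : |A * (Real.sin ψ - ψ)| ≤ A * ψ ^ 2 := by
      rw [abs_mul, abs_of_pos hA]; gcongr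
    have h2 : |A * (ψ * (1 - Real.cos ψ))| ≤ A * ψ ^ 2 := by
      rw [abs_mul, abs_of_pos hA]; gcongr
    have h3 : |ψ * (P - A * Real.cos ψ)| ≤ 176 / 1000000 * (A / 10000000) := by
      rw [abs_mul]; gcongr
    rw [hdec]
    calc _ ≤ |Q - A * Real.sin ψ| + |A * (Real.sin ψ - ψ)| + |A * (ψ * (1 - Real.cos ψ))| +
          |ψ * (P - A * Real.cos ψ)| := by
          refine (abs_sub _ _).trans (add_le_add_left ?_ _)
          exact (abs_add_le _ _).trans (add_le_add_left (abs_add_le _ _) _)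
      _ ≤ A / 10000000 + A * (176 / 1000000) ^ 2 + A * (176 / 1000000) ^ 2 +
          176 / 1000000 * (A / 10000000) := by
          have : A * ψ ^ 2 ≤ A * (176 / 1000000) ^ 2 := by gcongr
          linarith
      _ ≤ _ := by nlinarith
  have hdiv : Q / P - ψ = (Q - ψ * P) / P := by field_simp
  rw [hdiv, abs_div, abs_of_pos hPpos, div_le_iff₀ hPpos]
  refine hnum.trans ?_
  nlinarith

end Phase

end ClusteredSignal

end

noncomputable section

namespace ClusteredSignal

open MeasureTheory Set Finset ProbabilityTheory

/-! ### One step of the search -/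

section Step

/-- The time shift used at resolution `w`, for the uniform real `u`. -/
def shiftLength (w u : ℝ) : ℝ := (1 + u) / (80000 * Real.pi * w)

/-- One term of the empirical correlation of a signal with its shift. -/
def correlationTerm (y : ℝ → ℂ) (R T β u : ℝ) : ℂ :=
  sampleWeight R T u *
    (starRingEnd ℂ (y (samplePoint R T u)) * y (samplePoint R T u + β))

/-- The empirical correlation of a signal with its shift by `β`. -/
def correlation (y : ℝ → ℂ) (R T β : ℝ) (m : ℕ) (ω : ℕ → unitInterval) : ℂ :=
  ∑ i ∈ Finset.range m, correlationTerm y R T β (ω (i + 1))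

/-- The phase of the candidate frequency `c` over the shift at resolution `w`. -/
def candidatePhase (s : ℝ × ℝ) (u : ℝ) : ℝ := 2 * Real.pi * s.1 * shiftLength s.2 u

/-- The real part of the correlation, rotated by the phase of the candidate. -/
def rotatedRe (y : ℝ → ℂ) (R T : ℝ) (m : ℕ) (s : ℝ × ℝ) (ω : ℕ → unitInterval) : ℝ :=
  (correlation y R T (shiftLength s.2 (ω 0)) m ω).re * Real.cos (candidatePhase s (ω 0)) +
    (correlation y R T (shiftLength s.2 (ω 0)) m ω).im * Real.sin (candidatePhase s (ω 0))

/-- The imaginary part of the correlation, rotated by the phase of the candidate. -/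
def rotatedIm (y : ℝ → ℂ) (R T : ℝ) (m : ℕ) (s : ℝ × ℝ) (ω : ℕ → unitInterval) : ℝ :=
  (correlation y R T (shiftLength s.2 (ω 0)) m ω).im * Real.cos (candidatePhase s (ω 0)) -
    (correlation y R T (shiftLength s.2 (ω 0)) m ω).re * Real.sin (candidatePhase s (ω 0))

/-- The test whether the observed phase is consistent with the candidate. -/
def Accepts (y : ℝ → ℂ) (R T : ℝ) (m : ℕ) (s : ℝ × ℝ) (ω : ℕ → unitInterval) : Prop :=
  10000 * |rotatedIm y R T m s ω| ≤ rotatedRe y R T m s ω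

/-- The refined candidate. -/
def refined (y : ℝ → ℂ) (R T : ℝ) (m : ℕ) (s : ℝ × ℝ) (ω : ℕ → unitInterval) : ℝ :=
  s.1 + rotatedIm y R T m s ω / rotatedRe y R T m s ω /
    (2 * Real.pi * shiftLength s.2 (ω 0))

open Classical in
/-- One step of the noisy search: the state is a candidate and a resolution. A consistent
candidate is refined, an inconsistent one is given up for a coarser resolution. -/
def walkStep (y : ℝ → ℂ) (R T F wmin : ℝ) (m : ℕ) (s : ℝ × ℝ) (ω : ℕ → unitInterval) : ℝ × ℝ :=
  if Accepts y R T m s ω then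
    (refined y R T m s ω, if wmin ≤ s.2 / 2 then s.2 / 2 else s.2)
  else if F ≤ s.2 then (0, s.2) else (s.1, 2 * s.2)

/-- A step is correct if it refines to a good candidate or gives up a bad one. -/
def StepCorrect (y : ℝ → ℂ) (R T : ℝ) (m : ℕ) (f₀ : ℝ) (s : ℝ × ℝ) (ω : ℕ → unitInterval) :
    Prop :=
  (Accepts y R T m s ω → |f₀ - refined y R T m s ω| ≤ s.2 / 2) ∧
    (¬ Accepts y R T m s ω → s.2 < |f₀ - s.1|)

variable {y : ℝ → ℂ} {R T : ℝ}

theorem two_pi_mul_shiftLength {w : ℝ} (hw : 0 < w) (u : ℝ) :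
    2 * Real.pi * shiftLength w u = (1 + u) / (40000 * w) := by
  unfold shiftLength
  have := Real.pi_pos
  field_simp
  ring

theorem shiftLength_pos {w : ℝ} (hw : 0 < w) {u : ℝ} (hu : 0 ≤ u) : 0 < shiftLength w u := by
  unfold shiftLength
  have := Real.pi_pos
  positivity

/-- The acceptance test alone bounds the ratio by 1/10000, and 2πβ ≥ 1/(40000 w). So a wrong
acceptance also moves the candidate only a bounded number of resolutions. If the denominator is 0,
the ratio is 0 by convention. -/
theorem abs_refined_sub_le {m : ℕ} {s : ℝ × ℝ} (hw : 0 < s.2) {ω : ℕ → unitInterval}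
    (h : Accepts y R T m s ω) : |refined y R T m s ω - s.1| ≤ 4 * s.2 := by
  unfold Accepts at h
  unfold refined
  rw [add_sub_cancel_left, two_pi_mul_shiftLength hw]
  set P := rotatedRe y R T m s ω
  set Q := rotatedIm y R T m s ω
  have hu := (ω 0).2.1
  have hP0 : 0 ≤ P := le_trans (by positivity) h
  have h1 : |Q / P| ≤ 1 / 10000 := by
    rcases hP0.eq_or_lt with h0 | h0
    · rw [← h0]; simp
    · rw [abs_div, abs_of_pos h0, div_le_iff₀ h0]; linarith
  rw [abs_div, abs_of_pos (a := (1 + (ω 0 : ℝ)) / (40000 * s.2)) (by positivity),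
    div_le_iff₀ (by positivity)]
  calc |Q / P| ≤ 1 / 10000 := h1
    _ ≤ (1 + (ω 0 : ℝ)) / 10000 := by linarith
    _ = _ := by field_simp; norm_num

/-- With y(t) = g + η and y(t+β) = p g + ξ, the product differs from p|g|² by three cross terms. The
weighted inequality ab ≤ (l/2)a² + b²/(2l) puts only a small multiple l on |g|². -/
theorem norm_correlationTerm_sub_le {g η : ℝ → ℂ} {f₀ β u l : ℝ} (hR : 1 ≤ R) (hT : 0 < T)
    (hu : u ∈ Set.Icc (0 : ℝ) 1) (hl : 0 < l)
    (hy : ∀ t ∈ Set.Icc (-T) T, y t = g t + η t) :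
    ‖correlationTerm y R T β u - Complex.exp (2 * Real.pi * Complex.I * f₀ * β) *
      (sampleWeight R T u * ‖g (samplePoint R T u)‖ ^ 2 : ℝ)‖ ≤
      l * (sampleWeight R T u * ‖g (samplePoint R T u)‖ ^ 2) +
        (1 / (2 * l) + 1 / 2) * (sampleWeight R T u * ‖η (samplePoint R T u)‖ ^ 2) +
        (1 / (2 * l) + 1 / 2) *
          (sampleWeight R T u * ‖deviation y g f₀ β (samplePoint R T u)‖ ^ 2) := by
  set t := samplePoint R T u with ht
  have hw := sampleWeight_nonneg hR hT hu
  set w := sampleWeight R T u with hwdef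
  set p := Complex.exp (2 * Real.pi * Complex.I * f₀ * β) with hp
  set ξ := deviation y g f₀ β t with hξ
  have hp1 : ‖p‖ = 1 := norm_exp_two_pi_I _ _
  have hyβ : y (t + β) = p * g t + ξ := by rw [hξ, deviation]; ring
  have hdec : correlationTerm y R T β u - p * (w * ‖g t‖ ^ 2 : ℝ) =
      w * (starRingEnd ℂ (g t) * ξ + starRingEnd ℂ (η t) * (p * g t) +
        starRingEnd ℂ (η t) * ξ) := by
    rw [correlationTerm, ← ht, hyβ, hy t (samplePoint_mem hR hT hu), map_add]
    push_cast
    rw [← Complex.conj_mul']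
    ring
  rw [hdec, norm_mul, Complex.norm_real, Real.norm_of_nonneg hw]
  have h1 : ‖starRingEnd ℂ (g t) * ξ + starRingEnd ℂ (η t) * (p * g t) +
      starRingEnd ℂ (η t) * ξ‖ ≤ ‖g t‖ * ‖ξ‖ + ‖η t‖ * ‖g t‖ + ‖η t‖ * ‖ξ‖ := by
    refine (norm_add₃_le).trans (le_of_eq ?_)
    simp only [norm_mul, RCLike.norm_conj, hp1, one_mul]
  have hamgm : ∀ a b : ℝ, a * b ≤ l / 2 * a ^ 2 + 1 / (2 * l) * b ^ 2 := by
    intro a b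
    have : l / 2 * a ^ 2 + 1 / (2 * l) * b ^ 2 - a * b = (l * a - b) ^ 2 / (2 * l) := by
      field_simp; ring
    have h2 : 0 ≤ (l * a - b) ^ 2 / (2 * l) := by positivity
    linarith
  have h2 : ‖η t‖ * ‖ξ‖ ≤ 1 / 2 * ‖η t‖ ^ 2 + 1 / 2 * ‖ξ‖ ^ 2 := by
    nlinarith [sq_nonneg (‖η t‖ - ‖ξ‖)]
  have h3 := hamgm ‖g t‖ ‖ξ‖
  have h4 := hamgm ‖g t‖ ‖η t‖
  calc _ ≤ w * (l * ‖g t‖ ^ 2 + (1 / (2 * l) + 1 / 2) * ‖η t‖ ^ 2 +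
        (1 / (2 * l) + 1 / 2) * ‖ξ‖ ^ 2) := by
        refine mul_le_mul_of_nonneg_left (h1.trans ?_) hw
        linarith
    _ = _ := by ring

/-- The empirical correlation has the phase of the central frequency, if the noise and the
deviation are small on the sample. -/
theorem norm_correlation_sub_le {g η : ℝ → ℂ} {f₀ w : ℝ} {m : ℕ} {ω : ℕ → unitInterval}
    (hR : 1 ≤ R) (hT : 0 < T) (hy : ∀ t ∈ Set.Icc (-T) T, y t = g t + η t) {A : ℝ}
    (hA : sampleSum R T m (fun _ => g) ω = A)
    (hH : sampleSum R T m (fun _ => η) ω ≤ A / 10 ^ 16)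
    (hX : sampleSum R T m (fun u => deviation y g f₀ (shiftLength w u)) ω ≤ A / 10 ^ 16)
    (hA0 : 0 ≤ A) :
    ‖correlation y R T (shiftLength w (ω 0)) m ω -
      Complex.exp (2 * Real.pi * Complex.I * f₀ * shiftLength w (ω 0)) * A‖ ≤ A / 10000000 := by
  set β := shiftLength w (ω 0) with hβ
  have h1 : correlation y R T β m ω - Complex.exp (2 * Real.pi * Complex.I * f₀ * β) * A =
      ∑ i ∈ Finset.range m, (correlationTerm y R T β (ω (i + 1)) -
        Complex.exp (2 * Real.pi * Complex.I * f₀ * β) *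
          (sampleTerm R T (fun _ => g) (ω 0, ω (i + 1)) : ℝ)) := by
    rw [Finset.sum_sub_distrib, ← Finset.mul_sum, ← hA, sampleSum, correlation]
    push_cast
    rfl
  rw [h1]
  -- The choice l = 10⁻⁸ balances the terms: about 10⁻⁸ A from the signal, and 5·10⁷ · 2·10⁻¹⁶ A =
  -- 10⁻⁸ A from noise and deviation.
  calc _ ≤ ∑ i ∈ Finset.range m, ((1 / 10 ^ 8) * sampleTerm R T (fun _ => g) (ω 0, ω (i + 1)) +
        (1 / (2 * (1 / 10 ^ 8)) + 1 / 2) * sampleTerm R T (fun _ => η) (ω 0, ω (i + 1)) +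
        (1 / (2 * (1 / 10 ^ 8)) + 1 / 2) *
          sampleTerm R T (fun u => deviation y g f₀ (shiftLength w u)) (ω 0, ω (i + 1))) :=
        (norm_sum_le _ _).trans (Finset.sum_le_sum fun i _ =>
          norm_correlationTerm_sub_le hR hT (ω (i + 1)).2 (by norm_num) hy)
    _ = (1 / 10 ^ 8) * A + (1 / (2 * (1 / 10 ^ 8)) + 1 / 2) * sampleSum R T m (fun _ => η) ω +
        (1 / (2 * (1 / 10 ^ 8)) + 1 / 2) *
          sampleSum R T m (fun u => deviation y g f₀ (shiftLength w u)) ω := by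
        rw [Finset.sum_add_distrib, Finset.sum_add_distrib, ← Finset.mul_sum, ← Finset.mul_sum,
          ← Finset.mul_sum, ← hA]
        rfl
    _ ≤ _ := by linarith

/-- After rotation the correlation is close to A e^{iφ} with φ = 2π(f₀ − c)β. Acceptance determines
φ up to 10⁻⁶, and dividing by 2πβ = (1+u)/(40000 w) leaves an error of at most w/25. If |f₀ − c| ≤
w, then |φ| ≤ 1/20000 and the test succeeds. -/
theorem stepCorrect_of_norm_le {m : ℕ} {f₀ A : ℝ} {s : ℝ × ℝ} (hw : 0 < s.2)
    {ω : ℕ → unitInterval} (hA : 0 < A)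
    (hZ : ‖correlation y R T (shiftLength s.2 (ω 0)) m ω -
      Complex.exp (2 * Real.pi * Complex.I * f₀ * shiftLength s.2 (ω 0)) * A‖ ≤ A / 10000000)
    (hal : ¬ ∃ n : ℤ, n ≠ 0 ∧
      |(f₀ - s.1) / (80000 * Real.pi * s.2) * (1 + ω 0) - n| ≤ 3 / 100000) :
    StepCorrect y R T m f₀ s ω := by
  have hpi := Real.pi_pos
  set β := shiftLength s.2 (ω 0) with hβ
  set Z := correlation y R T β m ω with hZdef
  set θ := candidatePhase s (ω 0) with hθ
  set φ := 2 * Real.pi * (f₀ - s.1) * β with hφ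
  set P := rotatedRe y R T m s ω with hP
  set Q := rotatedIm y R T m s ω with hQ
  have hu := (ω 0).2
  have hβ' : 2 * Real.pi * β = (1 + (ω 0 : ℝ)) / (40000 * s.2) := two_pi_mul_shiftLength hw _
  have hφ' : φ = (f₀ - s.1) * ((1 + (ω 0 : ℝ)) / (40000 * s.2)) := by rw [hφ, ← hβ']; ring
  have hPQ : (⟨P, Q⟩ : ℂ) = Complex.exp (((-θ : ℝ) : ℂ) * Complex.I) * Z := by
    rw [Complex.exp_mul_I, ← Complex.ofReal_cos, ← Complex.ofReal_sin]
    apply Complex.ext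
    · simp only [Complex.mul_re, Complex.add_re, Complex.add_im, Complex.ofReal_re,
        Complex.ofReal_im, Complex.I_re, Complex.I_im, Complex.mul_im, Real.cos_neg, Real.sin_neg]
      rw [hP, rotatedRe]
      ring
    · simp only [Complex.mul_re, Complex.add_re, Complex.add_im, Complex.ofReal_re,
        Complex.ofReal_im, Complex.I_re, Complex.I_im, Complex.mul_im, Real.cos_neg, Real.sin_neg]
      rw [hQ, rotatedIm]
      ring
  have hexp : (⟨P, Q⟩ : ℂ) - (A : ℂ) * Complex.exp ((φ : ℂ) * Complex.I) =
      Complex.exp (((-θ : ℝ) : ℂ) * Complex.I) *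
        (Z - Complex.exp (2 * Real.pi * Complex.I * f₀ * β) * A) := by
    rw [hPQ, mul_sub, ← mul_assoc, ← Complex.exp_add, mul_comm (A : ℂ)]
    congr 4
    rw [hφ, hθ, candidatePhase]
    push_cast
    ring
  have hnorm : ‖(⟨P, Q⟩ : ℂ) - (A : ℂ) * Complex.exp ((φ : ℂ) * Complex.I)‖ ≤ A / 10000000 := by
    rw [hexp, norm_mul, Complex.norm_exp_ofReal_mul_I, one_mul]
    exact hZ
  have hre : ((A : ℂ) * Complex.exp ((φ : ℂ) * Complex.I)).re = A * Real.cos φ := by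
    rw [Complex.re_ofReal_mul, Complex.exp_ofReal_mul_I_re]
  have him : ((A : ℂ) * Complex.exp ((φ : ℂ) * Complex.I)).im = A * Real.sin φ := by
    rw [Complex.im_ofReal_mul, Complex.exp_ofReal_mul_I_im]
  have hP1 : |P - A * Real.cos φ| ≤ A / 10000000 := by
    have := (Complex.abs_re_le_norm _).trans hnorm
    rwa [Complex.sub_re, hre] at this
  have hQ1 : |Q - A * Real.sin φ| ≤ A / 10000000 := by
    have := (Complex.abs_im_le_norm _).trans hnorm
    rwa [Complex.sub_im, him] at this
  constructor
  · intro hacc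
    have h1 := abs_div_sub_phase_le hA hP1 hQ1 hacc (by
      have : φ / (2 * Real.pi) = (f₀ - s.1) / (80000 * Real.pi * s.2) * (1 + ω 0) := by
        rw [hφ']; field_simp; ring
      rwa [this])
    have h2 : f₀ - refined y R T m s ω =
        -(Q / P - φ) / ((1 + (ω 0 : ℝ)) / (40000 * s.2)) := by
      have h0 : (0 : ℝ) < (1 + (ω 0 : ℝ)) / (40000 * s.2) := by
        have := hu.1
        positivity
      rw [refined, ← hβ, hβ', ← hP, ← hQ, hφ', neg_sub, sub_div, mul_div_cancel_right₀ _ h0.ne']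
      ring
    have h0 : (0 : ℝ) < (1 + (ω 0 : ℝ)) / (40000 * s.2) := by
      have := hu.1
      positivity
    rw [h2, abs_div, abs_neg, abs_of_pos h0, div_le_iff₀ h0]
    refine h1.trans ?_
    have : s.2 / 2 * ((1 + (ω 0 : ℝ)) / (40000 * s.2)) = (1 + (ω 0 : ℝ)) / 80000 := by
      field_simp; ring
    rw [this]
    linarith [hu.1]
  · intro hrej
    by_contra hle
    push Not at hle
    refine hrej (accepts_of_small_phase hA hP1 hQ1 ?_)
    have hu1 := hu.1
    rw [hφ', abs_mul, abs_of_nonneg (a := (1 + (ω 0 : ℝ)) / (40000 * s.2)) (by positivity)]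
    calc |f₀ - s.1| * ((1 + (ω 0 : ℝ)) / (40000 * s.2)) ≤
          s.2 * ((1 + 1) / (40000 * s.2)) := by
          gcongr
          exact hu.2
      _ = 1 / 20000 := by field_simp; norm_num

variable {k : ℕ}

/-- A step is wrong with small probability. -/
theorem measure_not_stepCorrect_le (hk : 1 ≤ k) (v : Fin k → ℂ) {f : Fin k → ℝ} {η : ℝ → ℂ}
    {F Δ f₀ : ℝ} {m : ℕ} {s : ℝ × ℝ} (hT : 0 < T) (hF : 0 < F) (hΔ : 0 ≤ Δ) (hΔF : Δ ≤ F)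
    (hRdef : R = (worstRatio k F T).toReal)
    (hf : ∀ i, f i ∈ Set.Icc (f₀ - Δ) (f₀ + Δ)) (hη : Measurable η)
    (hG : 0 < ∫ s in (-T)..T, ‖sparseSignal v f s‖ ^ 2)
    (hηb : ∫⁻ t in Set.Icc (-T) T, ‖η t‖ₑ ^ 2 ≤
      ENNReal.ofReal (1 / 10 ^ 21 * ∫ s in (-T)..T, ‖sparseSignal v f s‖ ^ 2))
    (hy : y = observed T (fun t => sparseSignal v f t + η t))
    (hm : 24000 * (k * Real.log (2 * R + 1)) ≤ m) (hs : 10 ^ 18 * (Δ + R / T) ≤ s.2) :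
    coinLaw {ω | ¬ StepCorrect y R T m f₀ s ω} ≤ ENNReal.ofReal (1 / 500) := by
  have hR : 1 ≤ R := hRdef ▸ one_le_toReal_worstRatio hk hF hT
  set g := sparseSignal v f with hg
  set G := ∫ s in (-T)..T, ‖g s‖ ^ 2 with hGdef
  have hk1 : (1 : ℝ) ≤ k := by exact_mod_cast hk
  have hL := log_two_mul_add_one_pos hR
  have hm0 : (0 : ℝ) < m := lt_of_lt_of_le (by positivity) hm
  have hmn : 0 < m := by exact_mod_cast hm0
  have hw : 0 < s.2 := lt_of_lt_of_le (by positivity) hs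
  have hpi := Real.pi_gt_three
  have hgm : Measurable g := (continuous_sparseSignal v f).measurable
  have hym : Measurable y := by
    rw [hy]
    exact Measurable.indicator (hgm.add hη) measurableSet_Icc
  have hyg : ∀ t ∈ Set.Icc (-T) T, y t = g t + η t := fun t ht => by
    rw [hy, observed, Set.indicator_of_mem ht]
  -- On the event that the signal sum A is at least mG/2, sums below θ are below A/10¹⁶.
  set θ : ℝ := m * G / 2 / 10 ^ 16 with hθ
  have hθ0 : 0 < θ := by positivity
  have hdevm : Measurable (Function.uncurry fun (u : unitInterval) t =>
      deviation y g f₀ (shiftLength s.2 u) t) := by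
    unfold deviation shiftLength
    have h1 : Measurable fun p : unitInterval × ℝ =>
        y (p.2 + (1 + (p.1 : ℝ)) / (80000 * Real.pi * s.2)) := hym.comp (by fun_prop)
    have h2 : Measurable fun p : unitInterval × ℝ => g p.2 := hgm.comp (by fun_prop)
    exact h1.sub (Measurable.mul (by fun_prop) h2)
  have e1 : coinLaw {ω | sampleSum R T m (fun _ => g) ω < m * G / 2} ≤
      ENNReal.ofReal (1 / 2000) := by
    refine (measure_sampleSum_lt_le (κ := 3 * k * Real.log (2 * R + 1)) hR hT hmn hgm hG
      (lintegral_enorm_sq_sparseSignal v f hT) fun u hu => ?_).trans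
      (ENNReal.ofReal_le_ofReal ?_)
    · exact sampleWeight_mul_norm_sq_le v f hk hR hT (fun t ht => by
        rw [hRdef]; exact norm_sq_le_worstRatio_clustered hk v hT hΔF hf ht) hu
    -- Chebyshev's inequality gives 4 · 3kL/m with L = log(2R+1), whence the factor 24000.
    · rw [div_le_iff₀ hm0]; linarith
  have e2 : coinLaw {ω | θ < sampleSum R T m (fun _ => η) ω} ≤ ENNReal.ofReal (1 / 2000) := by
    refine (measure_lt_sampleSum_le hR hT m (φ := fun _ => η) (hη.comp measurable_snd) hθ0
      (fun _ => hηb)).trans (ENNReal.ofReal_le_ofReal ?_)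
    rw [div_le_iff₀ hθ0, hθ]
    nlinarith [mul_pos hm0 hG]
  -- The resolution w ≥ 10¹⁸(Δ + R/T) and the shift β ≤ 2/(80000πw) make β(Δ + R/T) smaller than
  -- 10⁻²². Then the noise level 10⁻²¹ dominates, and Markov's inequality applies.
  have e3 : coinLaw {ω | θ <
      sampleSum R T m (fun u => deviation y g f₀ (shiftLength s.2 u)) ω} ≤
      ENNReal.ofReal (1 / 2000) := by
    refine (measure_lt_sampleSum_le hR hT m hdevm hθ0 (fun u =>
      lintegral_deviation_le (b := 1 / 10 ^ 22) hk v hT hΔ hΔF hf (by norm_num) hηb hy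
        (shiftLength_pos hw u.2.1) ?_ (by norm_num) (hRdef ▸ hR))).trans
      (ENNReal.ofReal_le_ofReal ?_)
    · rw [← hRdef, shiftLength, div_mul_eq_mul_div, div_le_iff₀ (by positivity)]
      have h1 : (1 + (u : ℝ)) * (Δ + R / T) ≤ 2 * (Δ + R / T) :=
        mul_le_mul_of_nonneg_right (by linarith [u.2.2]) (by positivity)
      have h2 : 3 * s.2 ≤ Real.pi * s.2 := by nlinarith
      nlinarith
    · rw [div_le_iff₀ hθ0, hθ]
      nlinarith [mul_pos hm0 hG]
  have e4 := measure_alias_le ((f₀ - s.1) / (80000 * Real.pi * s.2))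
  have hsub : {ω | ¬ StepCorrect y R T m f₀ s ω} ⊆
      (({ω | sampleSum R T m (fun _ => g) ω < m * G / 2} ∪
        {ω | θ < sampleSum R T m (fun _ => η) ω}) ∪
        {ω | θ < sampleSum R T m (fun u => deviation y g f₀ (shiftLength s.2 u)) ω}) ∪
        {ω | ∃ n : ℤ, n ≠ 0 ∧
          |(f₀ - s.1) / (80000 * Real.pi * s.2) * (1 + ω 0) - n| ≤ 3 / 100000} := by
    intro ω hω
    by_contra hcon
    simp only [Set.mem_union, Set.mem_ofPred_eq, not_or] at hcon hω
    obtain ⟨⟨⟨h1, h2⟩, h3⟩, h4⟩ := hcon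
    push Not at h1 h2 h3
    set A := sampleSum R T m (fun _ => g) ω with hA
    have hA0 : 0 < A := lt_of_lt_of_le (by positivity) h1
    have hθA : θ ≤ A / 10 ^ 16 := by
      rw [hθ]; gcongr
    exact hω (stepCorrect_of_norm_le hw hA0 (norm_correlation_sub_le hR hT hyg hA.symm
      (h2.trans hθA) (h3.trans hθA) hA0.le) h4)
  calc _ ≤ _ := measure_mono hsub
    _ ≤ ENNReal.ofReal (1 / 2000) + ENNReal.ofReal (1 / 2000) + ENNReal.ofReal (1 / 2000) +
        ENNReal.ofReal (1 / 2000) := by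
        refine (measure_union_le _ _).trans (add_le_add ?_ e4)
        refine (measure_union_le _ _).trans (add_le_add ?_ e3)
        exact (measure_union_le _ _).trans (add_le_add e1 e2)
    _ = _ := by
        rw [← ENNReal.ofReal_add, ← ENNReal.ofReal_add, ← ENNReal.ofReal_add] <;> norm_num

end Step

end ClusteredSignal

end

noncomputable section

namespace ClusteredSignal

open MeasureTheory Set Finset ProbabilityTheory

/-! ### Measurability of a step in the state and the random reals -/

section Measurability

variable {y : ℝ → ℂ} {R T : ℝ}

theorem measurable_correlation (hy : Measurable y) (hR : 1 ≤ R) (hT : 0 < T) (m : ℕ) :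
    Measurable fun p : (ℝ × ℝ) × (ℕ → unitInterval) =>
      correlation y R T (shiftLength p.1.2 (p.2 0)) m p.2 := by
  have h1 := (continuous_samplePoint hR hT).measurable
  have h2 := (continuous_sampleWeight hR hT).measurable
  unfold correlation
  refine Finset.measurable_fun_sum _ fun i _ => ?_
  have hu : Measurable fun p : (ℝ × ℝ) × (ℕ → unitInterval) => (p.2 (i + 1) : ℝ) :=
    measurable_subtype_coe.comp ((measurable_pi_apply (i + 1)).comp measurable_snd)
  have hu0 : Measurable fun p : (ℝ × ℝ) × (ℕ → unitInterval) => (p.2 0 : ℝ) :=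
    measurable_subtype_coe.comp ((measurable_pi_apply 0).comp measurable_snd)
  have hβ : Measurable fun p : (ℝ × ℝ) × (ℕ → unitInterval) => shiftLength p.1.2 (p.2 0) := by
    unfold shiftLength
    fun_prop
  have hp := h1.comp hu
  exact (Complex.measurable_ofReal.comp (h2.comp hu)).mul
    ((Complex.continuous_conj.measurable.comp (hy.comp hp)).mul (hy.comp (hp.add hβ)))

theorem measurable_candidatePhase :
    Measurable fun p : (ℝ × ℝ) × (ℕ → unitInterval) => candidatePhase p.1 (p.2 0) := by
  have hu0 : Measurable fun p : (ℝ × ℝ) × (ℕ → unitInterval) => (p.2 0 : ℝ) :=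
    measurable_subtype_coe.comp ((measurable_pi_apply 0).comp measurable_snd)
  unfold candidatePhase shiftLength
  fun_prop

theorem measurable_rotatedRe (hy : Measurable y) (hR : 1 ≤ R) (hT : 0 < T) (m : ℕ) :
    Measurable fun p : (ℝ × ℝ) × (ℕ → unitInterval) => rotatedRe y R T m p.1 p.2 := by
  have h1 := measurable_correlation hy hR hT m
  have h2 := measurable_candidatePhase
  exact ((Complex.measurable_re.comp h1).mul (Real.measurable_cos.comp h2)).add
    ((Complex.measurable_im.comp h1).mul (Real.measurable_sin.comp h2))

theorem measurable_rotatedIm (hy : Measurable y) (hR : 1 ≤ R) (hT : 0 < T) (m : ℕ) :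
    Measurable fun p : (ℝ × ℝ) × (ℕ → unitInterval) => rotatedIm y R T m p.1 p.2 := by
  have h1 := measurable_correlation hy hR hT m
  have h2 := measurable_candidatePhase
  exact ((Complex.measurable_im.comp h1).mul (Real.measurable_cos.comp h2)).sub
    ((Complex.measurable_re.comp h1).mul (Real.measurable_sin.comp h2))

theorem measurableSet_accepts (hy : Measurable y) (hR : 1 ≤ R) (hT : 0 < T) (m : ℕ) :
    MeasurableSet {p : (ℝ × ℝ) × (ℕ → unitInterval) | Accepts y R T m p.1 p.2} :=
  measurableSet_le ((measurable_rotatedIm hy hR hT m).abs.const_mul 10000)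
    (measurable_rotatedRe hy hR hT m)

theorem measurable_refined (hy : Measurable y) (hR : 1 ≤ R) (hT : 0 < T) (m : ℕ) :
    Measurable fun p : (ℝ × ℝ) × (ℕ → unitInterval) => refined y R T m p.1 p.2 := by
  have hu0 : Measurable fun p : (ℝ × ℝ) × (ℕ → unitInterval) => (p.2 0 : ℝ) :=
    measurable_subtype_coe.comp ((measurable_pi_apply 0).comp measurable_snd)
  have h1 := measurable_rotatedIm hy hR hT m
  have h2 := measurable_rotatedRe hy hR hT m
  unfold refined shiftLength
  fun_prop

theorem measurable_walkStep (hy : Measurable y) (hR : 1 ≤ R) (hT : 0 < T) (F wmin : ℝ) (m : ℕ) :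
    Measurable fun p : (ℝ × ℝ) × (ℕ → unitInterval) => walkStep y R T F wmin m p.1 p.2 := by
  have hw : Measurable fun p : (ℝ × ℝ) × (ℕ → unitInterval) => p.1.2 := by fun_prop
  have hc : Measurable fun p : (ℝ × ℝ) × (ℕ → unitInterval) => p.1.1 := by fun_prop
  unfold walkStep
  refine Measurable.ite (measurableSet_accepts hy hR hT m) ?_ ?_
  · refine (measurable_refined hy hR hT m).prodMk ?_
    exact Measurable.ite (measurableSet_le measurable_const (hw.div_const 2)) (hw.div_const 2) hw
  · exact Measurable.ite (measurableSet_le measurable_const hw) (measurable_const.prodMk hw)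
      (hc.prodMk (hw.const_mul 2))

theorem measurableSet_stepCorrect (hy : Measurable y) (hR : 1 ≤ R) (hT : 0 < T) (m : ℕ) (f₀ : ℝ) :
    MeasurableSet {p : (ℝ × ℝ) × (ℕ → unitInterval) | StepCorrect y R T m f₀ p.1 p.2} := by
  have hacc := measurableSet_accepts hy hR hT m
  have hw : Measurable fun p : (ℝ × ℝ) × (ℕ → unitInterval) => p.1.2 := by fun_prop
  have hc : Measurable fun p : (ℝ × ℝ) × (ℕ → unitInterval) => p.1.1 := by fun_prop
  have h1 : MeasurableSet {p : (ℝ × ℝ) × (ℕ → unitInterval) |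
      |f₀ - refined y R T m p.1 p.2| ≤ p.1.2 / 2} :=
    measurableSet_le (measurable_const.sub (measurable_refined hy hR hT m)).abs (hw.div_const 2)
  have h2 : MeasurableSet {p : (ℝ × ℝ) × (ℕ → unitInterval) | p.1.2 < |f₀ - p.1.1|} :=
    measurableSet_lt hw (measurable_const.sub hc).abs
  have : {p : (ℝ × ℝ) × (ℕ → unitInterval) | StepCorrect y R T m f₀ p.1 p.2} =
      ({p | Accepts y R T m p.1 p.2}ᶜ ∪ {p | |f₀ - refined y R T m p.1 p.2| ≤ p.1.2 / 2}) ∩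
        ({p | Accepts y R T m p.1 p.2} ∪ {p | p.1.2 < |f₀ - p.1.1|}) := by
    ext p
    simp only [StepCorrect, Set.mem_inter_iff, Set.mem_union, Set.mem_compl_iff,
      Set.mem_ofPred_eq]
    tauto
  rw [this]
  exact (hacc.compl.union h1).inter (hacc.union h2)

end Measurability

/-! ### The trajectory and its number of wrong steps -/

section Trajectory

/-- The sequence of random reals from index `n` on. -/
def tailFrom (n : ℕ) (ω : ℕ → unitInterval) : ℕ → unitInterval := fun l => ω (n + l)

/-- The states of the search after each step; each step uses `m + 1` random reals. -/
def trajectory (y : ℝ → ℂ) (R T F wmin : ℝ) (m : ℕ) (ω : ℕ → unitInterval) : ℕ → ℝ × ℝ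
  | 0 => (0, F)
  | i + 1 => walkStep y R T F wmin m (trajectory y R T F wmin m ω i)
      (tailFrom (i * (m + 1)) ω)

open Classical in
/-- The number of wrong steps. -/
def wrongCount (y : ℝ → ℂ) (R T F wmin : ℝ) (m : ℕ) (f₀ : ℝ) (N : ℕ) (ω : ℕ → unitInterval) :
    ℕ :=
  ((Finset.range N).filter fun i => ¬ StepCorrect y R T m f₀ (trajectory y R T F wmin m ω i)
    (tailFrom (i * (m + 1)) ω)).card

variable {y : ℝ → ℂ} {R T F wmin : ℝ} {m : ℕ}

theorem correlation_congr {ω ω' : ℕ → unitInterval} (h : ∀ l ≤ m, ω l = ω' l) (β : ℝ) :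
    correlation y R T β m ω = correlation y R T β m ω' := by
  unfold correlation
  refine Finset.sum_congr rfl fun i hi => ?_
  rw [h (i + 1) (by have := Finset.mem_range.1 hi; omega)]

theorem walkStep_congr {ω ω' : ℕ → unitInterval} (h : ∀ l ≤ m, ω l = ω' l) (s : ℝ × ℝ) :
    walkStep y R T F wmin m s ω = walkStep y R T F wmin m s ω' := by
  have hA : Accepts y R T m s ω ↔ Accepts y R T m s ω' := by
    simp only [Accepts, rotatedIm, rotatedRe, correlation_congr h, h 0 (Nat.zero_le _)]
  have hr : refined y R T m s ω = refined y R T m s ω' := by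
    simp only [refined, rotatedIm, rotatedRe, correlation_congr h, h 0 (Nat.zero_le _)]
  unfold walkStep
  rw [hr]
  by_cases h' : Accepts y R T m s ω'
  · rw [if_pos (hA.2 h'), if_pos h']
  · rw [if_neg (mt hA.1 h'), if_neg h']

theorem stepCorrect_congr {ω ω' : ℕ → unitInterval} (h : ∀ l ≤ m, ω l = ω' l) (f₀ : ℝ)
    (s : ℝ × ℝ) : StepCorrect y R T m f₀ s ω ↔ StepCorrect y R T m f₀ s ω' := by
  simp only [StepCorrect, Accepts, refined, rotatedIm, rotatedRe, correlation_congr h,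
    h 0 (Nat.zero_le _)]

/-- The state after i steps is determined by the first i(m+1) random reals, hence independent of
those used by the next step. -/
theorem trajectory_congr {ω ω' : ℕ → unitInterval} (i : ℕ)
    (h : ∀ l < i * (m + 1), ω l = ω' l) :
    trajectory y R T F wmin m ω i = trajectory y R T F wmin m ω' i := by
  induction i with
  | zero => rfl
  | succ i ih =>
    have h2 : (i + 1) * (m + 1) = i * (m + 1) + (m + 1) := by ring
    rw [trajectory, trajectory, ih fun l hl => h l (by omega)]
    exact walkStep_congr (fun l hl => h _ (by omega)) _

theorem wrongCount_congr {ω ω' : ℕ → unitInterval} (f₀ : ℝ) (i : ℕ)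
    (h : ∀ l < i * (m + 1), ω l = ω' l) :
    wrongCount y R T F wmin m f₀ i ω = wrongCount y R T F wmin m f₀ i ω' := by
  classical
  unfold wrongCount
  congr 1
  refine Finset.filter_congr fun j hj => ?_
  have hj' := Finset.mem_range.1 hj
  have h2 : (j + 1) * (m + 1) ≤ i * (m + 1) := Nat.mul_le_mul_right _ hj'
  have h3 : (j + 1) * (m + 1) = j * (m + 1) + (m + 1) := by ring
  rw [trajectory_congr j fun l hl => h l (by omega)]
  exact not_congr (stepCorrect_congr (fun l hl => h _ (by omega)) _ _)

theorem measurable_tailFrom (n : ℕ) : Measurable (tailFrom n) :=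
  measurable_pi_lambda _ fun l => measurable_pi_apply (n + l)

theorem measurable_trajectory (hy : Measurable y) (hR : 1 ≤ R) (hT : 0 < T) (i : ℕ) :
    Measurable fun ω => trajectory y R T F wmin m ω i := by
  induction i with
  | zero => exact measurable_const
  | succ i ih =>
    have h := (measurable_walkStep hy hR hT F wmin m).comp
      (ih.prodMk (measurable_tailFrom (i * (m + 1))))
    simp only [trajectory]
    exact h

theorem wrongCount_succ (f₀ : ℝ) (N : ℕ) (ω : ℕ → unitInterval) [Decidable (StepCorrect y R T m f₀
    (trajectory y R T F wmin m ω N) (tailFrom (N * (m + 1)) ω))] :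
    wrongCount y R T F wmin m f₀ (N + 1) ω = wrongCount y R T F wmin m f₀ N ω +
      if StepCorrect y R T m f₀ (trajectory y R T F wmin m ω N) (tailFrom (N * (m + 1)) ω)
      then 0 else 1 := by
  classical
  unfold wrongCount
  rw [Finset.range_add_one, Finset.filter_insert]
  by_cases h : StepCorrect y R T m f₀ (trajectory y R T F wmin m ω N) (tailFrom (N * (m + 1)) ω)
  · simp [h]
  · rw [if_pos h, if_neg h, Finset.card_insert_of_notMem (by simp)]

theorem measurable_wrongCount (hy : Measurable y) (hR : 1 ≤ R) (hT : 0 < T) (f₀ : ℝ) (N : ℕ) :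
    Measurable (wrongCount y R T F wmin m f₀ N) := by
  classical
  induction N with
  | zero => exact measurable_const
  | succ N ih =>
    have : wrongCount y R T F wmin m f₀ (N + 1) = fun ω => wrongCount y R T F wmin m f₀ N ω +
        if StepCorrect y R T m f₀ (trajectory y R T F wmin m ω N) (tailFrom (N * (m + 1)) ω)
        then 0 else 1 := funext fun ω => wrongCount_succ f₀ N ω
    rw [this]
    refine ih.add (Measurable.ite ?_ measurable_const measurable_const)
    exact ((measurable_trajectory hy hR hT N).prodMk (measurable_tailFrom _))
      (measurableSet_stepCorrect hy hR hT m f₀)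

theorem tailFrom_splice (q : ℕ) (ω₁ ω₂ : ℕ → unitInterval) :
    tailFrom q (splice q (ω₁, ω₂)) = ω₂ := by
  ext l
  simp [tailFrom, splice]

theorem walkStep_snd_ge {s : ℝ × ℝ} (hw : wmin ≤ s.2) (hs : 0 ≤ s.2) (ω : ℕ → unitInterval) :
    wmin ≤ (walkStep y R T F wmin m s ω).2 := by
  classical
  unfold walkStep
  split_ifs <;> simp only <;> linarith

theorem trajectory_snd_ge (h0 : 0 ≤ wmin) (hF : wmin ≤ F) (ω : ℕ → unitInterval) (i : ℕ) :
    wmin ≤ (trajectory y R T F wmin m ω i).2 := by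
  induction i with
  | zero => exact hF
  | succ i ih => exact walkStep_snd_ge ih (h0.trans ih) _

/-- The exponential moment of the number of wrong steps. -/
theorem lintegral_pow_wrongCount_le (hy : Measurable y) (hR : 1 ≤ R) (hT : 0 < T)
    (h0 : 0 ≤ wmin) (hF : wmin ≤ F) {f₀ : ℝ}
    (hp : ∀ s : ℝ × ℝ, wmin ≤ s.2 →
      coinLaw {ω | ¬ StepCorrect y R T m f₀ s ω} ≤ ENNReal.ofReal (1 / 500)) (N : ℕ) :
    ∫⁻ ω, (16 : ℝ≥0∞) ^ wrongCount y R T F wmin m f₀ N ω ∂coinLaw ≤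
      ENNReal.ofReal (1 + 3 / 100) ^ N := by
  classical
  induction N with
  | zero => simp [wrongCount]
  | succ N ih =>
    set q := N * (m + 1) with hq
    have hm : Measurable fun ω => (16 : ℝ≥0∞) ^ wrongCount y R T F wmin m f₀ (N + 1) ω :=
      (measurable_of_countable fun n : ℕ => (16 : ℝ≥0∞) ^ n).comp
        (measurable_wrongCount hy hR hT f₀ (N + 1))
    rw [lintegral_splice q hm]
    have hin : ∀ ω₁, ∫⁻ ω₂, (16 : ℝ≥0∞) ^
        wrongCount y R T F wmin m f₀ (N + 1) (splice q (ω₁, ω₂)) ∂coinLaw ≤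
        16 ^ wrongCount y R T F wmin m f₀ N ω₁ * ENNReal.ofReal (1 + 3 / 100) := by
      intro ω₁
      -- With the past frozen, s is a fixed state and the step runs on a fresh sequence, so the
      -- uniform bound `hp` applies. A wrong step multiplies the moment by 16 = 1 + 15, and 15/500 =
      -- 3/100.
      set s := trajectory y R T F wmin m ω₁ N with hs
      have hmeas : MeasurableSet {ω | ¬ StepCorrect y R T m f₀ s ω} := by
        have := (measurableSet_stepCorrect hy hR hT m f₀).compl
        exact (measurable_const.prodMk measurable_id) this
      have h1 : ∀ ω₂, (16 : ℝ≥0∞) ^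
          wrongCount y R T F wmin m f₀ (N + 1) (splice q (ω₁, ω₂)) ≤
          16 ^ wrongCount y R T F wmin m f₀ N ω₁ *
            (1 + {ω | ¬ StepCorrect y R T m f₀ s ω}.indicator (fun _ => 15) ω₂) := by
        intro ω₂
        have hagree : ∀ l < N * (m + 1), splice q (ω₁, ω₂) l = ω₁ l := fun l hl => by
          simp [splice, hq, hl]
        rw [wrongCount_succ, wrongCount_congr f₀ N hagree, trajectory_congr N hagree, ← hq,
          tailFrom_splice, ← hs, pow_add]
        gcongr
        by_cases hc : StepCorrect y R T m f₀ s ω₂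
        · simp [hc]
        · simp [hc]; norm_num
      calc _ ≤ ∫⁻ ω₂, 16 ^ wrongCount y R T F wmin m f₀ N ω₁ *
            (1 + {ω | ¬ StepCorrect y R T m f₀ s ω}.indicator (fun _ => 15) ω₂) ∂coinLaw :=
            lintegral_mono h1
        _ = 16 ^ wrongCount y R T F wmin m f₀ N ω₁ *
            (1 + 15 * coinLaw {ω | ¬ StepCorrect y R T m f₀ s ω}) := by
            rw [lintegral_const_mul' _ _ (by finiteness), lintegral_add_left measurable_const,
              lintegral_indicator_const hmeas]
            simp
        _ ≤ _ := by
            gcongr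
            rw [ENNReal.ofReal_add (by norm_num) (by norm_num), ENNReal.ofReal_one]
            gcongr
            calc 15 * coinLaw {ω | ¬ StepCorrect y R T m f₀ s ω} ≤
                15 * ENNReal.ofReal (1 / 500) := by
                  gcongr
                  exact hp s (trajectory_snd_ge h0 hF ω₁ N)
              _ = _ := by
                rw [show (15 : ℝ≥0∞) = ENNReal.ofReal 15 by simp,
                  ← ENNReal.ofReal_mul (by norm_num)]
                norm_num
    calc _ ≤ ∫⁻ ω₁, 16 ^ wrongCount y R T F wmin m f₀ N ω₁ *
          ENNReal.ofReal (1 + 3 / 100) ∂coinLaw := lintegral_mono hin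
      _ = (∫⁻ ω₁, 16 ^ wrongCount y R T F wmin m f₀ N ω₁ ∂coinLaw) *
          ENNReal.ofReal (1 + 3 / 100) := lintegral_mul_const' _ _ (by finiteness)
      _ ≤ _ := by
          rw [pow_succ]
          gcongr

/-- Many wrong steps are unlikely. -/
theorem measure_wrongCount_le (hy : Measurable y) (hR : 1 ≤ R) (hT : 0 < T)
    (h0 : 0 ≤ wmin) (hF : wmin ≤ F) {f₀ : ℝ}
    (hp : ∀ s : ℝ × ℝ, wmin ≤ s.2 →
      coinLaw {ω | ¬ StepCorrect y R T m f₀ s ω} ≤ ENNReal.ofReal (1 / 500)) (N : ℕ) :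
    coinLaw {ω | N < 40 * wrongCount y R T F wmin m f₀ N ω} ≤
      ENNReal.ofReal (Real.exp (-(N / 30))) := by
  have hm : Measurable fun ω => (16 : ℝ≥0∞) ^ wrongCount y R T F wmin m f₀ N ω :=
    (measurable_of_countable fun n : ℕ => (16 : ℝ≥0∞) ^ n).comp
      (measurable_wrongCount hy hR hT f₀ N)
  set θ := Real.exp (N * (Real.log 16 / 40)) with hθ
  have hθ0 : 0 < θ := Real.exp_pos _
  have hmk := mul_meas_ge_le_lintegral (μ := coinLaw) hm (ENNReal.ofReal θ)
  -- The final exponent per step is at most 0.03 − 0.0693 < −1/30.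
  have hlog : (0.0693 : ℝ) ≤ Real.log 16 / 40 := by
    rw [show (16 : ℝ) = 2 ^ 4 by norm_num, Real.log_pow]
    have := Real.log_two_gt_d9
    push_cast
    linarith
  calc coinLaw {ω | N < 40 * wrongCount y R T F wmin m f₀ N ω}
      ≤ coinLaw {ω | ENNReal.ofReal θ ≤ 16 ^ wrongCount y R T F wmin m f₀ N ω} := by
        refine measure_mono fun ω hω => ?_
        simp only [Set.mem_ofPred_eq] at hω ⊢
        set n := wrongCount y R T F wmin m f₀ N ω
        have h1 : θ ≤ 16 ^ n := by
          rw [hθ, ← Real.exp_log (show (0 : ℝ) < 16 ^ n by positivity), Real.log_pow]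
          refine Real.exp_le_exp.2 ?_
          have h2 : (N : ℝ) ≤ 40 * n := by exact_mod_cast hω.le
          have h3 : 0 ≤ Real.log 16 := Real.log_nonneg (by norm_num)
          nlinarith
        calc ENNReal.ofReal θ ≤ ENNReal.ofReal (16 ^ n) := ENNReal.ofReal_le_ofReal h1
          _ = 16 ^ n := by rw [ENNReal.ofReal_pow (by norm_num)]; simp
    _ ≤ ENNReal.ofReal (1 + 3 / 100) ^ N / ENNReal.ofReal θ := by
        rw [ENNReal.le_div_iff_mul_le (Or.inl (by simpa using hθ0)) (Or.inl ENNReal.ofReal_ne_top),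
          mul_comm]
        exact hmk.trans (lintegral_pow_wrongCount_le hy hR hT h0 hF hp N)
    _ = ENNReal.ofReal ((1 + 3 / 100) ^ N / θ) := by
        rw [← ENNReal.ofReal_pow (by norm_num), ENNReal.ofReal_div_of_pos hθ0]
    _ ≤ _ := by
        refine ENNReal.ofReal_le_ofReal ?_
        calc (1 + 3 / 100 : ℝ) ^ N / θ ≤ Real.exp (3 / 100) ^ N / θ := by
              gcongr
              linarith [Real.add_one_le_exp (3 / 100 : ℝ)]
          _ = Real.exp (N * (3 / 100) - N * (Real.log 16 / 40)) := by
              rw [← Real.exp_nat_mul, hθ, Real.exp_sub]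
          _ ≤ _ := by
              refine Real.exp_le_exp.2 ?_
              have : (0 : ℝ) ≤ N := by positivity
              nlinarith

end Trajectory

/-! ### The potential of the search -/

section Potential

variable {y : ℝ → ℂ} {R T F wmin f₀ : ℝ} {m : ℕ}

/-- A lower bound for the progress of the search: the depth of the resolution, minus twice the
number of doublings after which the candidate is good. -/
def Progress (F wmin f₀ : ℝ) (φ : ℤ) (s : ℝ × ℝ) : Prop :=
  ∃ j n : ℕ, s.2 = F / 2 ^ j ∧ wmin ≤ s.2 ∧ |f₀ - s.1| ≤ 2 ^ n * s.2 ∧ φ ≤ j - 2 * n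

theorem le_depth_of_lt {L j : ℕ} (hF : 0 < F) (hL : wmin ≤ F / 2 ^ L)
    (h : F / 2 ^ j / 2 < wmin) : L ≤ j := by
  by_contra hlt
  push Not at hlt
  have h1 : F / 2 ^ L ≤ F / 2 ^ (j + 1) := by gcongr <;> norm_num; omega
  rw [pow_succ, ← div_div] at h1
  linarith

/-- A correct acceptance sets n = 0 and gains a level, unless the finest resolution is reached,
where the depth is at least L. A correct rejection occurs only for n ≥ 1: it gives up one level and
one doubling, and (j−1) − 2(n−1) = (j − 2n) + 1. At the coarsest level the reset to 0 is good
because |f₀| ≤ F. -/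
theorem Progress.step_of_correct {φ : ℤ} {L : ℕ} {s : ℝ × ℝ} {ω : ℕ → unitInterval}
    (hF : 0 < F) (hf₀ : |f₀| ≤ F) (hL : wmin ≤ F / 2 ^ L)
    (h : Progress F wmin f₀ φ s) (hc : StepCorrect y R T m f₀ s ω) :
    Progress F wmin f₀ (min (φ + 1) L) (walkStep y R T F wmin m s ω) := by
  classical
  obtain ⟨j, n, hj, hw, hn, hφ⟩ := h
  have hs : 0 < s.2 := by rw [hj]; positivity
  unfold walkStep
  split_ifs with h1 h2 h3
  · refine ⟨j + 1, 0, ?_, h2, ?_, ?_⟩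
    · simp only [hj, pow_succ]; field_simp
    · simpa using hc.1 h1
    · push_cast; omega
  · push Not at h2
    have hLj := le_depth_of_lt hF hL (hj ▸ h2)
    refine ⟨j, 0, hj, hw, ?_, ?_⟩
    · have := hc.1 h1
      simp only [pow_zero, one_mul]
      linarith
    · have : (L : ℤ) ≤ j := by exact_mod_cast hLj
      push_cast
      omega
  · have hn1 : n ≠ 0 := by
      rintro rfl
      have := hc.2 h1
      simp at hn
      linarith
    have hj0 : j = 0 := by
      by_contra hj0
      have : F / 2 ^ j < F := div_lt_self hF (one_lt_pow₀ (by norm_num) hj0)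
      linarith
    subst hj0
    refine ⟨0, 0, hj, hw, ?_, ?_⟩
    · simp only [sub_zero, pow_zero, one_mul, hj, div_one]
      exact hf₀
    · push_cast at hφ ⊢
      omega
  · have hn1 : n ≠ 0 := by
      rintro rfl
      have := hc.2 h1
      simp at hn
      linarith
    have hj0 : j ≠ 0 := by
      rintro rfl
      simp at hj
      exact h3 hj.ge
    obtain ⟨j, rfl⟩ := Nat.exists_eq_succ_of_ne_zero hj0
    obtain ⟨n, rfl⟩ := Nat.exists_eq_succ_of_ne_zero hn1
    refine ⟨j, n, ?_, ?_, ?_, ?_⟩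
    · simp only [hj, Nat.succ_eq_add_one, pow_succ]; field_simp
    · simp only; linarith
    · simp only [Nat.succ_eq_add_one, pow_succ] at hn ⊢
      linarith
    · push_cast at hφ ⊢
      omega

/-- The worst case is a wrong acceptance with halving. The candidate moves by at most 4w, and (2ⁿ +
4)w ≤ 2ⁿ⁺⁴ · w/2, so the depth gains 1 and n grows by 4, a change of 1 − 8 = −7. -/
theorem Progress.step {φ : ℤ} {s : ℝ × ℝ} (ω : ℕ → unitInterval) (hF : 0 < F)
    (hf₀ : |f₀| ≤ F) (h : Progress F wmin f₀ φ s) :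
    Progress F wmin f₀ (φ - 7) (walkStep y R T F wmin m s ω) := by
  classical
  obtain ⟨j, n, hj, hw, hn, hφ⟩ := h
  have hs : 0 < s.2 := by rw [hj]; positivity
  have h2n : (1 : ℝ) ≤ 2 ^ n := one_le_pow₀ (by norm_num)
  have hmove : Accepts y R T m s ω → |f₀ - refined y R T m s ω| ≤ 2 ^ n * s.2 + 4 * s.2 := by
    intro hacc
    have h1 := abs_refined_sub_le hs hacc
    calc |f₀ - refined y R T m s ω| = |(f₀ - s.1) - (refined y R T m s ω - s.1)| := by ring_nf
      _ ≤ |f₀ - s.1| + |refined y R T m s ω - s.1| := abs_sub _ _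
      _ ≤ _ := add_le_add hn h1
  unfold walkStep
  split_ifs with h1 h2 h3
  · refine ⟨j + 1, n + 4, ?_, h2, ?_, ?_⟩
    · simp only [hj, pow_succ]; field_simp
    · have := hmove h1
      simp only [pow_add]
      nlinarith
    · push_cast; omega
  · refine ⟨j, n + 3, hj, hw, ?_, ?_⟩
    · have := hmove h1
      simp only [pow_add]
      nlinarith
    · push_cast; omega
  · have hj0 : j = 0 := by
      by_contra hj0
      have : F / 2 ^ j < F := div_lt_self hF (one_lt_pow₀ (by norm_num) hj0)
      linarith
    subst hj0
    refine ⟨0, 0, hj, hw, ?_, ?_⟩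
    · simp only [sub_zero, pow_zero, one_mul, hj, div_one]
      exact hf₀
    · push_cast at hφ ⊢
      omega
  · have hj0 : j ≠ 0 := by
      rintro rfl
      simp at hj
      exact h3 hj.ge
    obtain ⟨j, rfl⟩ := Nat.exists_eq_succ_of_ne_zero hj0
    refine ⟨j, n, ?_, ?_, ?_, ?_⟩
    · simp only [hj, Nat.succ_eq_add_one, pow_succ]; field_simp
    · simp only; linarith
    · simp only
      nlinarith
    · push_cast at hφ ⊢
      omega

/-- The depth cannot exceed L, so progress L forces depth L and n = 0. The resolution there is below
2 `wmin`. -/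
theorem Progress.good {L : ℕ} {s : ℝ × ℝ} (hF : 0 < F) (hL : F / 2 ^ (L + 1) < wmin)
    (h : Progress F wmin f₀ L s) : |f₀ - s.1| ≤ 2 * wmin := by
  obtain ⟨j, n, hj, hw, hn, hφ⟩ := h
  have hjL : j ≤ L := by
    by_contra hlt
    push Not at hlt
    have h1 : F / 2 ^ j ≤ F / 2 ^ (L + 1) := by gcongr <;> norm_num; omega
    linarith
  have hn0 : n = 0 := by omega
  have hjL' : j = L := by omega
  subst hn0 hjL'
  rw [pow_succ, ← div_div, ← hj] at hL
  simp only [pow_zero, one_mul] at hn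
  linarith

open Classical in
/-- The guaranteed progress after each step. -/
def potential (y : ℝ → ℂ) (R T F wmin : ℝ) (m : ℕ) (f₀ : ℝ) (L : ℕ) (ω : ℕ → unitInterval) :
    ℕ → ℤ
  | 0 => 0
  | i + 1 => if StepCorrect y R T m f₀ (trajectory y R T F wmin m ω i) (tailFrom (i * (m + 1)) ω)
      then min (potential y R T F wmin m f₀ L ω i + 1) L
      else potential y R T F wmin m f₀ L ω i - 7

theorem potential_le (L : ℕ) (ω : ℕ → unitInterval) (i : ℕ) :
    potential y R T F wmin m f₀ L ω i ≤ L := by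
  induction i with
  | zero => simp [potential]
  | succ i ih =>
    rw [potential]
    split_ifs <;> omega

theorem progress_trajectory {L : ℕ} (hF : 0 < F) (hf₀ : |f₀| ≤ F) (hL : wmin ≤ F / 2 ^ L)
    (ω : ℕ → unitInterval) (i : ℕ) :
    Progress F wmin f₀ (potential y R T F wmin m f₀ L ω i)
      (trajectory y R T F wmin m ω i) := by
  induction i with
  | zero =>
    have h1 : F / 2 ^ L ≤ F := div_le_self hF.le (one_le_pow₀ (by norm_num))
    exact ⟨0, 0, by simp [trajectory], hL.trans h1, by simpa [trajectory] using hf₀,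
      by simp [potential]⟩
  | succ i ih =>
    rw [potential, trajectory]
    split_ifs with hc
    · exact ih.step_of_correct hF hf₀ hL hc
    · exact ih.step _ hF hf₀

/-- Amortization: a correct step below L raises the potential by 1, and a wrong step adds 8 − 7 to
the right side. So the right side grows by at least 1 at every low step and never falls. -/
theorem card_low_potential_le (L : ℕ) (ω : ℕ → unitInterval) (N : ℕ) :
    (((Finset.range N).filter fun i => potential y R T F wmin m f₀ L ω i < L).card : ℤ) ≤
      potential y R T F wmin m f₀ L ω N + 8 * wrongCount y R T F wmin m f₀ N ω := by
  classical
  induction N with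
  | zero => simp [potential, wrongCount]
  | succ N ih =>
    have hle := potential_le (y := y) (R := R) (T := T) (F := F) (wmin := wmin) (m := m)
      (f₀ := f₀) L ω N
    rw [wrongCount_succ, Finset.range_add_one, Finset.filter_insert, potential]
    split_ifs with h1 h2 h2
    · rw [Finset.card_insert_of_notMem (by simp)]
      push_cast
      omega
    · rw [Finset.card_insert_of_notMem (by simp)]
      push_cast
      omega
    · push_cast
      omega
    · push_cast
      omega

/-- If few steps are wrong, then most candidates are good. -/
theorem card_good_candidates {L N : ℕ} {ω : ℕ → unitInterval} (hF : 0 < F) (hf₀ : |f₀| ≤ F)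
    (hL : wmin ≤ F / 2 ^ L) (hL' : F / 2 ^ (L + 1) < wmin)
    (hw : 40 * wrongCount y R T F wmin m f₀ N ω ≤ N) (hLN : 10 * L < 3 * N) :
    N < 2 * ((Finset.range N).filter fun i =>
      |f₀ - (trajectory y R T F wmin m ω i).1| ≤ 2 * wmin).card := by
  have h1 := card_low_potential_le (y := y) (R := R) (T := T) (F := F) (wmin := wmin) (m := m)
    (f₀ := f₀) L ω N
  have h2 := potential_le (y := y) (R := R) (T := T) (F := F) (wmin := wmin) (m := m)
    (f₀ := f₀) L ω N
  have h3 : ((Finset.range N).filter fun i => ¬ potential y R T F wmin m f₀ L ω i < L).card ≤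
      ((Finset.range N).filter fun i =>
        |f₀ - (trajectory y R T F wmin m ω i).1| ≤ 2 * wmin).card := by
    refine Finset.card_le_card fun i hi => ?_
    rw [Finset.mem_filter] at hi ⊢
    refine ⟨hi.1, Progress.good hF hL' ?_⟩
    have h4 := progress_trajectory (y := y) (R := R) (T := T) (m := m) hF hf₀ hL ω i
    have h5 := potential_le (y := y) (R := R) (T := T) (F := F) (wmin := wmin) (m := m)
      (f₀ := f₀) L ω i
    rwa [le_antisymm h5 (not_lt.1 hi.2)] at h4
  -- At most L + 8N/40 < 3N/10 + N/5 = N/2 steps have low potential.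
  have h6 := Finset.card_filter_add_card_filter_not (s := Finset.range N)
    (fun i => potential y R T F wmin m f₀ L ω i < L)
  rw [Finset.card_range] at h6
  omega

theorem exists_depth (h0 : 0 < wmin) (hwF : wmin ≤ F) :
    ∃ L : ℕ, wmin ≤ F / 2 ^ L ∧ F / 2 ^ (L + 1) < wmin ∧ L * Real.log 2 ≤ Real.log (F / wmin) := by
  obtain ⟨L, h1, h2⟩ := exists_nat_pow_near (x := F / wmin) (y := 2) ((one_le_div h0).2 hwF)
    one_lt_two
  have h3 : wmin ≤ F / 2 ^ L := by
    rw [le_div_iff₀ (by positivity)]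
    rwa [le_div_iff₀ h0, mul_comm] at h1
  refine ⟨L, h3, ?_, ?_⟩
  · rw [div_lt_iff₀ (by positivity)]
    rwa [div_lt_iff₀ h0, mul_comm] at h2
  · rw [← Real.log_pow]
    exact Real.log_le_log (by positivity) h1

end Potential

/-! ### Selection by majority -/

section Selection

variable {c : ℕ → ℝ} {N : ℕ} {f₀ r : ℝ}

/-- The number of candidates close to the given one. -/
def closeCount (c : ℕ → ℝ) (r : ℝ) (N t : ℕ) : ℕ :=
  ((Finset.range N).filter fun s => (c s - c t) * (c s - c t) ≤ r * r).card

/-- Two majorities of the same N candidates share an element, which is close both to f₀ and to the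
selected candidate. -/
theorem close_of_closeCount
    (hgood : N < 2 * ((Finset.range N).filter fun i => |f₀ - c i| ≤ r / 2).card) (hr : 0 ≤ r)
    {t : ℕ} (h : N < 2 * closeCount c r N t) : |f₀ - c t| ≤ 2 * r := by
  classical
  obtain ⟨s, hs⟩ : (((Finset.range N).filter fun i => |f₀ - c i| ≤ r / 2) ∩
      ((Finset.range N).filter fun s => (c s - c t) * (c s - c t) ≤ r * r)).Nonempty := by
    refine Finset.inter_nonempty_of_card_lt_card_add_card (Finset.filter_subset _ _)
      (Finset.filter_subset _ _) ?_
    rw [Finset.card_range]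
    unfold closeCount at h
    omega
  simp only [Finset.mem_inter, Finset.mem_filter] at hs
  have h1 := hs.1.2
  have h2 : |c s - c t| ≤ r := abs_le_of_sq_le_sq (by nlinarith [hs.2.2]) hr
  calc |f₀ - c t| = |(f₀ - c s) + (c s - c t)| := by ring_nf
    _ ≤ _ := abs_add_le _ _
    _ ≤ _ := by linarith

/-- Any good candidate qualifies, since two good ones are within r of each other. -/
theorem exists_closeCount
    (hgood : N < 2 * ((Finset.range N).filter fun i => |f₀ - c i| ≤ r / 2).card) :
    ∃ t < N, N < 2 * closeCount c r N t := by
  have hne : ((Finset.range N).filter fun i => |f₀ - c i| ≤ r / 2).Nonempty :=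
    Finset.card_pos.1 (by omega)
  obtain ⟨t, ht⟩ := hne
  rw [Finset.mem_filter, Finset.mem_range] at ht
  refine ⟨t, ht.1, lt_of_lt_of_le hgood (Nat.mul_le_mul_left 2 ?_)⟩
  refine Finset.card_le_card fun s hs => ?_
  rw [Finset.mem_filter] at hs ⊢
  refine ⟨hs.1, ?_⟩
  have h1 := abs_le.1 hs.2
  have h2 := abs_le.1 ht.2
  nlinarith

end Selection

end ClusteredSignal

end

noncomputable section

namespace ClusteredSignal

open MeasureTheory Set Finset ProbabilityTheory

/-! ### The program -/

section Programs

/-- The memory cell with a fixed address. -/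
def RealExp.at (n : ℕ) : RealExp := .cell (.lit n)

/-- A natural number as a real expression. -/
def RealExp.num (n : ℕ) : RealExp := .ofNat (.lit n)

theorem RealExp.eval_at (s : State) (n : ℕ) : (RealExp.at n).eval s = s.cell n := rfl

theorem RealExp.eval_num (s : State) (n : ℕ) : (RealExp.num n).eval s = n := rfl

/-- The half-length `T + T / R` of the interval that carries the sampling density. -/
def halfLengthExp : RealExp := .add (.at 1) (.div (.at 1) (.at 4))

/-- The normalization `log (2 R + 1)` of the sampling density. -/
def logExp : RealExp := .log (.add (.mul (.num 2) (.at 4)) (.num 1))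

/-- Draw a sample point and add its term to the correlation in the cells `18` and `19`, for the
shift in cell `10`. -/
def correlationBody : Program :=
  -- Cell 11 holds the uniform real, 12 the sample point, 13 its weight; cells 14–17 hold the two
  -- samples. The cells 18 and 19 accumulate the real and the imaginary part.
  .seq (.rand (.lit 11)) <|
  .seq (.setCell (.lit 12) (.mul halfLengthExp (.sub (.num 1) (.div (.num 2)
    (.add (.exp (.mul (.sub (.mul (.num 2) (.at 11)) (.num 1)) logExp)) (.num 1)))))) <|
  .seq (.setCell (.lit 13) (.div (.mul logExp (.sub (.mul halfLengthExp halfLengthExp)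
    (.mul (.at 12) (.at 12)))) halfLengthExp)) <|
  .seq (.sample (.lit 14) (.at 12)) <|
  .seq (.sample (.lit 16) (.add (.at 12) (.at 10))) <|
  .seq (.setCell (.lit 18) (.add (.at 18) (.mul (.at 13)
    (.add (.mul (.at 14) (.at 16)) (.mul (.at 15) (.at 17)))))) <|
  .seq (.setCell (.lit 19) (.add (.at 19) (.mul (.at 13)
    (.sub (.mul (.at 14) (.at 17)) (.mul (.at 15) (.at 16)))))) <|
  .setReg 2 (.add (.reg 2) (.lit 1))

/-- The empirical correlation, with the number of samples bounded by cell `7`. -/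
def correlationLoop : Program :=
  .loop (.realLe (.ofNat (.reg 2)) (.at 7)) correlationBody

/-- Record the candidate, draw a shift and prepare the correlation. -/
def searchPrologue : Program :=
  -- Candidate number i is kept in cell 100 + i, clear of the working cells below 23.
  .seq (.setCell (.add (.lit 100) (.reg 1)) (.at 8)) <|
  .seq (.rand (.lit 10)) <|
  .seq (.setCell (.lit 10) (.div (.add (.num 1) (.at 10))
    (.mul (.mul (.num 80000) .pi) (.at 9)))) <|
  .seq (.setCell (.lit 18) (.num 0)) <|
  .seq (.setCell (.lit 19) (.num 0)) <|
  .setReg 2 (.lit 0)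

/-- Rotate the correlation by the phase of the candidate. -/
def searchRotate : Program :=
  .seq (.setCell (.lit 22) (.mul (.mul (.mul (.num 2) .pi) (.at 8)) (.at 10))) <|
  .seq (.setCell (.lit 20) (.add (.mul (.at 18) (.cos (.at 22))) (.mul (.at 19) (.sin (.at 22))))) <|
  .setCell (.lit 21) (.sub (.mul (.at 19) (.cos (.at 22))) (.mul (.at 18) (.sin (.at 22))))

/-- Update the candidate in cell `8` and the resolution in cell `9`. -/
def searchUpdate : Program :=
  -- The square root of a square serves as the absolute value.
  .seq (.ite (.realLe (.mul (.num 10000) (.sqrt (.mul (.at 21) (.at 21)))) (.at 20))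
    (.seq (.setCell (.lit 8) (.add (.at 8) (.div (.div (.at 21) (.at 20))
        (.mul (.mul (.num 2) .pi) (.at 10)))))
      (.ite (.realLe (.at 5) (.div (.at 9) (.num 2)))
        (.setCell (.lit 9) (.div (.at 9) (.num 2))) .skip))
    (.ite (.realLe (.at 0) (.at 9)) (.setCell (.lit 8) (.num 0))
      (.setCell (.lit 9) (.mul (.num 2) (.at 9))))) <|
  .setReg 1 (.add (.reg 1) (.lit 1))

/-- One step of the search. -/
def searchBody : Program :=
  .seq searchPrologue <| .seq correlationLoop <| .seq searchRotate searchUpdate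

/-- The search, with the number of steps bounded by cell `6`. -/
def searchLoop : Program :=
  .loop (.realLe (.ofNat (.reg 1)) (.at 6)) searchBody

/-- The squared distance of the candidates with the indices in the registers `4` and `3`. -/
def distanceExp : RealExp :=
  .sub (.cell (.add (.lit 100) (.reg 4))) (.cell (.add (.lit 100) (.reg 3)))

/-- Count one candidate close to the selected one. -/
def countBody : Program :=
  -- The radius is four times the finest resolution in cell 5, since two good candidates are each
  -- within twice that resolution of f₀.
  .seq (.ite (.realLe (.mul distanceExp distanceExp)
      (.mul (.mul (.num 4) (.at 5)) (.mul (.num 4) (.at 5))))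
    (.setReg 5 (.add (.reg 5) (.lit 1))) .skip) <|
  .setReg 4 (.add (.reg 4) (.lit 1))

/-- Count the candidates close to the one with the index in register `3`. -/
def countLoop : Program :=
  .loop (.natLe (.add (.reg 4) (.lit 1)) (.reg 1)) countBody

/-- Output a candidate if it is close to the majority. -/
def selectBody : Program :=
  .seq (.setReg 4 (.lit 0)) <|
  .seq (.setReg 5 (.lit 0)) <|
  .seq countLoop <|
  .seq (.ite (.natLe (.add (.reg 1) (.lit 1)) (.add (.reg 5) (.reg 5)))
    (.setCell (.lit 0) (.cell (.add (.lit 100) (.reg 3)))) .skip) <|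
  .setReg 3 (.add (.reg 3) (.lit 1))

/-- Output a candidate that is close to the majority of all candidates. -/
def selectLoop : Program :=
  .loop (.natLe (.add (.reg 3) (.lit 1)) (.reg 1)) selectBody

/-- The accuracy `Δ + R / T`. -/
def accuracyExp : RealExp := .add (.at 2) (.div (.at 4) (.at 1))

/-- Prepare the search. -/
def searchInit : Program :=
  -- The machine cannot round, so the loop bounds stay real: testing j ≤ x for j = 0, 1, … runs the
  -- loop ⌊x⌋ + 1 times when x ≥ 0.
  .seq (.setCell (.lit 6) (.mul (.num 40) (.log (.div (.at 0) (.mul accuracyExp (.at 3)))))) <|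
  .seq (.setCell (.lit 7) (.mul (.num 24000) (.mul (.ofNat (.reg 0)) logExp))) <|
  .seq (.setCell (.lit 8) (.num 0)) <|
  .seq (.setCell (.lit 9) (.at 0)) <|
  .setReg 1 (.lit 0)

/-- Estimate the central frequency of a cluster. -/
def locate : Program :=
  .seq (.setCell (.lit 5) (.mul (.num (10 ^ 18)) accuracyExp)) <|
  -- If F is below the finest resolution, the answer 0 is already accurate enough.
  .ite (.realLe (.at 5) (.at 0))
    (.seq searchInit <| .seq searchLoop <| .seq (.setReg 3 (.lit 0)) selectLoop)
    (.setCell (.lit 0) (.num 0))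

end Programs

/-! ### Runs of the program -/

section Semantics

variable {y : ℝ → ℂ} {ω : ℕ → unitInterval}

/-- The rule for a loop with a known number of iterations. -/
theorem Exec.loop_of_invariant {b : Test} {p : Program} (I : ℕ → State → Prop) {n : ℕ}
    (hstep : ∀ i < n, ∀ s, I i s → b.holds s ∧ ∃ s', Exec y ω p s.tick s' ∧ I (i + 1) s')
    (hend : ∀ s, I n s → ¬ b.holds s) {s : State} (h0 : I 0 s) :
    ∃ s', Exec y ω (.loop b p) s s'.tick ∧ I n s' := by
  have key : ∀ d i : ℕ, i + d = n → ∀ s, I i s →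
      ∃ s', Exec y ω (.loop b p) s s'.tick ∧ I n s' := by
    intro d
    induction d with
    | zero =>
      rintro i rfl s hs
      exact ⟨s, .loopFalse (hend s hs), hs⟩
    | succ d ih =>
      intro i hi s hs
      obtain ⟨hb, s', he, hs'⟩ := hstep i (by omega) s hs
      obtain ⟨s'', he', hs''⟩ := ih (i + 1) (by omega) s' hs'
      exact ⟨s'', .loopTrue hb he he', hs''⟩
  exact key n 0 (by omega) s h0

theorem re_correlationTerm (y : ℝ → ℂ) (R T β u : ℝ) :
    (correlationTerm y R T β u).re = sampleWeight R T u *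
      ((y (samplePoint R T u)).re * (y (samplePoint R T u + β)).re +
        (y (samplePoint R T u)).im * (y (samplePoint R T u + β)).im) := by
  simp [correlationTerm]

theorem im_correlationTerm (y : ℝ → ℂ) (R T β u : ℝ) :
    (correlationTerm y R T β u).im = sampleWeight R T u *
      ((y (samplePoint R T u)).re * (y (samplePoint R T u + β)).im -
        (y (samplePoint R T u)).im * (y (samplePoint R T u + β)).re) := by
  simp [correlationTerm, sub_eq_add_neg]

/-- The final state is read off the execution derivation. The last clause is a frame condition, by
which the callers carry parameters and stored candidates through the run. -/
theorem exec_correlationBody (s : State) : ∃ s', Exec y ω correlationBody s s' ∧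
    s'.reg = Function.update s.reg 2 (s.reg 2 + 1) ∧ s'.drawn = s.drawn + 1 ∧
    s'.samples = s.samples + 2 ∧ s'.steps = s.steps + 8 ∧
    s'.cell 18 = s.cell 18 +
      (correlationTerm y (s.cell 4) (s.cell 1) (s.cell 10) (ω s.drawn)).re ∧
    s'.cell 19 = s.cell 19 +
      (correlationTerm y (s.cell 4) (s.cell 1) (s.cell 10) (ω s.drawn)).im ∧
    ∀ a, a < 11 ∨ 19 < a → s'.cell a = s.cell a := by
  refine ⟨_, .seq (.rand _ _) <| .seq (.setCell _ _ _) <| .seq (.setCell _ _ _) <|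
    .seq (.sample _ _ _) <| .seq (.sample _ _ _) <| .seq (.setCell _ _ _) <|
    .seq (.setCell _ _ _) <| .setReg _ _ _, ?_⟩
  simp only [State.tick, NatExp.eval, RealExp.eval, RealExp.eval_at, RealExp.eval_num,
    halfLengthExp, logExp, Function.update_self, Function.update_of_ne, ne_eq, 
    Nat.reduceEqDiff, not_false_eq_true, Nat.reduceAdd, Nat.cast_ofNat, Nat.cast_one]
  refine ⟨trivial, trivial, trivial, trivial, ?_, ?_, ?_⟩
  · simp only [re_correlationTerm, samplePoint, sampleWeight, pow_two]
  · simp only [im_correlationTerm, samplePoint, sampleWeight, pow_two]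
  · intro a ha
    simp only [Function.update_apply]
    grind

/-- Hypothesis `hm` says that m is the number of passes allowed by the real bound in cell 7. Each
pass costs eight steps and a test, and the failing test adds one. -/
theorem exec_correlationLoop {m : ℕ} {s : State} (hm : ∀ j : ℕ, (j : ℝ) ≤ s.cell 7 ↔ j < m)
    (hr : s.reg 2 = 0) (h18 : s.cell 18 = 0) (h19 : s.cell 19 = 0) :
    ∃ s', Exec y ω correlationLoop s s' ∧
      (∀ a, a ≠ 2 → s'.reg a = s.reg a) ∧ s'.drawn = s.drawn + m ∧
      s'.samples = s.samples + 2 * m ∧ s'.steps = s.steps + 9 * m + 1 ∧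
      s'.cell 18 = (∑ i ∈ Finset.range m,
        correlationTerm y (s.cell 4) (s.cell 1) (s.cell 10) (ω (s.drawn + i))).re ∧
      s'.cell 19 = (∑ i ∈ Finset.range m,
        correlationTerm y (s.cell 4) (s.cell 1) (s.cell 10) (ω (s.drawn + i))).im ∧
      ∀ a, a < 11 ∨ 19 < a → s'.cell a = s.cell a := by
  obtain ⟨s', he, h⟩ := Exec.loop_of_invariant (y := y) (ω := ω)
    (b := .realLe (.ofNat (.reg 2)) (.at 7)) (p := correlationBody) (n := m) (s := s)
    (fun j t => t.reg 2 = j ∧ (∀ a, a ≠ 2 → t.reg a = s.reg a) ∧ t.drawn = s.drawn + j ∧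
      t.samples = s.samples + 2 * j ∧ t.steps = s.steps + 9 * j ∧
      t.cell 18 = (∑ i ∈ Finset.range j,
        correlationTerm y (s.cell 4) (s.cell 1) (s.cell 10) (ω (s.drawn + i))).re ∧
      t.cell 19 = (∑ i ∈ Finset.range j,
        correlationTerm y (s.cell 4) (s.cell 1) (s.cell 10) (ω (s.drawn + i))).im ∧
      ∀ a, a < 11 ∨ 19 < a → t.cell a = s.cell a)
    (by
      rintro j hj t ⟨h2, hreg, hd, hsa, hst, hre, him, hfr⟩
      refine ⟨?_, ?_⟩
      · change ((t.reg 2 : ℕ) : ℝ) ≤ t.cell 7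
        rw [h2, hfr 7 (by norm_num)]
        exact (hm j).2 hj
      obtain ⟨t', he, hreg', hd', hsa', hst', hre', him', hfr'⟩ :=
        exec_correlationBody (y := y) (ω := ω) t.tick
      simp only [State.tick] at hreg' hd' hsa' hst' hre' him' hfr'
      refine ⟨t', he, ?_, ?_, ?_, ?_, ?_, ?_, ?_, ?_⟩
      · rw [hreg', Function.update_self, h2]
      · intro a ha
        rw [hreg', Function.update_of_ne ha, hreg a ha]
      · omega
      · omega
      · omega
      · rw [hre', hre, hd, hfr 4 (by norm_num), hfr 1 (by norm_num), hfr 10 (by norm_num),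
          Finset.sum_range_succ, Complex.add_re]
      · rw [him', him, hd, hfr 4 (by norm_num), hfr 1 (by norm_num), hfr 10 (by norm_num),
          Finset.sum_range_succ, Complex.add_im]
      · intro a ha
        rw [hfr' a ha, hfr a ha])
    (by
      rintro t ⟨h2, -, -, -, -, -, -, hfr⟩
      change ¬ ((t.reg 2 : ℕ) : ℝ) ≤ t.cell 7
      rw [h2, hfr 7 (by norm_num), hm]
      exact lt_irrefl m)
    ⟨hr, fun _ _ => rfl, rfl, rfl, rfl, by simpa using h18, by simpa using h19, fun _ _ => rfl⟩
  obtain ⟨-, hreg, hd, hsa, hst, hre, him, hfr⟩ := h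
  exact ⟨s'.tick, he, hreg, hd, hsa, by simp [State.tick, hst], hre, him, hfr⟩

theorem exec_searchPrologue (s : State) : ∃ s', Exec y ω searchPrologue s s' ∧
    s'.reg = Function.update s.reg 2 0 ∧ s'.drawn = s.drawn + 1 ∧
    s'.samples = s.samples ∧ s'.steps = s.steps + 6 ∧
    s'.cell 10 = shiftLength (s.cell 9) (ω s.drawn) ∧ s'.cell 18 = 0 ∧ s'.cell 19 = 0 ∧
    s'.cell (100 + s.reg 1) = s.cell 8 ∧
    ∀ a, a < 10 ∨ 100 ≤ a ∧ a ≠ 100 + s.reg 1 → s'.cell a = s.cell a := by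
  refine ⟨_, .seq (.setCell _ _ _) <| .seq (.rand _ _) <| .seq (.setCell _ _ _) <|
    .seq (.setCell _ _ _) <| .seq (.setCell _ _ _) <| .setReg _ _ _, ?_⟩
  have h9 : (9 : ℕ) ≠ 100 + s.reg 1 := by omega
  simp only [State.tick, NatExp.eval, RealExp.eval, RealExp.eval_at, RealExp.eval_num,
    Function.update_self, Function.update_of_ne, ne_eq, h9,
    Nat.reduceEqDiff, not_false_eq_true, Nat.cast_ofNat, Nat.cast_one, Nat.cast_zero]
  refine ⟨trivial, trivial, trivial, trivial, ?_, trivial, trivial, ?_, ?_⟩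
  · simp only [shiftLength]
  · simp only [Function.update_apply]
    grind
  · intro a ha
    simp only [Function.update_apply]
    grind

theorem exec_searchRotate (s : State) : ∃ s', Exec y ω searchRotate s s' ∧
    s'.reg = s.reg ∧ s'.drawn = s.drawn ∧ s'.samples = s.samples ∧ s'.steps = s.steps + 3 ∧
    s'.cell 20 = s.cell 18 * Real.cos (2 * Real.pi * s.cell 8 * s.cell 10) +
      s.cell 19 * Real.sin (2 * Real.pi * s.cell 8 * s.cell 10) ∧
    s'.cell 21 = s.cell 19 * Real.cos (2 * Real.pi * s.cell 8 * s.cell 10) -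
      s.cell 18 * Real.sin (2 * Real.pi * s.cell 8 * s.cell 10) ∧
    ∀ a, a < 20 ∨ 22 < a → s'.cell a = s.cell a := by
  refine ⟨_, .seq (.setCell _ _ _) <| .seq (.setCell _ _ _) <| .setCell _ _ _, ?_⟩
  simp only [State.tick, NatExp.eval, RealExp.eval, RealExp.eval_at, RealExp.eval_num,
    Function.update_self, Function.update_of_ne, ne_eq,
    Nat.reduceEqDiff, not_false_eq_true, Nat.cast_ofNat]
  refine ⟨trivial, trivial, trivial, trivial, trivial, trivial, ?_⟩
  intro a ha
  simp only [Function.update_apply]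
  grind

open Classical in
theorem exec_searchUpdate (s : State) : ∃ s', Exec y ω searchUpdate s s' ∧
    s'.reg = Function.update s.reg 1 (s.reg 1 + 1) ∧ s'.drawn = s.drawn ∧
    s'.samples = s.samples ∧ s'.steps ≤ s.steps + 5 ∧
    (s'.cell 8, s'.cell 9) = (if 10000 * |s.cell 21| ≤ s.cell 20 then
      (s.cell 8 + s.cell 21 / s.cell 20 / (2 * Real.pi * s.cell 10),
        if s.cell 5 ≤ s.cell 9 / 2 then s.cell 9 / 2 else s.cell 9)
      else if s.cell 0 ≤ s.cell 9 then (0, s.cell 9) else (s.cell 8, 2 * s.cell 9)) ∧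
    ∀ a, a ≠ 8 → a ≠ 9 → s'.cell a = s.cell a := by
  have hA : (Test.realLe (.mul (.num 10000) (.sqrt (.mul (.at 21) (.at 21)))) (.at 20)).holds s ↔
      10000 * |s.cell 21| ≤ s.cell 20 := by
    simp [Test.holds, RealExp.eval, RealExp.eval_at, RealExp.eval_num, Real.sqrt_mul_self_eq_abs]
  by_cases h1 : 10000 * |s.cell 21| ≤ s.cell 20
  · by_cases h2 : s.cell 5 ≤ s.cell 9 / 2
    · refine ⟨_, .seq (.iteTrue (hA.2 h1) (.seq (.setCell _ _ _)
        (.iteTrue ?_ (.setCell _ _ _)))) (.setReg _ _ _), ?_⟩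
      · simpa [Test.holds, RealExp.eval, RealExp.eval_at, RealExp.eval_num, State.tick,
          NatExp.eval] using h2
      · simp +contextual [State.tick, NatExp.eval, RealExp.eval, RealExp.eval_at,
          RealExp.eval_num, h1, h2, Function.update_of_ne]
    · refine ⟨_, .seq (.iteTrue (hA.2 h1) (.seq (.setCell _ _ _)
        (.iteFalse ?_ (.skip _)))) (.setReg _ _ _), ?_⟩
      · simpa [Test.holds, RealExp.eval, RealExp.eval_at, RealExp.eval_num, State.tick,
          NatExp.eval] using h2
      · simp +contextual [State.tick, NatExp.eval, RealExp.eval, RealExp.eval_at,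
          RealExp.eval_num, h1, h2, Function.update_of_ne]
  · by_cases h2 : s.cell 0 ≤ s.cell 9
    · refine ⟨_, .seq (.iteFalse (mt hA.1 h1) (.iteTrue ?_ (.setCell _ _ _))) (.setReg _ _ _), ?_⟩
      · simpa [Test.holds, RealExp.eval_at, State.tick] using h2
      · simp +contextual [State.tick, NatExp.eval, RealExp.eval_num, h1, h2,
          Function.update_of_ne]
    · refine ⟨_, .seq (.iteFalse (mt hA.1 h1) (.iteFalse ?_ (.setCell _ _ _))) (.setReg _ _ _), ?_⟩
      · simpa [Test.holds, RealExp.eval_at, State.tick] using h2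
      · simp +contextual [State.tick, NatExp.eval, RealExp.eval, RealExp.eval_at,
          RealExp.eval_num, h1, h2, Function.update_of_ne]

/-- The bridge from machine to mathematics: a pass acts on the cells 8 and 9 as `walkStep`, fed with
the random reals not yet drawn. -/
theorem exec_searchBody {m : ℕ} {s : State} (hm : ∀ j : ℕ, (j : ℝ) ≤ s.cell 7 ↔ j < m) :
    ∃ s', Exec y ω searchBody s s' ∧
      s'.reg 1 = s.reg 1 + 1 ∧ s'.drawn = s.drawn + (m + 1) ∧
      s'.samples = s.samples + 2 * m ∧ s'.steps ≤ s.steps + (9 * m + 15) ∧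
      (s'.cell 8, s'.cell 9) = walkStep y (s.cell 4) (s.cell 1) (s.cell 0) (s.cell 5) m
        (s.cell 8, s.cell 9) (tailFrom s.drawn ω) ∧
      s'.cell (100 + s.reg 1) = s.cell 8 ∧
      ∀ a, a < 8 ∨ 100 ≤ a ∧ a ≠ 100 + s.reg 1 → s'.cell a = s.cell a := by
  obtain ⟨s₁, e₁, r₁, d₁, n₁, t₁, c10, c18, c19, cs, fr₁⟩ := exec_searchPrologue (y := y) (ω := ω) s
  obtain ⟨s₂, e₂, r₂, d₂, n₂, t₂, z18, z19, fr₂⟩ := exec_correlationLoop (y := y) (ω := ω) (m := m)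
    (s := s₁) (by simpa only [fr₁ 7 (by norm_num)] using hm) (by simp [r₁]) c18 c19
  obtain ⟨s₃, e₃, r₃, d₃, n₃, t₃, p20, p21, fr₃⟩ := exec_searchRotate (y := y) (ω := ω) s₂
  obtain ⟨s₄, e₄, r₄, d₄, n₄, t₄, u, fr₄⟩ := exec_searchUpdate (y := y) (ω := ω) s₃
  have low : ∀ a, a < 10 → s₃.cell a = s.cell a := fun a ha => by
    rw [fr₃ a (by omega), fr₂ a (by omega), fr₁ a (by omega)]
  have low₂ : ∀ a, a < 10 → s₁.cell a = s.cell a := fun a ha => fr₁ a (by omega)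
  have hreg : s₃.reg 1 = s.reg 1 := by
    rw [r₃, r₂ 1 (by norm_num), r₁, Function.update_of_ne (by norm_num)]
  have h10 : s₂.cell 10 = shiftLength (s.cell 9) (ω s.drawn) := by rw [fr₂ 10 (by norm_num), c10]
  have h10' : s₃.cell 10 = shiftLength (s.cell 9) (ω s.drawn) := by rw [fr₃ 10 (by norm_num), h10]
  have h8 : s₂.cell 8 = s.cell 8 := by rw [fr₂ 8 (by norm_num), low₂ 8 (by norm_num)]
  have hsum : (∑ i ∈ Finset.range m,
      correlationTerm y (s₁.cell 4) (s₁.cell 1) (s₁.cell 10) (ω (s₁.drawn + i))) =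
      correlation y (s.cell 4) (s.cell 1) (shiftLength (s.cell 9) (tailFrom s.drawn ω 0)) m
        (tailFrom s.drawn ω) := by
    unfold correlation
    refine Finset.sum_congr rfl fun i _ => ?_
    rw [low₂ 4 (by norm_num), low₂ 1 (by norm_num), c10, d₁]
    simp only [tailFrom, add_zero]
    congr 3
    ring
  have hP : s₃.cell 20 = rotatedRe y (s.cell 4) (s.cell 1) m (s.cell 8, s.cell 9)
      (tailFrom s.drawn ω) := by
    rw [p20, z18, z19, hsum, h8, h10]
    rfl
  have hQ : s₃.cell 21 = rotatedIm y (s.cell 4) (s.cell 1) m (s.cell 8, s.cell 9)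
      (tailFrom s.drawn ω) := by
    rw [p21, z18, z19, hsum, h8, h10]
    rfl
  refine ⟨s₄, .seq e₁ (.seq e₂ (.seq e₃ e₄)), ?_, ?_, ?_, ?_, ?_, ?_, ?_⟩
  · rw [r₄, Function.update_self, hreg]
  · omega
  · omega
  · omega
  · rw [u, hP, hQ, h10', low 8 (by norm_num), low 9 (by norm_num), low 5 (by norm_num),
      low 0 (by norm_num)]
    rfl
  · rw [fr₄ _ (by omega) (by omega), fr₃ _ (by omega), fr₂ _ (by omega), cs]
  · intro a ha
    rw [fr₄ _ (by omega) (by omega), fr₃ _ (by omega), fr₂ _ (by omega), fr₁ a (by omega)]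

theorem exec_searchLoop {m N : ℕ} {s : State} (hm : ∀ j : ℕ, (j : ℝ) ≤ s.cell 7 ↔ j < m)
    (hN : ∀ j : ℕ, (j : ℝ) ≤ s.cell 6 ↔ j < N) (hr : s.reg 1 = 0) (hd : s.drawn = 0)
    (h8 : s.cell 8 = 0) (h9 : s.cell 9 = s.cell 0) :
    ∃ s', Exec y ω searchLoop s s' ∧ s'.reg 1 = N ∧
      s'.samples = s.samples + 2 * m * N ∧ s'.steps ≤ s.steps + (9 * m + 16) * N + 1 ∧
      (∀ i < N, s'.cell (100 + i) =
        (trajectory y (s.cell 4) (s.cell 1) (s.cell 0) (s.cell 5) m ω i).1) ∧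
      ∀ a < 8, s'.cell a = s.cell a := by
  obtain ⟨s', he, h⟩ := Exec.loop_of_invariant (y := y) (ω := ω)
    (b := .realLe (.ofNat (.reg 1)) (.at 6)) (p := searchBody) (n := N) (s := s)
    -- The count of drawn reals matches the offset j(m+1) in the definition of `trajectory`.
    (fun j t => t.reg 1 = j ∧ t.drawn = j * (m + 1) ∧
      t.samples = s.samples + 2 * m * j ∧ t.steps ≤ s.steps + (9 * m + 16) * j ∧
      (t.cell 8, t.cell 9) = trajectory y (s.cell 4) (s.cell 1) (s.cell 0) (s.cell 5) m ω j ∧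
      (∀ i < j, t.cell (100 + i) =
        (trajectory y (s.cell 4) (s.cell 1) (s.cell 0) (s.cell 5) m ω i).1) ∧
      ∀ a < 8, t.cell a = s.cell a)
    (by
      rintro j hj t ⟨h1, hd, hsa, hst, htr, hc, hfr⟩
      refine ⟨?_, ?_⟩
      · change ((t.reg 1 : ℕ) : ℝ) ≤ t.cell 6
        rw [h1, hfr 6 (by norm_num)]
        exact (hN j).2 hj
      obtain ⟨t', he, hreg', hd', hsa', hst', hw', hc', hfr'⟩ :=
        exec_searchBody (y := y) (ω := ω) (m := m) (s := t.tick)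
          (by simpa only [State.tick, hfr 7 (by norm_num)] using hm)
      simp only [State.tick] at hreg' hd' hsa' hst' hw' hc' hfr'
      refine ⟨t', he, by omega, ?_, ?_, ?_, ?_, ?_, ?_⟩
      · rw [hd', hd]; ring
      · rw [hsa', hsa]; ring
      · refine hst'.trans ?_
        rw [mul_add, mul_one]
        omega
      · rw [hw', htr, hd, hfr 4 (by norm_num), hfr 1 (by norm_num), hfr 0 (by norm_num),
          hfr 5 (by norm_num)]
        rfl
      · intro i hi
        rcases Nat.lt_succ_iff_lt_or_eq.1 hi with hi | rfl
        · rw [hfr' _ (by omega), hc i hi]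
        · rw [← h1, hc', h1, ← htr]
      · intro a ha
        rw [hfr' a (by omega), hfr a ha])
    (by
      rintro t ⟨h1, -, -, -, -, -, hfr⟩
      change ¬ ((t.reg 1 : ℕ) : ℝ) ≤ t.cell 6
      rw [h1, hfr 6 (by norm_num), hN]
      exact lt_irrefl N)
    ⟨hr, by omega, rfl, le_rfl, by rw [h8, h9]; rfl, fun i hi => absurd hi (Nat.not_lt_zero i),
      fun _ _ => rfl⟩
  obtain ⟨h1, -, hsa, hst, -, hc, hfr⟩ := h
  exact ⟨s'.tick, he, h1, hsa, Nat.succ_le_succ hst, hc, hfr⟩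

theorem exec_countBody (s : State) : ∃ s', Exec y ω countBody s s' ∧
    s'.cell = s.cell ∧ s'.samples = s.samples ∧ s'.steps ≤ s.steps + 3 ∧
    s'.reg 1 = s.reg 1 ∧ s'.reg 3 = s.reg 3 ∧ s'.reg 4 = s.reg 4 + 1 ∧
    ((s.cell (100 + s.reg 4) - s.cell (100 + s.reg 3)) *
      (s.cell (100 + s.reg 4) - s.cell (100 + s.reg 3)) ≤
        (4 * s.cell 5) * (4 * s.cell 5) → s'.reg 5 = s.reg 5 + 1) ∧
    (¬ (s.cell (100 + s.reg 4) - s.cell (100 + s.reg 3)) *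
      (s.cell (100 + s.reg 4) - s.cell (100 + s.reg 3)) ≤
        (4 * s.cell 5) * (4 * s.cell 5) → s'.reg 5 = s.reg 5) := by
  by_cases h : (s.cell (100 + s.reg 4) - s.cell (100 + s.reg 3)) *
      (s.cell (100 + s.reg 4) - s.cell (100 + s.reg 3)) ≤ (4 * s.cell 5) * (4 * s.cell 5)
  · refine ⟨_, .seq (.iteTrue ?_ (.setReg _ _ _)) (.setReg _ _ _), ?_⟩
    · simpa only [Test.holds, distanceExp, RealExp.eval, RealExp.eval_at, RealExp.eval_num,
        NatExp.eval, Nat.cast_ofNat] using h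
    · simp [State.tick, NatExp.eval, h]
  · refine ⟨_, .seq (.iteFalse ?_ (.skip _)) (.setReg _ _ _), ?_⟩
    · simpa only [Test.holds, distanceExp, RealExp.eval, RealExp.eval_at, RealExp.eval_num,
        NatExp.eval, Nat.cast_ofNat] using h
    · simp [State.tick, NatExp.eval, h]

theorem exec_countLoop {N : ℕ} {s : State} (h1 : s.reg 1 = N) (h4 : s.reg 4 = 0)
    (h5 : s.reg 5 = 0) : ∃ s', Exec y ω countLoop s s' ∧
      s'.cell = s.cell ∧ s'.samples = s.samples ∧ s'.steps ≤ s.steps + 4 * N + 1 ∧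
      s'.reg 1 = N ∧ s'.reg 3 = s.reg 3 ∧
      s'.reg 5 = closeCount (fun i => s.cell (100 + i)) (4 * s.cell 5) N (s.reg 3) := by
  obtain ⟨s', he, h⟩ := Exec.loop_of_invariant (y := y) (ω := ω)
    (b := .natLe (.add (.reg 4) (.lit 1)) (.reg 1)) (p := countBody) (n := N) (s := s)
    (fun j t => t.reg 4 = j ∧ t.reg 1 = N ∧ t.reg 3 = s.reg 3 ∧ t.cell = s.cell ∧
      t.samples = s.samples ∧ t.steps ≤ s.steps + 4 * j ∧
      t.reg 5 = closeCount (fun i => s.cell (100 + i)) (4 * s.cell 5) j (s.reg 3))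
    (by
      rintro j hj t ⟨r4, r1, r3, hc, hsa, hst, r5⟩
      refine ⟨?_, ?_⟩
      · change t.reg 4 + 1 ≤ t.reg 1
        omega
      obtain ⟨t', he, hc', hsa', hst', r1', r3', r4', r5', r5''⟩ :=
        exec_countBody (y := y) (ω := ω) t.tick
      simp only [State.tick] at hc' hsa' hst' r1' r3' r4' r5' r5''
      refine ⟨t', he, by omega, by omega, by omega, hc'.trans hc, hsa'.trans hsa, by omega, ?_⟩
      rw [hc, r4, r3] at r5' r5''
      rw [closeCount, Finset.range_add_one, Finset.filter_insert]
      split_ifs with h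
      · rw [Finset.card_insert_of_notMem (by simp), r5' h, r5]
        rfl
      · rw [r5'' h, r5]
        rfl)
    (by
      rintro t ⟨r4, r1, -⟩
      change ¬ t.reg 4 + 1 ≤ t.reg 1
      omega)
    ⟨h4, h1, rfl, rfl, rfl, le_rfl, by simpa [closeCount] using h5⟩
  obtain ⟨-, r1, r3, hc, hsa, hst, r5⟩ := h
  exact ⟨s'.tick, he, hc, hsa, Nat.succ_le_succ hst, r1, r3, r5⟩

theorem exec_selectBody {N : ℕ} {s : State} (h1 : s.reg 1 = N) :
    ∃ s', Exec y ω selectBody s s' ∧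
      s'.samples = s.samples ∧ s'.steps ≤ s.steps + 4 * N + 6 ∧
      s'.reg 1 = N ∧ s'.reg 3 = s.reg 3 + 1 ∧ (∀ a, a ≠ 0 → s'.cell a = s.cell a) ∧
      (N < 2 * closeCount (fun i => s.cell (100 + i)) (4 * s.cell 5) N (s.reg 3) →
        s'.cell 0 = s.cell (100 + s.reg 3)) ∧
      (¬ N < 2 * closeCount (fun i => s.cell (100 + i)) (4 * s.cell 5) N (s.reg 3) →
        s'.cell 0 = s.cell 0) := by
  obtain ⟨s₁, e₁, c₁, n₁, t₁, r1, r3, r5⟩ := exec_countLoop (y := y) (ω := ω) (N := N)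
    (s := { s with
      reg := Function.update (Function.update s.reg 4 0) 5 0
      steps := s.steps + 1 + 1 }) (by simpa using h1) (by simp) (by simp)
  simp only at c₁ n₁ t₁ r3 r5
  rw [Function.update_of_ne (by norm_num), Function.update_of_ne (by norm_num)] at r3 r5
  by_cases h : N < 2 * closeCount (fun i => s.cell (100 + i)) (4 * s.cell 5) N (s.reg 3)
  · refine ⟨_, .seq (.setReg _ _ _) (.seq (.setReg _ _ _) (.seq e₁
      (.seq (.iteTrue ?_ (.setCell _ _ _)) (.setReg _ _ _)))), ?_⟩
    · change s₁.reg 1 + 1 ≤ s₁.reg 5 + s₁.reg 5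
      omega
    · refine ⟨by simp [State.tick, n₁], by simp only [State.tick]; omega,
        by simpa [State.tick] using r1, by simp [State.tick, NatExp.eval, r3], ?_, ?_⟩
      · intro a ha
        simp [State.tick, NatExp.eval, ha, c₁]
      · simp [State.tick, NatExp.eval, RealExp.eval, h, c₁, r3]
  · refine ⟨_, .seq (.setReg _ _ _) (.seq (.setReg _ _ _) (.seq e₁
      (.seq (.iteFalse ?_ (.skip _)) (.setReg _ _ _)))), ?_⟩
    · change ¬ s₁.reg 1 + 1 ≤ s₁.reg 5 + s₁.reg 5
      omega
    · refine ⟨by simp [State.tick, n₁], by simp only [State.tick]; omega,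
        by simpa [State.tick] using r1, by simp [State.tick, NatExp.eval, r3], ?_, ?_⟩
      · intro a ha
        simp [State.tick, c₁]
      · simp [State.tick, h, c₁]

/-- The output overwrites cell 0, which is harmless because the comparisons read only cell 5 and the
candidates. The last qualifying candidate is the one that remains. -/
theorem exec_selectLoop {N : ℕ} {s : State} (h1 : s.reg 1 = N) (h3 : s.reg 3 = 0) :
    ∃ s', Exec y ω selectLoop s s' ∧
      s'.samples = s.samples ∧ s'.steps ≤ s.steps + (4 * N + 7) * N + 1 ∧
      ((∃ t < N, N < 2 * closeCount (fun i => s.cell (100 + i)) (4 * s.cell 5) N t) →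
        ∃ t < N, N < 2 * closeCount (fun i => s.cell (100 + i)) (4 * s.cell 5) N t ∧
          s'.cell 0 = s.cell (100 + t)) := by
  obtain ⟨s', he, h⟩ := Exec.loop_of_invariant (y := y) (ω := ω)
    (b := .natLe (.add (.reg 3) (.lit 1)) (.reg 1)) (p := selectBody) (n := N) (s := s)
    (fun j t => t.reg 3 = j ∧ t.reg 1 = N ∧ (∀ a, a ≠ 0 → t.cell a = s.cell a) ∧
      t.samples = s.samples ∧ t.steps ≤ s.steps + (4 * N + 7) * j ∧
      ((∃ i < j, N < 2 * closeCount (fun i => s.cell (100 + i)) (4 * s.cell 5) N i) →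
        ∃ i < j, N < 2 * closeCount (fun i => s.cell (100 + i)) (4 * s.cell 5) N i ∧
          t.cell 0 = s.cell (100 + i)))
    (by
      rintro j hj t ⟨r3, r1, hc, hsa, hst, hsel⟩
      refine ⟨?_, ?_⟩
      · change t.reg 3 + 1 ≤ t.reg 1
        omega
      obtain ⟨t', he, hsa', hst', r1', r3', hc', h0', h1'⟩ :=
        exec_selectBody (y := y) (ω := ω) (N := N) (s := t.tick) r1
      simp only [State.tick] at hsa' hst' r3' hc' h0' h1'
      have hfun : (fun i => t.cell (100 + i)) = fun i => s.cell (100 + i) :=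
        funext fun i => hc _ (by omega)
      rw [hfun, hc 5 (by norm_num), r3] at h0' h1'
      rw [hc (100 + j) (by omega)] at h0'
      refine ⟨t', he, by omega, r1', fun a ha => (hc' a ha).trans (hc a ha), hsa'.trans hsa, ?_, ?_⟩
      · rw [mul_add, mul_one]
        omega
      · rintro ⟨i, hi, hci⟩
        by_cases hcj : N < 2 * closeCount (fun i => s.cell (100 + i)) (4 * s.cell 5) N j
        · exact ⟨j, by omega, hcj, h0' hcj⟩
        · have hij : i < j := lt_of_le_of_ne (by omega) (by rintro rfl; exact hcj hci)
          obtain ⟨i', hi', hci', h0⟩ := hsel ⟨i, hij, hci⟩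
          exact ⟨i', by omega, hci', (h1' hcj).trans h0⟩)
    (by
      rintro t ⟨r3, r1, -⟩
      change ¬ t.reg 3 + 1 ≤ t.reg 1
      omega)
    ⟨h3, h1, fun _ _ => rfl, rfl, le_rfl, by rintro ⟨i, hi, -⟩; exact absurd hi (Nat.not_lt_zero i)⟩
  obtain ⟨-, -, -, hsa, hst, hsel⟩ := h
  exact ⟨s'.tick, he, hsa, Nat.succ_le_succ hst, hsel⟩

theorem closeCount_congr {c c' : ℕ → ℝ} {N t : ℕ} (h : ∀ i < N, c i = c' i) (r : ℝ) (ht : t < N) :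
    closeCount c r N t = closeCount c' r N t := by
  unfold closeCount
  congr 1
  refine Finset.filter_congr fun i hi => ?_
  rw [h i (Finset.mem_range.1 hi), h t ht]

theorem exec_searchInit (s : State) : ∃ s', Exec y ω searchInit s s' ∧
    s'.reg 1 = 0 ∧ s'.drawn = s.drawn ∧ s'.samples = s.samples ∧ s'.steps = s.steps + 5 ∧
    s'.cell 6 = 40 * Real.log (s.cell 0 / ((s.cell 2 + s.cell 4 / s.cell 1) * s.cell 3)) ∧
    s'.cell 7 = 24000 * (s.reg 0 * Real.log (2 * s.cell 4 + 1)) ∧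
    s'.cell 8 = 0 ∧ s'.cell 9 = s.cell 0 ∧ ∀ a < 6, s'.cell a = s.cell a := by
  refine ⟨_, .seq (.setCell _ _ _) <| .seq (.setCell _ _ _) <| .seq (.setCell _ _ _) <|
    .seq (.setCell _ _ _) <| .setReg _ _ _, ?_⟩
  simp only [State.tick, NatExp.eval, RealExp.eval, RealExp.eval_at, RealExp.eval_num,
    accuracyExp, logExp, Function.update_self, Function.update_of_ne, ne_eq,
    Nat.reduceEqDiff, not_false_eq_true, Nat.cast_ofNat, Nat.cast_one, Nat.cast_zero]
  refine ⟨trivial, trivial, trivial, trivial, ?_, ?_, ?_, ?_, ?_⟩ <;> try simp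
  intro a ha
  simp only [Function.update_apply]
  grind

theorem eval_resolution (k : ℕ) (F T Δ δ R : ℝ) :
    (RealExp.mul (.num (10 ^ 18)) accuracyExp).eval (initial k F T Δ δ R) =
      10 ^ 18 * (Δ + R / T) := by
  simp only [RealExp.eval, RealExp.eval_num, Nat.cast_pow, Nat.cast_ofNat]
  rfl

/-- The run of the algorithm when the range of frequencies is large. -/
theorem exec_locate_of_le {k m N : ℕ} {F T Δ δ R : ℝ} (h : 10 ^ 18 * (Δ + R / T) ≤ F)
    (hm : ∀ j : ℕ, (j : ℝ) ≤ 24000 * (k * Real.log (2 * R + 1)) ↔ j < m)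
    (hN : ∀ j : ℕ, (j : ℝ) ≤ 40 * Real.log (F / ((Δ + R / T) * δ)) ↔ j < N) :
    ∃ s', Exec y ω locate (initial k F T Δ δ R) s' ∧ s'.samples = 2 * m * N ∧
      s'.steps ≤ 10 + (9 * m + 16) * N + (4 * N + 7) * N ∧
      ((∃ t < N, N < 2 * closeCount
          (fun i => (trajectory y R T F (10 ^ 18 * (Δ + R / T)) m ω i).1)
          (4 * (10 ^ 18 * (Δ + R / T))) N t) →
        ∃ t < N, N < 2 * closeCount
          (fun i => (trajectory y R T F (10 ^ 18 * (Δ + R / T)) m ω i).1)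
          (4 * (10 ^ 18 * (Δ + R / T))) N t ∧
          s'.cell 0 = (trajectory y R T F (10 ^ 18 * (Δ + R / T)) m ω t).1) := by
  set s₀ : State := { (initial k F T Δ δ R).tick with
    cell := Function.update (initial k F T Δ δ R).cell 5 (10 ^ 18 * (Δ + R / T)) } with hs₀
  have e₀ : Exec y ω (.setCell (.lit 5) (.mul (.num (10 ^ 18)) accuracyExp))
      (initial k F T Δ δ R) s₀ := by
    have := Exec.setCell (y := y) (ω := ω) (.lit 5) (.mul (.num (10 ^ 18)) accuracyExp)
      (initial k F T Δ δ R)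
    rw [eval_resolution] at this
    exact this
  have c0 : s₀.cell 0 = F := by simp [hs₀, initial]
  have c1 : s₀.cell 1 = T := by simp [hs₀, initial]
  have c2 : s₀.cell 2 = Δ := by simp [hs₀, initial]
  have c3 : s₀.cell 3 = δ := by simp [hs₀, initial]
  have c4 : s₀.cell 4 = R := by simp [hs₀, initial]
  have c5 : s₀.cell 5 = 10 ^ 18 * (Δ + R / T) := by simp [hs₀]
  obtain ⟨s₁, e₁, r₁, d₁, n₁, t₁, i6, i7, i8, i9, fr₁⟩ :=
    exec_searchInit (y := y) (ω := ω) s₀.tick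
  have f0 : s₁.cell 0 = F := (fr₁ 0 (by norm_num)).trans c0
  have f1 : s₁.cell 1 = T := (fr₁ 1 (by norm_num)).trans c1
  have f4 : s₁.cell 4 = R := (fr₁ 4 (by norm_num)).trans c4
  have f5 : s₁.cell 5 = 10 ^ 18 * (Δ + R / T) := (fr₁ 5 (by norm_num)).trans c5
  simp only [State.tick, c0, c1, c2, c3, c4] at i6 i7 i9 d₁ n₁ t₁
  have hk : s₀.reg 0 = k := by simp [hs₀, initial, State.tick]
  rw [hk] at i7
  obtain ⟨s₂, e₂, r₂, n₂, t₂, tr₂, fr₂⟩ := exec_searchLoop (y := y) (ω := ω) (m := m) (N := N)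
    (s := s₁) (by simpa only [i7] using hm) (by simpa only [i6] using hN) r₁
    (by simp [d₁, hs₀, State.tick, initial]) i8 (by rw [i9, f0])
  rw [f0, f1, f4, f5] at tr₂
  obtain ⟨s₃, e₃, n₃, t₃, sel⟩ := exec_selectLoop (y := y) (ω := ω) (N := N)
    (s := { s₂.tick with reg := Function.update s₂.reg 3 0 })
    (by simpa [State.tick] using r₂) (by simp)
  simp only [State.tick] at n₃ t₃ sel
  rw [fr₂ 5 (by norm_num), f5] at sel
  refine ⟨s₃, .seq e₀ (.iteTrue ?_ (.seq e₁ (.seq e₂ (.seq (.setReg _ _ _) e₃)))), ?_, ?_, ?_⟩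
  · change s₀.cell 5 ≤ s₀.cell 0
    rwa [c5, c0]
  · rw [n₃, n₂, n₁]
    simp [hs₀, State.tick, initial]
  · have : s₀.steps = 1 := by simp [hs₀, State.tick, initial]
    omega
  · rintro ⟨t, ht, hc⟩
    obtain ⟨t', ht', hc', h0⟩ := sel ⟨t, ht, by rwa [closeCount_congr tr₂ _ ht]⟩
    exact ⟨t', ht', by rwa [closeCount_congr tr₂ _ ht'] at hc', h0.trans (tr₂ t' ht')⟩

/-- The run of the algorithm when the range of frequencies is small. -/
theorem exec_locate_of_lt {k : ℕ} {F T Δ δ R : ℝ} (h : F < 10 ^ 18 * (Δ + R / T)) :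
    ∃ s', Exec y ω locate (initial k F T Δ δ R) s' ∧ s'.samples = 0 ∧ s'.steps = 3 ∧
      s'.cell 0 = 0 := by
  refine ⟨_, .seq (.setCell _ _ _) (.iteFalse ?_ (.setCell _ _ _)), ?_⟩
  · change ¬ (Function.update (initial k F T Δ δ R).cell 5
      ((RealExp.mul (.num (10 ^ 18)) accuracyExp).eval (initial k F T Δ δ R)) 5 ≤
      Function.update (initial k F T Δ δ R).cell 5
        ((RealExp.mul (.num (10 ^ 18)) accuracyExp).eval (initial k F T Δ δ R)) 0)
    rw [eval_resolution, Function.update_self, Function.update_of_ne (by norm_num)]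
    exact not_le.2 h
  · simp [State.tick, RealExp.eval_num, NatExp.eval, initial]

end Semantics
end ClusteredSignal
end

noncomputable section

namespace ClusteredSignal

open MeasureTheory Set Finset ProbabilityTheory

/-! ### Positivity of the energy and numerical bounds -/

section Guarantees

variable {k : ℕ}

/-- The growth bound with M = 0 propagates vanishing on [-T,T] to the whole line, so a signal that
is nonzero anywhere has energy in the observed interval. -/
theorem integral_norm_sq_pos (hk : 1 ≤ k) (v : Fin k → ℂ) (f : Fin k → ℝ) {T : ℝ} (hT : 0 < T)
    (h : ∃ t, sparseSignal v f t ≠ 0) : 0 < ∫ s in (-T)..T, ‖sparseSignal v f s‖ ^ 2 := by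
  have h0 : 0 ≤ ∫ s in (-T)..T, ‖sparseSignal v f s‖ ^ 2 :=
    intervalIntegral.integral_nonneg (by linarith) fun _ _ => by positivity
  refine h0.lt_of_ne fun hz => ?_
  have hin : ∀ s ∈ Set.Icc (-T) T, ‖sparseSignal v f s‖ ≤ 0 := fun s hs => by
    have h1 := norm_sq_le_integral hk v f hT hs
    rw [← hz, mul_zero] at h1
    exact (pow_eq_zero_iff two_ne_zero).1 (le_antisymm h1 (by positivity)) |>.le
  have hout : ∀ f' : Fin k → ℝ, (∀ s ∈ Set.Icc 0 T, ‖sparseSignal v f' s‖ ≤ 0) → ∀ s ≥ T,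
      sparseSignal v f' s = 0 := fun f' h s hs => by
    have h1 := norm_sq_sparseSignal_growth hk v f' hT h hs
    rw [zero_pow two_ne_zero, zero_mul] at h1
    exact norm_eq_zero.1 ((pow_eq_zero_iff two_ne_zero).1 (le_antisymm h1 (by positivity)))
  obtain ⟨t, ht⟩ := h
  refine ht ?_
  rcases le_total T t with h1 | h1
  · exact hout f (fun s hs => hin s ⟨by linarith [hs.1], hs.2⟩) t h1
  rcases le_total t (-T) with h2 | h2
  · rw [← neg_neg t, sparseSignal_neg_time]
    refine hout _ (fun s hs => ?_) (-t) (by linarith)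
    rw [← sparseSignal_neg_time]
    exact hin _ ⟨by linarith [hs.2], by linarith [hs.1]⟩
  · exact norm_le_zero_iff.1 (hin t ⟨h2, h1⟩)

theorem lintegral_noise_le {v : Fin k → ℂ} {f : Fin k → ℝ} {η : ℝ → ℂ} {T ε : ℝ} (hT : 0 < T)
    (hε : 0 ≤ ε) (h : meanSq T η ≤ ENNReal.ofReal ε * meanSq T (sparseSignal v f)) :
    ∫⁻ t in Set.Icc (-T) T, ‖η t‖ₑ ^ 2 ≤
      ENNReal.ofReal (ε * ∫ s in (-T)..T, ‖sparseSignal v f s‖ ^ 2) := by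
  rw [meanSq_sparseSignal v f hT, meanSq, ENNReal.div_le_iff (by simpa using hT) ENNReal.ofReal_ne_top,
    ← ENNReal.ofReal_mul hε, ← ENNReal.ofReal_mul' (by positivity)] at h
  refine h.trans (le_of_eq ?_)
  congr 1
  field_simp

theorem le_iff_lt_floor_add_one {x : ℝ} (hx : 0 ≤ x) (j : ℕ) : (j : ℝ) ≤ x ↔ j < ⌊x⌋₊ + 1 := by
  rw [← Nat.le_floor_iff hx, Nat.lt_succ_iff]

/-- From R ≤ 16k³ one gets 2R + 1 ≤ 2⁶(k+1)³ ≤ (k+1)⁹. -/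
theorem log_worstRatio_le (hk : 1 ≤ k) (F : ℝ) {T : ℝ} (hT : 0 < T) :
    Real.log (2 * (worstRatio k F T).toReal + 1) ≤ 9 * Real.log (k + 1) := by
  have h1 := toReal_worstRatio_le hk F hT
  have hk1 : (1 : ℝ) ≤ k := by exact_mod_cast hk
  have h0 : 0 ≤ (worstRatio k F T).toReal := ENNReal.toReal_nonneg
  rw [show (9 : ℝ) = (9 : ℕ) by norm_num, ← Real.log_pow]
  refine Real.log_le_log (by positivity) ?_
  calc 2 * (worstRatio k F T).toReal + 1 ≤ 33 * k ^ 3 := by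
        have : (1 : ℝ) ≤ k ^ 3 := one_le_pow₀ hk1
        linarith
    _ ≤ 2 ^ 6 * (k + 1) ^ 3 := by gcongr <;> linarith
    _ ≤ (k + 1) ^ 6 * (k + 1) ^ 3 := by gcongr; linarith
    _ = _ := by ring

theorem log_two_le_log_add_one (hk : 1 ≤ k) : 0.69 ≤ Real.log ((k : ℝ) + 1) := by
  have h1 : Real.log 2 ≤ Real.log ((k : ℝ) + 1) :=
    Real.log_le_log (by norm_num) (by have : (1 : ℝ) ≤ k := by exact_mod_cast hk
                                      linarith)
  linarith [Real.log_two_gt_d9]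

/-- The number of samples per step of the search. -/
theorem cast_sampleNumber_le (hk : 1 ≤ k) (F : ℝ) {T : ℝ} (hT : 0 < T) :
    ((⌊24000 * (k * Real.log (2 * (worstRatio k F T).toReal + 1))⌋₊ + 1 : ℕ) : ℝ) ≤
      220000 * (k * Real.log (k + 1)) := by
  have hk1 : (1 : ℝ) ≤ k := by exact_mod_cast hk
  have h0 : 0 ≤ (worstRatio k F T).toReal := ENNReal.toReal_nonneg
  have hl := log_two_le_log_add_one hk
  have h1 := log_worstRatio_le hk F hT
  have h2 : 0 ≤ Real.log (2 * (worstRatio k F T).toReal + 1) := Real.log_nonneg (by linarith)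
  have h3 := Nat.floor_le (show 0 ≤ 24000 * (k * Real.log (2 * (worstRatio k F T).toReal + 1)) by
    positivity)
  push_cast
  have h4 : (k : ℝ) * Real.log (2 * (worstRatio k F T).toReal + 1) ≤
    k * (9 * Real.log (k + 1)) := by gcongr
  have h5 : 0.69 ≤ (k : ℝ) * Real.log (k + 1) := by nlinarith
  linarith

/-- The search needs only order k ℓ Λ samples; ℓ ≥ 0.69 turns ℓ into 2ℓ². -/
theorem samples_le {m N : ℕ} {ℓ Λ : ℝ} (hℓ : 0.69 ≤ ℓ) (hΛ : 1 ≤ Λ)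
    (hm : (m : ℝ) ≤ 220000 * (k * ℓ)) (hN : (N : ℝ) ≤ 41 * Λ) :
    ((2 * m * N : ℕ) : ℝ) ≤ 8 * 10 ^ 18 * (k * ℓ ^ 2 * Λ) := by
  push_cast
  have h1 : (m : ℝ) ≤ 440000 * (k * ℓ ^ 2) := by
    refine hm.trans ?_
    have : (k : ℝ) * ℓ ≤ 2 * (k * ℓ ^ 2) := by
      have : (k : ℝ) * ℓ * 1 ≤ k * ℓ * (2 * ℓ) := by gcongr; linarith
      linarith
    linarith
  calc 2 * (m : ℝ) * N ≤ 2 * (440000 * (k * ℓ ^ 2)) * (41 * Λ) := by gcongr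
    _ = 36080000 * (k * ℓ ^ 2 * Λ) := by ring
    _ ≤ _ := by gcongr; norm_num

/-- The search contributes mN and the pairwise comparison of candidates N²; both are at most
quadratic in k(1 + Λ). -/
theorem steps_le (hk : 1 ≤ k) {m N n : ℕ} {ℓ Λ : ℝ} (hℓ : ℓ ≤ k) (hΛ : 1 ≤ Λ)
    (hm : (m : ℝ) ≤ 220000 * (k * ℓ)) (hN : (N : ℝ) ≤ 41 * Λ)
    (hn : n ≤ 10 + (9 * m + 16) * N + (4 * N + 7) * N) :
    (n : ℝ) ≤ 8 * 10 ^ 18 * (k * (1 + Λ)) ^ 2 := by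
  have hk1 : (1 : ℝ) ≤ k := by exact_mod_cast hk
  have h1 : (n : ℝ) ≤ 10 + (9 * m + 16) * N + (4 * N + 7) * N := by exact_mod_cast hn
  have h2 : (m : ℝ) ≤ 220000 * k ^ 2 := by
    refine hm.trans ?_
    rw [pow_two]
    gcongr
  set x : ℝ := k * (1 + Λ) with hx
  have hx1 : 1 ≤ x := by nlinarith
  have hNx : (N : ℝ) ≤ 41 * x := by nlinarith
  have hxx : x ≤ x ^ 2 := by nlinarith
  have hmN : (m : ℝ) * N ≤ 220000 * 41 * x ^ 2 := by
    calc (m : ℝ) * N ≤ 220000 * k ^ 2 * (41 * Λ) := by gcongr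
      _ = 220000 * 41 * (k ^ 2 * Λ) := by ring
      _ ≤ 220000 * 41 * (k ^ 2 * (1 + Λ) ^ 2) := by gcongr; nlinarith
      _ = _ := by rw [hx]; ring
  have hNN : (N : ℝ) * N ≤ 1681 * x ^ 2 := by
    calc (N : ℝ) * N ≤ (41 * x) * (41 * x) := by gcongr
      _ = _ := by ring
  have h3 : (n : ℝ) ≤ 10 + 9 * (m * N) + 23 * N + 4 * (N * N) := by linarith
  calc (n : ℝ) ≤ 10 ^ 9 * x ^ 2 := by linarith
    _ ≤ _ := by gcongr; norm_num

end Guarantees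

/-! ### Assembly of the guarantees -/

section Main

variable {k : ℕ} {F T Δ δ R f₀ : ℝ} {v : Fin k → ℂ} {f : Fin k → ℝ} {η y : ℝ → ℂ}

/-- The probability that the search ends far from the central frequency. -/
theorem measure_locate_fails_le (hk : 1 ≤ k) (hF : 0 < F) (hT : 0 < T) (hΔ : 0 ≤ Δ) (hδ : 0 < δ)
    (hδ1 : δ < 1) (hR : R = (worstRatio k F T).toReal) (hwF : 10 ^ 18 * (Δ + R / T) ≤ F)
    (hf₀ : f₀ ∈ Set.Icc (-F) F) (hf : ∀ i, f i ∈ Set.Icc (f₀ - Δ) (f₀ + Δ))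
    (hg : ∃ t, sparseSignal v f t ≠ 0) (hη : Measurable η)
    (hηb : meanSq T η ≤ ENNReal.ofReal (1 / 10 ^ 21) * meanSq T (sparseSignal v f))
    (hy : y = observed T (fun t => sparseSignal v f t + η t)) {m N : ℕ}
    (hm : ∀ j : ℕ, (j : ℝ) ≤ 24000 * (k * Real.log (2 * R + 1)) ↔ j < m)
    (hN : ∀ j : ℕ, (j : ℝ) ≤ 40 * Real.log (F / ((Δ + R / T) * δ)) ↔ j < N) :
    coinLaw {ω | ¬ ∃ s : State, Exec y ω locate (initial k F T Δ δ R) s ∧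
      |f₀ - s.cell 0| ≤ 8 * 10 ^ 18 * (Δ + R / T)} ≤ ENNReal.ofReal δ := by
  have hR1 : 1 ≤ R := hR ▸ one_le_toReal_worstRatio hk hF hT
  set D := Δ + R / T with hD
  have hD0 : 0 < D := by positivity
  have hΔF : Δ ≤ F := by
    have : Δ ≤ D := by rw [hD]; linarith [show 0 < R / T by positivity]
    linarith
  have hw0 : 0 < 10 ^ 18 * D := by positivity
  have hym : Measurable y := by
    rw [hy]
    exact ((continuous_sparseSignal v f).measurable.add hη).indicator measurableSet_Icc
  have hmR : 24000 * (k * Real.log (2 * R + 1)) ≤ m := by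
    by_contra h
    exact lt_irrefl m ((hm m).1 (not_le.1 h).le)
  have hNR : 40 * Real.log (F / (D * δ)) ≤ N := by
    by_contra h
    exact lt_irrefl N ((hN N).1 (not_le.1 h).le)
  have hp : ∀ s : ℝ × ℝ, 10 ^ 18 * D ≤ s.2 →
      coinLaw {ω | ¬ StepCorrect y R T m f₀ s ω} ≤ ENNReal.ofReal (1 / 500) := fun s hs =>
    measure_not_stepCorrect_le hk v hT hF hΔ hΔF hR hf hη (integral_norm_sq_pos hk v f hT hg)
      (lintegral_noise_le hT (by positivity) hηb) hy hmR hs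
  have hsplit : Real.log (F / (D * δ)) = Real.log (F / D) - Real.log δ := by
    rw [← div_div, Real.log_div (by positivity) hδ.ne']
  have hFD : 1 ≤ F / D := by
    rw [one_le_div hD0]
    linarith
  have hlogF : 0 ≤ Real.log (F / D) := Real.log_nonneg hFD
  have hlogδ : Real.log δ < 0 := Real.log_neg hδ hδ1
  obtain ⟨L, hL, hL', hLlog⟩ := exists_depth hw0 hwF
  -- Here L ≤ 2 log(F/D), while N ≥ 40(log(F/D) − log δ), and log δ < 0 makes the inequality strict.
  have hLN : 10 * L < 3 * N := by
    have h1 : Real.log (F / (10 ^ 18 * D)) ≤ Real.log (F / D) := by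
      refine Real.log_le_log (by positivity) ?_
      gcongr
      linarith
    have h2 := Real.log_two_gt_d9
    have h3 : (0 : ℝ) ≤ L := by positivity
    have h4 : (L : ℝ) * 0.5 ≤ L * Real.log 2 := by gcongr; linarith
    have : (10 * L : ℝ) < 3 * N := by linarith
    exact_mod_cast this
  calc coinLaw {ω | ¬ ∃ s : State, Exec y ω locate (initial k F T Δ δ R) s ∧
        |f₀ - s.cell 0| ≤ 8 * 10 ^ 18 * D}
      ≤ coinLaw {ω | N < 40 * wrongCount y R T F (10 ^ 18 * D) m f₀ N ω} := by
        refine measure_mono fun ω hω => ?_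
        simp only [Set.mem_ofPred_eq] at hω ⊢
        by_contra hfew
        apply hω
        have hgood := card_good_candidates (y := y) (R := R) (T := T) (m := m) (ω := ω) hF
          (abs_le.2 hf₀) hL hL' (not_lt.1 hfew) hLN
        rw [show 2 * (10 ^ 18 * D) = 4 * (10 ^ 18 * D) / 2 by ring] at hgood
        obtain ⟨s, hs, -, -, hsel⟩ := exec_locate_of_le (y := y) (ω := ω) hwF hm hN
        obtain ⟨t, -, htc, hout⟩ := hsel (exists_closeCount hgood)
        refine ⟨s, hs, ?_⟩
        rw [hout]
        refine (close_of_closeCount hgood (by positivity) htc).trans (le_of_eq ?_)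
        ring
    _ ≤ ENNReal.ofReal (Real.exp (-(N / 30))) :=
        measure_wrongCount_le hym hR1 hT hw0.le hwF hp N
    _ ≤ _ := by
        -- N/30 ≥ (4/3) log(F/(Dδ)) ≥ log(1/δ), because F ≥ D.
        refine ENNReal.ofReal_le_ofReal ?_
        rw [← Real.le_log_iff_exp_le hδ]
        linarith

end Main

end ClusteredSignal

end

theorem mainTheorem7 :
    -- one program and universal constants
    ∃ (P : Program) (ε A B C : ℝ) (a b c : ℕ), 0 < ε ∧ 0 < A ∧ 0 < B ∧ 0 < C ∧
      ∀ (k : ℕ) (F T Δ δ : ℝ), 1 ≤ k → 0 < F → 0 < T → 0 ≤ Δ → 0 < δ → δ < 1 →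
      ∀ R Δ' : ℝ, R = (worstRatio k F T).toReal →
      Δ' = Δ + A * R * Real.log (R + 1) ^ a / T →
        worstRatio k F T ≠ ⊤ ∧
        Δ' ≤ Δ + B * (k : ℝ) ^ 3 * Real.log (k + 1) ^ b / T ∧
        ∀ (f₀ : ℝ) (v : Fin k → ℂ) (f : Fin k → ℝ) (η : ℝ → ℂ),
          f₀ ∈ Set.Icc (-F) F →
          (∀ i, f i ∈ Set.Icc (f₀ - Δ) (f₀ + Δ)) →
          (∃ t, sparseSignal v f t ≠ 0) →
          Measurable η →
          meanSq T η ≤ ENNReal.ofReal ε * meanSq T (sparseSignal v f) →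
          ∀ y : ℝ → ℂ, y = observed T (fun t => sparseSignal v f t + η t) →
            -- every run halts within the sample bound, in polynomial time
            (∀ ω : ℕ → unitInterval, ∃ s : State, Exec y ω P (initial k F T Δ δ R) s ∧
              (s.samples : ℝ) ≤
                C * (k * Real.log (k + 1) ^ 2 * max 0 (Real.log (F / (Δ' * δ)))) ∧
              (s.steps : ℝ) ≤
                C * (k * (1 + max 0 (Real.log (F / (Δ' * δ))))) ^ c) ∧
            -- the probability that the output is not within `C * Δ'` of `f₀` is at most `δ`
            coinLaw {ω | ¬ ∃ s : State, Exec y ω P (initial k F T Δ δ R) s ∧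
              |f₀ - s.cell 0| ≤ C * Δ'} ≤ ENNReal.ofReal δ := by
  -- No logarithms are needed in Δ', so A = 1 and a = b = 0, and B = 16 comes from R ≤ 16k³. The
  -- selected candidate is within twice the radius 4 · 10¹⁸Δ' of f₀, which gives C; the same C
  -- exceeds the constants for samples and steps.
  refine ⟨locate, 1 / 10 ^ 21, 1, 16, 8 * 10 ^ 18, 0, 0, 2, by positivity, by positivity,
    by positivity, by positivity, ?_⟩
  intro k F T Δ δ hk hF hT hΔ hδ hδ1 R Δ' hR hΔ'
  rw [one_mul, pow_zero, mul_one] at hΔ'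
  subst hΔ'
  have hR1 : 1 ≤ R := hR ▸ one_le_toReal_worstRatio hk hF hT
  have hk1 : (1 : ℝ) ≤ k := by exact_mod_cast hk
  refine ⟨worstRatio_ne_top hk F hT, ?_, ?_⟩
  · rw [pow_zero, mul_one, hR]
    gcongr
    exact toReal_worstRatio_le hk F hT
  intro f₀ v f η hf₀ hf hg hη hηb y hy
  have hD0 : 0 < Δ + R / T := by positivity
  -- Above the threshold the logarithm is at least 1 and absorbs the rounding of the loop counts.
  -- Below it the logarithm may vanish or be negative; the program then takes no samples and outputs
  -- 0, which suffices as |f₀| ≤ F.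
  rcases le_or_gt (10 ^ 18 * (Δ + R / T)) F with hwF | hFw
  · set Λ := Real.log (F / ((Δ + R / T) * δ)) with hΛ
    have hΛ1 : 1 ≤ Λ := by
      rw [hΛ, Real.le_log_iff_exp_le (by positivity), le_div_iff₀ (by positivity)]
      have h1 := Real.exp_one_lt_three
      calc Real.exp 1 * ((Δ + R / T) * δ) ≤ 10 ^ 18 * ((Δ + R / T) * 1) := by
            gcongr
            linarith
        _ ≤ F := by rwa [mul_one]
    have hlog := log_two_mul_add_one_pos hR1
    have hm := le_iff_lt_floor_add_one (x := 24000 * (k * Real.log (2 * R + 1))) (by positivity)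
    have hN := le_iff_lt_floor_add_one (x := 40 * Λ) (by linarith)
    have hmle := cast_sampleNumber_le hk F hT
    rw [← hR] at hmle
    have hNle : ((⌊40 * Λ⌋₊ + 1 : ℕ) : ℝ) ≤ 41 * Λ := by
      have := Nat.floor_le (show 0 ≤ 40 * Λ by linarith)
      push_cast
      linarith
    refine ⟨fun ω => ?_, measure_locate_fails_le hk hF hT hΔ hδ hδ1 hR hwF hf₀ hf hg hη hηb hy
      hm hN⟩
    obtain ⟨s, hs, hsa, hst, -⟩ := exec_locate_of_le (y := y) (ω := ω) hwF hm hN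
    rw [max_eq_right (by linarith : 0 ≤ Λ)]
    refine ⟨s, hs, ?_, steps_le hk ?_ hΛ1 hmle hNle hst⟩
    · rw [hsa]
      exact samples_le (log_two_le_log_add_one hk) hΛ1 hmle hNle
    · have := Real.log_le_sub_one_of_pos (show (0 : ℝ) < k + 1 by positivity)
      linarith
  · have hrun : ∀ ω : ℕ → unitInterval, _ := fun ω =>
      exec_locate_of_lt (y := y) (ω := ω) (k := k) (δ := δ) hFw
    refine ⟨fun ω => ?_, ?_⟩
    · obtain ⟨s, hs, hsa, hst, -⟩ := hrun ω
      have hmax : 0 ≤ max 0 (Real.log (F / ((Δ + R / T) * δ))) := le_max_left _ _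
      refine ⟨s, hs, ?_, ?_⟩
      · rw [hsa, Nat.cast_zero]
        positivity
      · rw [hst]
        have h1 : 1 ≤ (k * (1 + max 0 (Real.log (F / ((Δ + R / T) * δ))))) ^ 2 :=
          one_le_pow₀ (by nlinarith)
        push_cast
        linarith
    · have hall : ∀ ω : ℕ → unitInterval, ∃ s : State,
          Exec y ω locate (initial k F T Δ δ R) s ∧
            |f₀ - s.cell 0| ≤ 8 * 10 ^ 18 * (Δ + R / T) := fun ω => by
        obtain ⟨s, hs, -, -, h0⟩ := hrun ω
        refine ⟨s, hs, ?_⟩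
        rw [h0, sub_zero]
        exact (abs_le.2 hf₀).trans (by linarith)
      simp [hall]
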